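/- Let $n\ge 3$ and $M\ge 1$ be integers, $\kappa>0$, and let $a_j>0$ and $P_j\le Q_j$ be real numbers $(1\le j\le n)$. Let $H_k(x)=(-1)^k e^{x^2}\left(\frac{d}{dx}\right)^k e^{-x^2}$ be the Hermite polynomials, let $\operatorname{erfc}(z)=1-\frac{2}{\sqrt\pi}\int_0^z e^{-w^2}\,dw$ for $z\in\mathbb C$, and let $$\eta_{2M}(x)=\frac{(-1)^{M-1}}{2^{2M-1}\sqrt\pi\,(M-1)!}\,\frac{H_{2M-1}(x)\,e^{-x^2}}{x}$$ (extended continuously to $x=0$). With principal branches of the roots and powers, put $$\mathcal P_M(x,t)=\sum_{s=0}^{M-1}\frac{(-1)^s}{s!\,4^s}\frac{1}{(1+t)^{s+1/2}}H_{2s}\Big(\frac{x}{\sqrt{1+t}}\Big),\qquad F(x,t,p)=\sqrt{\frac{t+1}{t}}\Big(p-\frac{x}{t+1}\Big),$$ $$\mathcal Q_M(x,t,y)=2\sum_{k=1}^{M-1}\frac{(-1)^k}{k!\,4^k}\sum_{\ell=1}^{2k}\frac{(-1)^\ell}{t^{\ell/2}}\bigg(H_{2k-\ell}(y)H_{\ell-1}\Big(\frac{y-x}{\sqrt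 t}\Big)-\binom{2k}{\ell}H_{2k-\ell}\Big(\frac{x}{\sqrt{1+t}}\Big)\frac{H_{\ell-1}(F(x,t,y))}{(1+t)^{k+1/2}}\bigg)$$ (so that $\mathcal Q_1=0$), and $$\Psi_M(x,t,y)=\frac{1}{2\sqrt\pi}\,e^{-x^2/(1+t)}\bigg(\operatorname{erfc}(F(x,t,y))\,\mathcal P_M(x,t)-\frac{e^{-F^2(x,t,y)}}{\sqrt\pi}\,\mathcal Q_M(x,t,y)\bigg).$$ Then for every $\mathbf x\in\mathbb R^n$ the integral $$u(\mathbf x)=i\int_0^\infty e^{i\kappa^2t}\prod_{j=1}^n\big(\Psi_M(a_jx_j,4ia_j^2t,a_jP_j)-\Psi_M(a_jx_j,4ia_j^2t,a_jQ_j)\big)\,dt$$ converges absolutely, and the function $u$ so defined is the unique solution on $\mathbb R^n$ of the Helmholtz equation $$-(\Delta+\kappa^2)u=\prod_{j=1}^n\chi_{(P_j,Q_j)}(x_j)\,\eta_{2M}(a_jx_j)$$ (that is, the unique $u\in C^1(\mathbb R^n;\mathbb C)$ that satisfies the equation in the sense of distributions) which satisfies Sommerfeld's radiation condition $$\lim_{|\mathbf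 x|\to\infty}|\mathbf x|^{(n-1)/2}\Big(\Big\langle\frac{\mathbf x}{|\mathbf x|},\nabla u(\mathbf x)\Big\rangle-i\kappa u(\mathbf x)\Big)=0.$$ -/

import Mathlib

open MeasureTheory Filter Topology
open scoped ContDiff

namespace Diffraction

noncomputable section

/-- The (physicists') Hermite polynomials `H_k`, given by `H_0 = 1` and
`H_{k+1} = 2 X H_k - H_k'`. -/
def hermiteH : ℕ → Polynomial ℤ
  | 0 => 1
  | k + 1 => 2 * Polynomial.X * hermiteH k - Polynomial.derivative (hermiteH k)

/-- The value `H_k(z)` of the Hermite polynomial at a complex number. -/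
def H (k : ℕ) (z : ℂ) : ℂ := Polynomial.aeval z (hermiteH k)

/-- Rodrigues' formula: `H_k(z) = (-1)^k exp(z^2) (d/dz)^k exp(-z^2)`. -/
theorem H_eq_rodrigues (k : ℕ) (z : ℂ) :
    H k z = (-1) ^ k * Complex.exp (z ^ 2) *
      iteratedDeriv k (fun w : ℂ => Complex.exp (-w ^ 2)) z := by
  have key : ∀ k : ℕ, iteratedDeriv k (fun w : ℂ => Complex.exp (-w ^ 2)) =
      fun z => (-1) ^ k * H k z * Complex.exp (-z ^ 2) := by
    intro k
    induction k with
    | zero => funext z; simp [H, hermiteH]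
    | succ k ih =>
      funext z
      rw [iteratedDeriv_succ, ih]
      have h1 : HasDerivAt (H k) (Polynomial.aeval z (Polynomial.derivative (hermiteH k))) z :=
        Polynomial.hasDerivAt_aeval (hermiteH k) z
      have h2 : HasDerivAt (fun w : ℂ => Complex.exp (-w ^ 2))
          (Complex.exp (-z ^ 2) * (-(2 * z))) z := by
        have := ((hasDerivAt_id z).pow 2).neg.cexp
        simpa using this
      refine ((h1.const_mul ((-1) ^ k)).mul h2).deriv.trans ?_
      simp only [H, hermiteH, map_sub, map_mul, Polynomial.aeval_X, map_ofNat]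
      ring
  rw [key k]
  have : Complex.exp (z ^ 2) * Complex.exp (-z ^ 2) = 1 := by
    rw [← Complex.exp_add]; simp
  have h3 : ((-1 : ℂ) ^ k) * (-1) ^ k = 1 := by rw [← mul_pow]; simp
  linear_combination (-(H k z)) * h3 - (H k z) * ((-1 : ℂ) ^ k * (-1) ^ k) * this

/-- The basis function
`η_{2M}(x) = (-1)^{M-1} / (2^{2M-1} √π (M-1)!) · H_{2M-1}(x) exp(-x^2) / x`.
Here `H_{2M-1}(x) / x` is the polynomial quotient (`H_{2M-1}` is odd), so that the removable
singularity at `x = 0` is filled in; see `eta_eq`. -/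
def eta (M : ℕ) (x : ℝ) : ℝ :=
  (-1) ^ (M - 1) / (2 ^ (2 * M - 1) * √Real.pi * (Nat.factorial (M - 1) : ℝ)) *
    Polynomial.aeval x (hermiteH (2 * M - 1)).divX * Real.exp (-x ^ 2)

theorem hermiteH_comp_neg (k : ℕ) :
    (hermiteH k).comp (-Polynomial.X) = (-1) ^ k * hermiteH k := by
  induction k with
  | zero => simp [hermiteH]
  | succ k ih =>
    have hd := congrArg Polynomial.derivative ih
    rw [Polynomial.derivative_comp] at hd
    have h1 : Polynomial.derivative ((-1 : Polynomial ℤ) ^ k * hermiteH k) =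
        (-1) ^ k * Polynomial.derivative (hermiteH k) := by
      have : ((-1 : Polynomial ℤ) ^ k) = Polynomial.C ((-1) ^ k) := by simp
      rw [this, Polynomial.derivative_C_mul]
    rw [h1] at hd
    simp only [Polynomial.derivative_neg, Polynomial.derivative_X] at hd
    simp only [hermiteH, Polynomial.sub_comp, Polynomial.mul_comp, Polynomial.X_comp,
      Polynomial.ofNat_comp, ih]
    linear_combination hd

theorem eta_eq (M : ℕ) (hM : 1 ≤ M) (x : ℝ) (hx : x ≠ 0) :
    eta M x = (-1) ^ (M - 1) / (2 ^ (2 * M - 1) * √Real.pi * (Nat.factorial (M - 1) : ℝ)) *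
      (Polynomial.aeval x (hermiteH (2 * M - 1)) * Real.exp (-x ^ 2) / x) := by
  have h0 : (hermiteH (2 * M - 1)).coeff 0 = 0 := by
    have h := congrArg (Polynomial.eval 0) (hermiteH_comp_neg (2 * M - 1))
    have hodd : Odd (2 * M - 1) := ⟨M - 1, by omega⟩
    rw [hodd.neg_one_pow] at h
    simp only [Polynomial.eval_comp, Polynomial.eval_neg, Polynomial.eval_X, neg_zero,
      neg_mul, one_mul] at h
    rw [Polynomial.coeff_zero_eq_eval_zero]
    omega
  have h1 : Polynomial.aeval x (hermiteH (2 * M - 1)) =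
      Polynomial.aeval x (hermiteH (2 * M - 1)).divX * x := by
    conv_lhs => rw [← Polynomial.divX_mul_X_add (hermiteH (2 * M - 1)), h0]
    simp
  rw [h1, eta]
  field_simp

/-- The complementary error function `erfc z = 1 - (2/√π) ∫_0^z exp(-w^2) dw` on the complex
plane (the integral is taken along the segment from `0` to `z`). -/
def erfc (z : ℂ) : ℂ :=
  1 - 2 / (√Real.pi : ℝ) * ∫ s in (0 : ℝ)..1, z * Complex.exp (-((s : ℂ) * z) ^ 2)

/-- `𝒫_M(x,t) = ∑_{s=0}^{M-1} (-1)^s / (s! 4^s) (1+t)^{-(s+1/2)} H_{2s}(x / √(1+t))`. -/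
def calP (M : ℕ) (x t : ℂ) : ℂ :=
  ∑ s ∈ Finset.range M, (-1) ^ s / ((Nat.factorial s : ℂ) * 4 ^ s) *
    (1 / (1 + t) ^ ((s : ℂ) + 1 / 2)) * H (2 * s) (x / Complex.sqrt (1 + t))

/-- `F(x,t,p) = √((t+1)/t) (p - x/(t+1))`. -/
def F (x t p : ℂ) : ℂ := Complex.sqrt ((t + 1) / t) * (p - x / (t + 1))

/-- The Hermite double sum `𝒬_M(x,t,y)`; for `M = 1` it is the empty sum. -/
def calQ (M : ℕ) (x t y : ℂ) : ℂ :=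
  2 * ∑ k ∈ Finset.Icc 1 (M - 1), (-1) ^ k / ((Nat.factorial k : ℂ) * 4 ^ k) *
    ∑ l ∈ Finset.Icc 1 (2 * k), (-1) ^ l / t ^ ((l : ℂ) / 2) *
      (H (2 * k - l) y * H (l - 1) ((y - x) / Complex.sqrt t) -
        (Nat.choose (2 * k) l : ℂ) * H (2 * k - l) (x / Complex.sqrt (1 + t)) *
          (H (l - 1) (F x t y) / (1 + t) ^ ((k : ℂ) + 1 / 2)))

/-- `Ψ_M(x,t,y)
  = (1 / (2√π)) exp(-x^2/(1+t)) (erfc(F(x,t,y)) 𝒫_M(x,t) - exp(-F^2(x,t,y))/√π · 𝒬_M(x,t,y))`. -/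
def Psi (M : ℕ) (x t y : ℂ) : ℂ :=
  1 / (2 * (√Real.pi : ℝ)) * Complex.exp (-x ^ 2 / (1 + t)) *
    (erfc (F x t y) * calP M x t -
      Complex.exp (-(F x t y) ^ 2) / (√Real.pi : ℝ) * calQ M x t y)

/-- The density `∏_j χ_{(P_j,Q_j)}(x_j) η_{2M}(a_j x_j)` on `ℝⁿ`. -/
def boxDensity {n : ℕ} (M : ℕ) (a P Q : Fin n → ℝ) (x : EuclideanSpace ℝ (Fin n)) : ℝ :=
  ∏ j, (Set.Ioo (P j) (Q j)).indicator (fun _ => (1 : ℝ)) (x j) * eta M (a j * x j)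

/-- The integrand
`exp(iκ²t) ∏_j (Ψ_M(a_j x_j, 4i a_j² t, a_j P_j) - Ψ_M(a_j x_j, 4i a_j² t, a_j Q_j))`. -/
def potentialIntegrand {n : ℕ} (M : ℕ) (κ : ℝ) (a P Q : Fin n → ℝ)
    (x : EuclideanSpace ℝ (Fin n)) (t : ℝ) : ℂ :=
  Complex.exp (Complex.I * (κ : ℂ) ^ 2 * (t : ℂ)) *
    ∏ j, (Psi M ((a j : ℂ) * (x j : ℂ)) (4 * Complex.I * (a j : ℂ) ^ 2 * (t : ℂ))
          ((a j : ℂ) * (P j : ℂ)) -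
        Psi M ((a j : ℂ) * (x j : ℂ)) (4 * Complex.I * (a j : ℂ) ^ 2 * (t : ℂ))
          ((a j : ℂ) * (Q j : ℂ)))

/-- `u` is a solution on `ℝⁿ` of the Helmholtz equation `-(Δ + κ²) u = g` that satisfies
Sommerfeld's radiation condition. The density `g` may be discontinuous, so the equation is
understood in the sense of distributions; `u` itself is continuously differentiable, so that the
radiation condition is meaningful pointwise. -/
structure IsRadiatingSolution {n : ℕ} (κ : ℝ) (g : EuclideanSpace ℝ (Fin n) → ℝ)
    (u : EuclideanSpace ℝ (Fin n) → ℂ) : Prop where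
  contDiff : ContDiff ℝ 1 u
  equation : ∀ φ : EuclideanSpace ℝ (Fin n) → ℂ, ContDiff ℝ ∞ φ → HasCompactSupport φ →
    -(∫ x, u x * (Laplacian.laplacian φ x + (κ : ℂ) ^ 2 * φ x)) = ∫ x, (g x : ℂ) * φ x
  radiation : Tendsto
    (fun x : EuclideanSpace ℝ (Fin n) => ((‖x‖ ^ (((n : ℝ) - 1) / 2) : ℝ) : ℂ) *
      (fderiv ℝ u x (‖x‖⁻¹ • x) - Complex.I * (κ : ℂ) * u x))
    (cocompact (EuclideanSpace ℝ (Fin n))) (𝓝 0)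

end

end Diffraction

namespace Diffraction

/-! The outgoing resolvent is the time integral of the Schrödinger group: formally, -(Δ + κ²)u = g
is solved by u = i ∫₀^∞ e^{iκ²t} e^{itΔ} g dt. For a tensor product g on a box, e^{itΔ}g is a
product of one-dimensional evolutions. The function Ψ is built to make these explicit: its
y-derivative is minus a Gaussian kernel times η (`hasDerivAt_Psi`, by a telescoping sum and the
Hermite addition theorem), so the difference of its values at the two ends of an interval is the
evolution of the truncated η (`Psi_sub_Psi`). From there on only the C¹ smoothness of the factors
matters.

Convergence. Each factor is O(min(1, t^{-1/2})) and its derivative O(t^{-1/2}), uniformly in x. With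
at least three factors, the product and its gradient are dominated by t^{-1/2} min(1, t^{-1/2})²,
which is integrable; hence absolute convergence and u ∈ C¹.

Equation. For a test function φ, S(t) = e^{iκ²t}⟨e^{itΔ}g, φ⟩ starts at ⟨g, φ⟩, tends to 0, and has
derivative i e^{iκ²t}⟨e^{itΔ}g, (Δ + κ²)φ⟩. Integrating S' gives the equation; S is handled on the
Fourier side (`integral_pot_mul_helmholtz`).

Radiation. The kernel of ∂_r u - iκu has, up to a harmless error, the amplitude t^{-n/2}(ρ/(2t) - κ)
with ρ = |x - y|. It vanishes exactly at the stationary point t = ρ/(2κ) of the phase κ²t + ρ²/(4t).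
Beyond T = |x|/(8κ) one integration by parts therefore gives O(T^{-n/2}); before T the phase is not
stationary and a contour shift in z = 1/t gives the same order. This beats the factor |x|^{(n-1)/2}
by |x|^{-1/2}.

Uniqueness. Neither Rellich's lemma nor unique continuation enters. Two radiating solutions v, h
with compactly supported sources G_v, G_h satisfy ∫ G_h v = ∫ G_v h (`WeakHelmholtz.reciprocity`).
Taking for h the potential of an arbitrary cube, any radiating solution has the same integral over
every cube as the constructed one, and both are continuous. -/

/-! ### Hermite polynomials: recurrences, addition theorem, the sum for η -/

theorem derivative_hermiteH (k : ℕ) :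
    Polynomial.derivative (hermiteH (k + 1)) = 2 * ((k : Polynomial ℤ) + 1) * hermiteH k := by
  induction k with
  | zero => simp [hermiteH]
  | succ k ih =>
    have h2 : hermiteH (k + 1) = 2 * Polynomial.X * hermiteH k -
      Polynomial.derivative (hermiteH k) := by rw [hermiteH]
    rw [hermiteH, Polynomial.derivative_sub, Polynomial.derivative_mul, ih]
    simp only [Polynomial.derivative_mul, Polynomial.derivative_X, Polynomial.derivative_ofNat,
      Polynomial.derivative_add, Polynomial.derivative_natCast, Polynomial.derivative_one]
    push_cast
    rw [h2]
    ring

theorem hermiteH_add_two (k : ℕ) :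
    hermiteH (k + 2) = 2 * Polynomial.X * hermiteH (k + 1) -
      2 * ((k : Polynomial ℤ) + 1) * hermiteH k := by
  rw [hermiteH, derivative_hermiteH]

theorem hasDerivAt_H (k : ℕ) (z : ℂ) : HasDerivAt (H k) (2 * z * H k z - H (k + 1) z) z := by
  have h1 : HasDerivAt (H k) (Polynomial.aeval z (Polynomial.derivative (hermiteH k))) z :=
    Polynomial.hasDerivAt_aeval (hermiteH k) z
  convert h1 using 1
  simp only [H, hermiteH, map_sub, map_mul, Polynomial.aeval_X, map_ofNat]
  ring

/-- The addition theorem of the Hermite polynomials. -/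
theorem H_add (α β : ℂ) (h : α ^ 2 + β ^ 2 = 1) (n : ℕ) (u v : ℂ) :
    H n (α * u + β * v) = ∑ ij ∈ Finset.HasAntidiagonal.antidiagonal n, (n.choose ij.1 : ℂ) *
      (β ^ ij.1 * α ^ ij.2 * (H ij.1 v * H ij.2 u)) := by
  induction n generalizing u v with
  | zero => simp [H, hermiteH]
  | succ n ih =>
    have hu : HasDerivAt (fun u => H n (α * u + β * v))
        ((2 * (α * u + β * v) * H n (α * u + β * v) - H (n + 1) (α * u + β * v)) * α) u := by
      have h2 : HasDerivAt (fun u : ℂ => α * u + β * v) α u := by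
        simpa using ((hasDerivAt_id u).const_mul α).add_const (β * v)
      exact (hasDerivAt_H n _).comp u h2
    have hv : HasDerivAt (fun v => H n (α * u + β * v))
        ((2 * (α * u + β * v) * H n (α * u + β * v) - H (n + 1) (α * u + β * v)) * β) v := by
      have h2 : HasDerivAt (fun v : ℂ => α * u + β * v) β v := by
        simpa using ((hasDerivAt_id v).const_mul β).const_add (α * u)
      exact (hasDerivAt_H n _).comp v h2
    have hu' : HasDerivAt (fun u => H n (α * u + β * v))
        (∑ ij ∈ Finset.HasAntidiagonal.antidiagonal n, (n.choose ij.1 : ℂ) *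
          (β ^ ij.1 * α ^ ij.2 * (H ij.1 v * (2 * u * H ij.2 u - H (ij.2 + 1) u)))) u := by
      simp_rw [ih]
      refine HasDerivAt.fun_sum fun ij _ => ?_
      exact (((hasDerivAt_H ij.2 u).const_mul _).const_mul _).const_mul _
    have hv' : HasDerivAt (fun v => H n (α * u + β * v))
        (∑ ij ∈ Finset.HasAntidiagonal.antidiagonal n, (n.choose ij.1 : ℂ) *
          (β ^ ij.1 * α ^ ij.2 * ((2 * v * H ij.1 v - H (ij.1 + 1) v) * H ij.2 u))) v := by
      simp_rw [ih]
      refine HasDerivAt.fun_sum fun ij _ => ?_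
      exact (((hasDerivAt_H ij.1 v).mul_const _).const_mul _).const_mul _
    -- Both partial derivatives are known in two ways. Since α∂_u + β∂_v produces (α² + β²) H_n' =
    -- H_n', the relation H_{n+1} = 2w H_n - H_n' at w = αu + βv carries the expansion from n to n +
    -- 1.
    have eu := hu.unique hu'
    have ev := hv.unique hv'
    rw [Finset.sum_antidiagonal_choose_succ_mul
      (fun i j => β ^ i * α ^ j * (H i v * H j u)) n]
    have e1 : ∑ ij ∈ Finset.HasAntidiagonal.antidiagonal n, (n.choose ij.1 : ℂ) *
        (β ^ ij.1 * α ^ (ij.2 + 1) * (H ij.1 v * H (ij.2 + 1) u)) =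
        α * (2 * u * ∑ ij ∈ Finset.HasAntidiagonal.antidiagonal n, (n.choose ij.1 : ℂ) *
          (β ^ ij.1 * α ^ ij.2 * (H ij.1 v * H ij.2 u)) -
          ∑ ij ∈ Finset.HasAntidiagonal.antidiagonal n, (n.choose ij.1 : ℂ) *
          (β ^ ij.1 * α ^ ij.2 * (H ij.1 v * (2 * u * H ij.2 u - H (ij.2 + 1) u)))) := by
      rw [Finset.mul_sum, ← Finset.sum_sub_distrib, Finset.mul_sum]
      refine Finset.sum_congr rfl fun ij _ => ?_
      ring
    have e2 : ∑ ij ∈ Finset.HasAntidiagonal.antidiagonal n, (n.choose ij.2 : ℂ) *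
        (β ^ (ij.1 + 1) * α ^ ij.2 * (H (ij.1 + 1) v * H ij.2 u)) =
        β * (2 * v * ∑ ij ∈ Finset.HasAntidiagonal.antidiagonal n, (n.choose ij.1 : ℂ) *
          (β ^ ij.1 * α ^ ij.2 * (H ij.1 v * H ij.2 u)) -
          ∑ ij ∈ Finset.HasAntidiagonal.antidiagonal n, (n.choose ij.1 : ℂ) *
          (β ^ ij.1 * α ^ ij.2 * ((2 * v * H ij.1 v - H (ij.1 + 1) v) * H ij.2 u))) := by
      rw [Finset.mul_sum, ← Finset.sum_sub_distrib, Finset.mul_sum]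
      refine Finset.sum_congr rfl fun ij hij => ?_
      rw [← Nat.choose_symm_of_eq_add (Finset.HasAntidiagonal.mem_antidiagonal.mp hij).symm]
      ring
    rw [e1, e2, ← eu, ← ev, ← ih]
    linear_combination (2 * (α * u + β * v) * H n (α * u + β * v) -
      H (n + 1) (α * u + β * v)) * h

theorem H_neg (k : ℕ) (z : ℂ) : H k (-z) = (-1) ^ k * H k z := by
  have h := congrArg (fun p => Polynomial.aeval z p) (hermiteH_comp_neg k)
  simpa [Polynomial.aeval_comp, H] using h

theorem divX_mul_X' (p : Polynomial ℤ) : (p * Polynomial.X).divX = p := by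
  ext n; simp [Polynomial.coeff_divX]

/-- `H_{2M+1}(y)/y` as a sum of even Hermite polynomials. -/
theorem aeval_divX_hermiteH (m : ℕ) (y : ℂ) :
    (-1) ^ m / (2 ^ (2 * m + 1) * (Nat.factorial m : ℂ)) *
        Polynomial.aeval y (hermiteH (2 * m + 1)).divX =
      ∑ k ∈ Finset.range (m + 1), (-1) ^ k / ((Nat.factorial k : ℂ) * 4 ^ k) * H (2 * k) y := by
  induction m with
  | zero =>
    have : (hermiteH 1).divX = 2 := by
      have h : hermiteH 1 = Polynomial.C 2 * Polynomial.X ^ 1 := by simp [hermiteH]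
      rw [h, Polynomial.divX_C_mul_X_pow]; simp
    rw [show 2 * 0 + 1 = 1 from rfl, this]
    simp [H, hermiteH, map_ofNat]
  | succ m ih =>
    rw [Finset.sum_range_succ, ← ih]
    -- The three-term recurrence divided by X. The factor 4(m + 1) is exactly the ratio of
    -- consecutive normalisations, so each step adds one even Hermite polynomial.
    have hd : (hermiteH (2 * (m + 1) + 1)).divX =
        Polynomial.C 2 * hermiteH (2 * (m + 1)) -
          Polynomial.C (4 * ((m : ℤ) + 1)) * (hermiteH (2 * m + 1)).divX := by
      have h1 : hermiteH (2 * (m + 1) + 1) =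
          Polynomial.C 2 * (hermiteH (2 * (m + 1)) * Polynomial.X) +
            Polynomial.C (-(4 * ((m : ℤ) + 1))) * hermiteH (2 * m + 1) := by
        rw [show 2 * (m + 1) + 1 = (2 * m + 1) + 2 by ring, hermiteH_add_two,
          show 2 * m + 1 + 1 = 2 * (m + 1) by ring]
        push_cast
        simp only [map_neg, map_mul, map_add, map_ofNat, map_natCast, map_one]
        ring
      rw [h1, Polynomial.divX_add, Polynomial.divX_C_mul, Polynomial.divX_C_mul,
        divX_mul_X', map_neg]
      ring
    rw [hd]
    simp only [map_sub, map_mul, Polynomial.aeval_C]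
    simp only [H, Nat.factorial_succ]
    push_cast
    have h0 : (Nat.factorial m : ℂ) ≠ 0 := by exact_mod_cast Nat.factorial_ne_zero m
    have h1 : (m : ℂ) + 1 ≠ 0 := by exact_mod_cast Nat.succ_ne_zero m
    have h4 : (4 : ℂ) ^ m = 2 ^ (2 * m) := by rw [pow_mul]; norm_num
    have h5 : (4 : ℂ) ^ (m + 1) = 4 * 2 ^ (2 * m) := by rw [pow_succ, h4]; ring
    rw [h5, show 2 * (m + 1) + 1 = 2 * m + 3 by ring]
    simp only [pow_add, eq_intCast]
    push_cast
    field_simp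
    ring

/-- The coefficients are those of `calP` and `calQ`; this is the form in which η emerges from
differentiating `Psi`. -/
theorem eta_eq_sum (M : ℕ) (hM : 1 ≤ M) (y : ℝ) :
    (eta M y : ℂ) = 1 / (√Real.pi : ℝ) * Complex.exp (-(y : ℂ) ^ 2) *
      ∑ k ∈ Finset.range M, (-1) ^ k / ((Nat.factorial k : ℂ) * 4 ^ k) * H (2 * k) y := by
  obtain ⟨m, rfl⟩ := Nat.exists_eq_add_of_le' hM
  rw [← aeval_divX_hermiteH, eta]
  have : ((Polynomial.aeval y (hermiteH (2 * m + 1)).divX : ℝ) : ℂ) =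
      Polynomial.aeval (y : ℂ) (hermiteH (2 * m + 1)).divX :=
    (Polynomial.aeval_algebraMap_apply ℂ y _).symm
  rw [show 2 * (m + 1) - 1 = 2 * m + 1 by omega, show m + 1 - 1 = m by omega]
  push_cast
  rw [this]
  field_simp

/-! ### The y-derivative of Ψ -/

/-- On a ball around 0 containing z the entire integrand has a holomorphic primitive, and the
segment integral is a difference of its values, so nothing is differentiated under the integral
sign. -/
theorem hasDerivAt_erfc (z : ℂ) :
    HasDerivAt erfc (-(2 / (√Real.pi : ℝ)) * Complex.exp (-z ^ 2)) z := by
  have hd : DifferentiableOn ℂ (fun w : ℂ => Complex.exp (-w ^ 2))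
      (Metric.ball 0 (‖z‖ + 1)) := by fun_prop
  obtain ⟨G, hG⟩ := hd.isExactOn_ball
  have key : ∀ w ∈ Metric.ball (0 : ℂ) (‖z‖ + 1),
      ∫ s in (0 : ℝ)..1, w * Complex.exp (-((s : ℂ) * w) ^ 2) = G w - G 0 := by
    intro w hw
    have h1 : ∀ s ∈ Set.uIcc (0 : ℝ) 1, HasDerivAt (fun s : ℝ => G ((s : ℂ) * w))
        (w * Complex.exp (-((s : ℂ) * w) ^ 2)) s := by
      intro s hs
      rw [Set.uIcc_of_le zero_le_one] at hs
      have hm : (s : ℂ) * w ∈ Metric.ball (0 : ℂ) (‖z‖ + 1) := by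
        simp only [mem_ball_zero_iff, norm_mul, Complex.norm_real, Real.norm_eq_abs,
          abs_of_nonneg hs.1] at hw ⊢
        nlinarith [hs.2, norm_nonneg w]
      have h2 : HasDerivAt (fun s : ℝ => (s : ℂ) * w) w s := by
        simpa using (Complex.ofRealCLM.hasDerivAt (x := s)).mul_const w
      have h3 := (hG _ hm).comp s h2
      rw [mul_comm] at h3
      exact h3
    rw [intervalIntegral.integral_eq_sub_of_hasDerivAt h1
      (by apply Continuous.intervalIntegrable; fun_prop)]
    simp
  have hz : z ∈ Metric.ball (0 : ℂ) (‖z‖ + 1) := by simp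
  have h4 : HasDerivAt (fun w => 1 - 2 / (√Real.pi : ℝ) * (G w - G 0))
      (-(2 / (√Real.pi : ℝ)) * Complex.exp (-z ^ 2)) z := by
    have := (((hG z hz).sub_const (G 0)).const_mul (2 / ((√Real.pi : ℝ) : ℂ))).const_sub 1
    rw [neg_mul]; exact this
  refine h4.congr_of_eventuallyEq ?_
  filter_upwards [Metric.isOpen_ball.mem_nhds hz] with w hw
  rw [erfc, key w hw]

theorem hasDerivAt_exp_mul_H (k : ℕ) (y : ℂ) :
    HasDerivAt (fun y => Complex.exp (-y ^ 2) * H k y) (-(Complex.exp (-y ^ 2) * H (k + 1) y)) y := by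
  have h2 : HasDerivAt (fun w : ℂ => Complex.exp (-w ^ 2))
      (Complex.exp (-y ^ 2) * (-(2 * y))) y := by
    simpa using ((hasDerivAt_id y).pow 2).neg.cexp
  convert! h2.mul (hasDerivAt_H k y) using 1
  ring

theorem sum_alternating_telescope (A : ℕ → ℂ) (k : ℕ) :
    ∑ l ∈ Finset.Icc 1 k, (-1) ^ l * (A (l - 1) + A l) = (-1) ^ k * A k - A 0 := by
  induction k with
  | zero => simp
  | succ k ih =>
    rw [Finset.sum_Icc_succ_top (by omega), ih, pow_succ]
    simp only [Nat.add_sub_cancel]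
    ring

theorem sum_Icc_one_eq_sum_range (f : ℕ → ℂ) (n : ℕ) :
    ∑ l ∈ Finset.Icc 1 n, f l = ∑ l ∈ Finset.range n, f (l + 1) := by
  rw [Finset.range_eq_Ico, Finset.sum_Ico_add' f 0 n 1]
  rfl

/-- The addition theorem with α = s/q and β = -1/q: the combination of x/q and q/s · (y - x/q²)
collapses to -(y - x)/s. The subtracted term is the summand l = 0, which `calQ` omits. -/
theorem H_addition_scaled {s q : ℂ} (hs : s ≠ 0) (hq : q ≠ 0) (hsq : q ^ 2 = 1 + s ^ 2)
    (k : ℕ) (x y : ℂ) :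
    ∑ l ∈ Finset.Icc 1 (2 * k), (-1) ^ l / s ^ l *
      ((Nat.choose (2 * k) l : ℂ) * H (2 * k - l) (x / q) * H l (q / s * (y - x / q ^ 2))) =
    (q / s) ^ (2 * k) * H (2 * k) ((y - x) / s) - H (2 * k) (x / q) := by
  have h1 : (s / q) ^ 2 + (-1 / q) ^ 2 = 1 := by field_simp; rw [hsq]; ring
  have h2 := H_add (s / q) (-1 / q) h1 (2 * k) (x / q) (q / s * (y - x / q ^ 2))
  have h3 : s / q * (x / q) + -1 / q * (q / s * (y - x / q ^ 2)) = -((y - x) / s) := by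
    field_simp
    rw [hsq]; ring
  have h4 : ∀ l ∈ Finset.range (2 * k), (-1) ^ (l + 1) / s ^ (l + 1) =
      (q / s) ^ (2 * k) * ((-1 / q) ^ (l + 1) * (s / q) ^ (2 * k - (l + 1))) := by
    intro l hl
    obtain ⟨m, hm⟩ := Nat.exists_eq_add_of_lt (Finset.mem_range.mp hl)
    rw [hm, show l + m + 1 - (l + 1) = m by omega]
    simp only [div_pow, pow_add]
    field_simp
  rw [h3, H_neg, (even_two_mul k).neg_one_pow, one_mul,
    Finset.Nat.sum_antidiagonal_eq_sum_range_succ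
      (fun i j => ((2 * k).choose i : ℂ) *
      ((-1 / q) ^ i * (s / q) ^ j * (H i (q / s * (y - x / q ^ 2)) * H j (x / q)))) (2 * k)] at h2
  rw [h2, Finset.mul_sum, Finset.sum_range_succ', sum_Icc_one_eq_sum_range, add_sub_assoc]
  have h5 : (q / s) ^ (2 * k) * (s / q) ^ (2 * k) = 1 := by
    rw [← mul_pow]; field_simp; simp
  have h0 : H 0 (q / s * (y - x / q ^ 2)) = 1 := by simp [H, hermiteH]
  rw [h0]
  simp only [Nat.choose_zero_right, Nat.cast_one, pow_zero, one_mul, Nat.sub_zero]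
  rw [← mul_assoc, h5, one_mul, sub_self, add_zero]
  refine Finset.sum_congr rfl fun l hl => ?_
  rw [h4 l hl]
  ring

/-- Up to a factor independent of y, the Gaussian in F splits into Gaussians in (y - x)/s and in y;
against each of them differentiation of a Hermite polynomial only raises its index. -/
theorem exp_completing_square {s q : ℂ} (hs : s ≠ 0) (hq : q ≠ 0) (hsq : q ^ 2 = 1 + s ^ 2)
    (x y : ℂ) :
    Complex.exp (-x ^ 2 / q ^ 2) * Complex.exp (-(q / s * (y - x / q ^ 2)) ^ 2) =
      Complex.exp (-((y - x) / s) ^ 2) * Complex.exp (-y ^ 2) := by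
  rw [← Complex.exp_add, ← Complex.exp_add]
  congr 1
  field_simp
  linear_combination (x ^ 2 - q ^ 2 * y ^ 2) * hsq

/-- Derivative of the `k`-th inner sum of `calQ` (times the Gaussian). -/
theorem hasDerivAt_inner_calQ {s q : ℂ} (hs : s ≠ 0) (hq : q ≠ 0) (hsq : q ^ 2 = 1 + s ^ 2)
    (k : ℕ) (x y : ℂ) :
    HasDerivAt (fun y => Complex.exp (-(q / s * (y - x / q ^ 2)) ^ 2) *
      ∑ l ∈ Finset.Icc 1 (2 * k), (-1) ^ l / s ^ l *
      (H (2 * k - l) y * H (l - 1) ((y - x) / s) -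
        (Nat.choose (2 * k) l : ℂ) * H (2 * k - l) (x / q) *
          (H (l - 1) (q / s * (y - x / q ^ 2)) / q ^ (2 * k + 1))))
      (Complex.exp (-(q / s * (y - x / q ^ 2)) ^ 2) *
        (H (2 * k) y / s - H (2 * k) (x / q) / (s * q ^ (2 * k)))) y := by
  have hz : HasDerivAt (fun y : ℂ => (y - x) / s) (1 / s) y :=
    ((hasDerivAt_id y).sub_const x).div_const s
  have hF : HasDerivAt (fun y : ℂ => q / s * (y - x / q ^ 2)) (q / s) y := by
    simpa using ((hasDerivAt_id y).sub_const (x / q ^ 2)).const_mul (q / s)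
  have hA : ∀ a b, HasDerivAt (fun y => Complex.exp (-(q / s * (y - x / q ^ 2)) ^ 2) *
      (H a y * H b ((y - x) / s))) (-(Complex.exp (-(q / s * (y - x / q ^ 2)) ^ 2) *
      (H (a + 1) y * H b ((y - x) / s) + H a y * H (b + 1) ((y - x) / s) / s))) y := by
    intro a b
    have e : ∀ y, Complex.exp (-(q / s * (y - x / q ^ 2)) ^ 2) = Complex.exp (x ^ 2 / q ^ 2) *
        (Complex.exp (-((y - x) / s) ^ 2) * Complex.exp (-y ^ 2)) := by
      intro y
      rw [← exp_completing_square hs hq hsq, ← mul_assoc, ← Complex.exp_add]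
      simp [neg_div]
    simp_rw [e]
    have h1 := hasDerivAt_exp_mul_H a y
    have h2 := (hasDerivAt_exp_mul_H b ((y - x) / s)).comp y hz
    convert! (h1.mul h2).const_mul (Complex.exp (x ^ 2 / q ^ 2)) using 1
    · funext w; simp; ring
    · simp; ring
  have hB : ∀ b, HasDerivAt (fun y => Complex.exp (-(q / s * (y - x / q ^ 2)) ^ 2) *
      H b (q / s * (y - x / q ^ 2))) (-(Complex.exp (-(q / s * (y - x / q ^ 2)) ^ 2) *
      (q / s * H (b + 1) (q / s * (y - x / q ^ 2))))) y := by
    intro b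
    convert! (hasDerivAt_exp_mul_H b (q / s * (y - x / q ^ 2))).comp y hF using 1
    ring
  have hsum := HasDerivAt.fun_sum (u := Finset.Icc 1 (2 * k)) (x := y) fun l _ =>
    (((hA (2 * k - l) (l - 1)).sub ((hB (l - 1)).const_mul
      ((Nat.choose (2 * k) l : ℂ) * H (2 * k - l) (x / q) / q ^ (2 * k + 1)))).const_mul
      ((-1) ^ l / s ^ l))
  convert! hsum using 1
  · funext w
    rw [Finset.mul_sum]
    refine Finset.sum_congr rfl fun l _ => ?_
    simp only [Pi.sub_apply]
    ring
  · have h6 := H_addition_scaled hs hq hsq k x y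
    -- The first Hermite products differentiate to A(l-1) + A(l) with alternating signs, so only the
    -- two end terms survive. The end term H_{2k}((y - x)/s) cancels against the one delivered by
    -- `H_addition_scaled`.
    have h7 := sum_alternating_telescope
      (fun l => H (2 * k - l) y * H l ((y - x) / s) / s ^ (l + 1)) (2 * k)
    have h8 : ∀ l ∈ Finset.Icc 1 (2 * k), (-1) ^ l / s ^ l *
        (-(Complex.exp (-(q / s * (y - x / q ^ 2)) ^ 2) *
          (H (2 * k - l + 1) y * H (l - 1) ((y - x) / s) +
            H (2 * k - l) y * H (l - 1 + 1) ((y - x) / s) / s)) -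
          (Nat.choose (2 * k) l : ℂ) * H (2 * k - l) (x / q) / q ^ (2 * k + 1) *
          -(Complex.exp (-(q / s * (y - x / q ^ 2)) ^ 2) *
            (q / s * H (l - 1 + 1) (q / s * (y - x / q ^ 2))))) =
        Complex.exp (-(q / s * (y - x / q ^ 2)) ^ 2) * (
        -((-1) ^ l * (H (2 * k - (l - 1)) y * H (l - 1) ((y - x) / s) / s ^ (l - 1 + 1) +
          H (2 * k - l) y * H l ((y - x) / s) / s ^ (l + 1))) +
        1 / (s * q ^ (2 * k)) * ((-1) ^ l / s ^ l * ((Nat.choose (2 * k) l : ℂ) *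
          H (2 * k - l) (x / q) * H l (q / s * (y - x / q ^ 2))))) := by
      intro l hl
      rw [Finset.mem_Icc] at hl
      rw [Nat.sub_add_cancel hl.1, show 2 * k - l + 1 = 2 * k - (l - 1) by omega]
      simp only [pow_succ]
      field_simp
      ring
    rw [Finset.sum_congr rfl h8, ← Finset.mul_sum, Finset.sum_add_distrib, ← Finset.mul_sum, h6,
      Finset.sum_neg_distrib, h7, (even_two_mul k).neg_one_pow]
    have h0 : ∀ w, H 0 w = 1 := fun w => by simp [H, hermiteH]
    simp only [Nat.sub_self, h0, Nat.sub_zero, div_pow, pow_succ, pow_zero]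
    field_simp
    ring

theorem cpow_natCast_div_two (t : ℂ) (l : ℕ) : t ^ ((l : ℂ) / 2) = Complex.sqrt t ^ l := by
  rw [div_eq_mul_inv, Complex.cpow_nat_mul, Complex.sqrt]

theorem cpow_natCast_add_half (t : ℂ) (k : ℕ) :
    t ^ ((k : ℂ) + 1 / 2) = Complex.sqrt t ^ (2 * k + 1) := by
  rw [← cpow_natCast_div_two]
  congr 1
  push_cast
  ring

theorem sqrt_sq (z : ℂ) : Complex.sqrt z ^ 2 = z := by
  rw [Complex.sqrt, ← Complex.cpow_nat_mul]; simp

/-- The derivative of `erfc` times `calP` cancels the H_{2k}(x/q) terms of `hasDerivAt_inner_calQ`;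
what remains is the Gaussian kernel times the Hermite sum of η. The identity `hsqrt` is a condition
on branches, and `sqrt_quotient` verifies it on the positive imaginary axis. -/
theorem hasDerivAt_Psi (M : ℕ) (hM : 1 ≤ M) (x t y : ℂ) (ht : t ≠ 0) (ht1 : 1 + t ≠ 0)
    (hsqrt : Complex.sqrt ((t + 1) / t) = Complex.sqrt (1 + t) / Complex.sqrt t) :
    HasDerivAt (fun y => Psi M x t y)
      (-(1 / Real.pi / Complex.sqrt t * (Complex.exp (-(y - x) ^ 2 / t) * (Complex.exp (-y ^ 2) *
        ∑ k ∈ Finset.range M, (-1) ^ k / ((Nat.factorial k : ℂ) * 4 ^ k) * H (2 * k) y)))) y := by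
  have hs2 := sqrt_sq t
  have hq2 := sqrt_sq (1 + t)
  set s := Complex.sqrt t with hsdef
  set q := Complex.sqrt (1 + t) with hqdef
  have hs : s ≠ 0 := by intro h; rw [h] at hs2; simp at hs2; exact ht hs2.symm
  have hq : q ≠ 0 := by intro h; rw [h] at hq2; simp at hq2; exact ht1 hq2.symm
  have hsq : q ^ 2 = 1 + s ^ 2 := by rw [hs2, hq2]
  have hFeq : ∀ y, F x t y = q / s * (y - x / q ^ 2) := by
    intro y; rw [F, hsqrt, hq2, add_comm t 1]
  have hP : calP M x t = ∑ k ∈ Finset.range M, (-1) ^ k / ((Nat.factorial k : ℂ) * 4 ^ k) *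
      (1 / q ^ (2 * k + 1)) * H (2 * k) (x / q) := by
    simp only [calP, cpow_natCast_add_half, ← hqdef]
  have hPsi : (fun y => Psi M x t y) = fun y => 1 / (2 * (√Real.pi : ℝ)) *
      Complex.exp (-x ^ 2 / q ^ 2) * (erfc (q / s * (y - x / q ^ 2)) * calP M x t -
      2 / (√Real.pi : ℝ) * ∑ k ∈ Finset.range M, (-1) ^ k / ((Nat.factorial k : ℂ) * 4 ^ k) *
      (Complex.exp (-(q / s * (y - x / q ^ 2)) ^ 2) *
      ∑ l ∈ Finset.Icc 1 (2 * k), (-1) ^ l / s ^ l *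
      (H (2 * k - l) y * H (l - 1) ((y - x) / s) -
        (Nat.choose (2 * k) l : ℂ) * H (2 * k - l) (x / q) *
          (H (l - 1) (q / s * (y - x / q ^ 2)) / q ^ (2 * k + 1))))) := by
    funext y
    obtain ⟨m, rfl⟩ := Nat.exists_eq_add_of_le' hM
    -- The outer sum of `calQ` starts at k = 1, but may be extended to k = 0 because the inner sum
    -- is then empty; this aligns it with `calP`.
    rw [Psi, hFeq, calQ, hq2, Finset.sum_range_succ', Nat.add_sub_cancel, sum_Icc_one_eq_sum_range]
    simp only [cpow_natCast_add_half, cpow_natCast_div_two, ← hqdef, ← hsdef, hFeq]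
    rw [hq2]
    simp only [mul_zero, Finset.Icc_eq_empty_of_lt (zero_lt_one' ℕ), Finset.sum_empty, add_zero]
    congr 2
    have hr : ∀ a p S : ℂ, a / p * (2 * S) = 2 / p * (a * S) := fun a p S => by ring
    rw [hr, Finset.mul_sum]
    congr 1
    refine Finset.sum_congr rfl fun k _ => ?_
    ring
  rw [hPsi]
  have hF : HasDerivAt (fun y : ℂ => q / s * (y - x / q ^ 2)) (q / s) y := by
    simpa using ((hasDerivAt_id y).sub_const (x / q ^ 2)).const_mul (q / s)
  have hsum := HasDerivAt.fun_sum (u := Finset.range M) (x := y) fun k _ =>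
    (hasDerivAt_inner_calQ hs hq hsq k x y).const_mul
      ((-1) ^ k / ((Nat.factorial k : ℂ) * 4 ^ k))
  have hE := ((hasDerivAt_erfc (q / s * (y - x / q ^ 2))).comp y hF).mul_const (calP M x t)
  convert! (hE.sub (hsum.const_mul (2 / ((√Real.pi : ℝ) : ℂ)))).const_mul
    (1 / (2 * ((√Real.pi : ℝ) : ℂ)) * Complex.exp (-x ^ 2 / q ^ 2)) using 1
  have hpi : ((√Real.pi : ℝ) : ℂ) ≠ 0 := by
    exact_mod_cast (Real.sqrt_pos.mpr Real.pi_pos).ne'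
  have hpi2 : ((Real.pi : ℝ) : ℂ) = ((√Real.pi : ℝ) : ℂ) ^ 2 := by
    rw [← Complex.ofReal_pow, Real.sq_sqrt Real.pi_pos.le]
  have e1 : -(y - x) ^ 2 / t = -((y - x) / s) ^ 2 := by rw [div_pow, hs2, neg_div]
  rw [e1, ← mul_assoc (Complex.exp (-((y - x) / s) ^ 2)), ← exp_completing_square hs hq hsq, hP,
    hpi2, Finset.mul_sum, Finset.mul_sum, Finset.mul_sum, ← Finset.sum_neg_distrib,
    Finset.mul_sum, ← Finset.sum_sub_distrib, Finset.mul_sum]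
  refine Finset.sum_congr rfl fun k _ => ?_
  have hf : (Nat.factorial k : ℂ) ≠ 0 := by exact_mod_cast Nat.factorial_ne_zero k
  simp only [pow_succ]
  field_simp
  ring

/-! ### Differences of Ψ as one-dimensional Schrödinger evolutions -/

/-- The one-dimensional free Schrödinger propagator applied to `χ_{(p,r)} g`. -/
noncomputable def freeProp (g : ℝ → ℝ) (p r x t : ℝ) : ℂ :=
  1 / ((√(2 * Real.pi) : ℝ) * (1 + Complex.I)) * ((√t)⁻¹ : ℝ) *
    ∫ y in p..r, Complex.exp (Complex.I * ((((x - y) ^ 2 / (4 * t)) : ℝ) : ℂ)) * (g y : ℂ)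

/-- Both roots on the right lie in the open first quadrant, so their quotient has positive real part
and is the principal root of its square. -/
theorem sqrt_quotient (τ : ℝ) (hτ : 0 < τ) :
    Complex.sqrt ((4 * Complex.I * τ + 1) / (4 * Complex.I * τ)) =
      Complex.sqrt (1 + 4 * Complex.I * τ) / Complex.sqrt (4 * Complex.I * τ) := by
  have hpos : 0 < (Complex.sqrt (1 + 4 * Complex.I * τ) / Complex.sqrt (4 * Complex.I * τ)).re := by
    have h1 : 0 < (1 + 4 * Complex.I * τ).re := by simp
    have h2 : 0 ≤ (1 + 4 * Complex.I * τ).im := by simp; positivity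
    have h3 : (4 * Complex.I * τ).re = 0 := by simp
    have h4 : 0 < (4 * Complex.I * τ).im := by simp; positivity
    have h5 : 0 < ‖4 * Complex.I * τ‖ := by
      rw [norm_pos_iff]; intro h; rw [h] at h4; simp at h4
    rw [Complex.sqrt_eq_real_add_ite (a := 1 + 4 * Complex.I * τ),
      Complex.sqrt_eq_real_add_ite (a := 4 * Complex.I * τ), if_pos h2, if_pos h4.le, h3]
    rw [Complex.div_re, ← add_div]
    simp only [one_mul, add_zero, sub_zero, Complex.add_re, Complex.add_im, Complex.mul_re,
      Complex.mul_im, Complex.ofReal_re, Complex.ofReal_im, Complex.I_re, Complex.I_im, mul_zero,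
      mul_one, sub_self, zero_add]
    have h6 : 0 < √(‖4 * Complex.I * τ‖ / 2) := by positivity
    have h7 : 0 < √((‖1 + 4 * Complex.I * τ‖ + (1 + 4 * Complex.I * τ).re) / 2) :=
      Real.sqrt_pos.mpr (by positivity)
    simp only [Complex.add_re, Complex.mul_re, Complex.mul_im, Complex.ofReal_re,
      Complex.ofReal_im, Complex.I_re, Complex.I_im, mul_zero,
      mul_one, add_zero, sub_zero] at h7
    refine div_pos ?_ ?_
    · positivity
    · rw [Complex.normSq_pos]
      intro h
      have := congrArg Complex.re h
      simp at this
      simp at h6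
      exact hτ.ne' this
  rw [Complex.sqrt, ← Complex.sq_cpow_two_inv hpos, div_pow, sqrt_sq, sqrt_sq, add_comm 1]

theorem sqrt_four_I_mul (a t : ℝ) (ha : 0 < a) (ht : 0 < t) :
    Complex.sqrt (4 * Complex.I * (a : ℂ) ^ 2 * t) =
      a * (√2 * √t : ℝ) * (1 + Complex.I) := by
  have h : 0 < ((a : ℂ) * (√2 * √t : ℝ) * (1 + Complex.I)).re := by
    simp; positivity
  rw [Complex.sqrt, ← Complex.sq_cpow_two_inv h]
  congr 1
  have h2 : ((√2 : ℝ) : ℂ) ^ 2 = 2 := by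
    rw [← Complex.ofReal_pow, Real.sq_sqrt (by norm_num)]; norm_num
  have h3 : ((√t : ℝ) : ℂ) ^ 2 = t := by
    rw [← Complex.ofReal_pow, Real.sq_sqrt ht.le]
  push_cast
  linear_combination (-(a : ℂ) ^ 2 * (((√t : ℝ) : ℂ) ^ 2) * (1 + Complex.I) ^ 2) * h2 -
    2 * (a : ℂ) ^ 2 * (1 + Complex.I) ^ 2 * h3 - 2 * (a : ℂ) ^ 2 * t * Complex.I_sq

/-- The difference of two values of `Psi` is the free evolution of the truncated `eta`. -/
theorem Psi_sub_Psi (M : ℕ) (hM : 1 ≤ M) (a p r x t : ℝ) (ha : 0 < a) (ht : 0 < t) :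
    Psi M ((a : ℂ) * (x : ℂ)) (4 * Complex.I * (a : ℂ) ^ 2 * (t : ℂ)) ((a : ℂ) * (p : ℂ)) -
      Psi M ((a : ℂ) * (x : ℂ)) (4 * Complex.I * (a : ℂ) ^ 2 * (t : ℂ)) ((a : ℂ) * (r : ℂ)) =
    freeProp (fun y => eta M (a * y)) p r x t := by
  set T : ℂ := 4 * Complex.I * (a : ℂ) ^ 2 * (t : ℂ) with hT
  have hTτ : T = 4 * Complex.I * ((a ^ 2 * t : ℝ) : ℂ) := by rw [hT]; push_cast; ring
  have haC : (a : ℂ) ≠ 0 := by exact_mod_cast ha.ne'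
  have htC : (t : ℂ) ≠ 0 := by exact_mod_cast ht.ne'
  have hT0 : T ≠ 0 := by rw [hT]; simp [haC, htC]
  have hT1 : 1 + T ≠ 0 := by
    intro h
    have := congrArg Complex.re h
    rw [hTτ] at this
    simp [-Complex.ofReal_mul] at this
  have hsq : Complex.sqrt ((T + 1) / T) = Complex.sqrt (1 + T) / Complex.sqrt T := by
    rw [hTτ]; exact sqrt_quotient _ (by positivity)
  have hd : ∀ y ∈ Set.uIcc p r, HasDerivAt (fun y : ℝ => Psi M (a * x) T (a * y))
      (-(1 / ((√(2 * Real.pi) : ℝ) * (1 + Complex.I)) * ((√t)⁻¹ : ℝ) *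
        (Complex.exp (Complex.I * ((((x - y) ^ 2 / (4 * t)) : ℝ) : ℂ)) *
          (eta M (a * y) : ℂ)))) y := by
    intro y _
    have h1 : HasDerivAt (fun y : ℝ => (a : ℂ) * (y : ℂ)) a y := by
      simpa using (Complex.ofRealCLM.hasDerivAt (x := y)).const_mul (a : ℂ)
    have h2 := (hasDerivAt_Psi M hM (a * x) T (a * y) hT0 hT1 hsq).comp y h1
    convert! h2 using 1
    rw [eta_eq_sum M hM, sqrt_four_I_mul a t ha ht]
    have e1 : -((a : ℂ) * y - a * x) ^ 2 / T =
        Complex.I * ((((x - y) ^ 2 / (4 * t)) : ℝ) : ℂ) := by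
      rw [hT]
      push_cast
      field_simp
      linear_combination (-(x - y : ℂ) ^ 2) * Complex.I_sq
    have hpi : ((√Real.pi : ℝ) : ℂ) ≠ 0 := by
      exact_mod_cast (Real.sqrt_pos.mpr Real.pi_pos).ne'
    have hpi2 : ((Real.pi : ℝ) : ℂ) = ((√Real.pi : ℝ) : ℂ) ^ 2 := by
      rw [← Complex.ofReal_pow, Real.sq_sqrt Real.pi_pos.le]
    have h2' : ((√2 : ℝ) : ℂ) ≠ 0 := by
      exact_mod_cast (Real.sqrt_pos.mpr two_pos).ne'
    have ht' : ((√t : ℝ) : ℂ) ≠ 0 := by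
      exact_mod_cast (Real.sqrt_pos.mpr ht).ne'
    have hI : (1 + Complex.I) ≠ 0 := by
      intro h
      have := congrArg Complex.re h
      simp at this
    rw [e1, Real.sqrt_mul (by norm_num), hpi2]
    push_cast
    field_simp
  have hi := intervalIntegral.integral_eq_sub_of_hasDerivAt hd (by
    apply Continuous.intervalIntegrable
    have : Continuous (eta M) := by unfold eta; fun_prop
    fun_prop)
  rw [intervalIntegral.integral_neg, intervalIntegral.integral_const_mul] at hi
  rw [freeProp]
  linear_combination hi

/-! ### One-dimensional oscillatory integrals -/

/-- The oscillating Gaussian `exp(i s² / (4t))`. -/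
noncomputable def osc (t s : ℝ) : ℂ := Complex.exp (Complex.I * ((s ^ 2 / (4 * t) : ℝ) : ℂ))

theorem norm_osc (t s : ℝ) : ‖osc t s‖ = 1 := by
  rw [osc, mul_comm, Complex.norm_exp_ofReal_mul_I]

theorem continuous_osc (t : ℝ) : Continuous (osc t) := by unfold osc; fun_prop

/-- Valid at t = 0 as well: division by zero makes `osc 0` constant. This lets the later
differentiations in x be stated for every t. -/
theorem hasDerivAt_osc (t s : ℝ) :
    HasDerivAt (osc t) (Complex.I * ((s / (2 * t) : ℝ) : ℂ) * osc t s) s := by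
  have h1 : HasDerivAt (fun s : ℝ => s ^ 2 / (4 * t)) (s / (2 * t)) s := by
    convert! ((hasDerivAt_id s).pow 2).div_const (4 * t) using 1
    simp
    by_cases h : t = 0
    · simp [h]
    · field_simp; norm_num
  convert! (h1.ofReal_comp.const_mul Complex.I).cexp using 1
  rw [mul_comm]; rfl

/-- Integration by parts: `osc t` is the derivative of -i(2t/s) `osc t`, up to a correction of
modulus 2t/s². Boundary terms and correction add up to exactly 4t/a. -/
theorem norm_integral_osc_tail (t a b : ℝ) (ht : 0 < t) (ha : 0 < a) (hab : a ≤ b) :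
    ‖∫ s in a..b, osc t s‖ ≤ 4 * t / a := by
  have hd : ∀ s ∈ Set.uIcc a b, HasDerivAt
      (fun s : ℝ => (-Complex.I) * (((2 * t) * s⁻¹ : ℝ) : ℂ) * osc t s)
      (osc t s + Complex.I * (((2 * t) * (s ^ 2)⁻¹ : ℝ) : ℂ) * osc t s) s := by
    intro s hs
    rw [Set.uIcc_of_le hab] at hs
    have hs0 : s ≠ 0 := (ha.trans_le hs.1).ne'
    have h1 := (((hasDerivAt_inv hs0).const_mul (2 * t)).ofReal_comp.const_mul
      (-Complex.I)).mul (hasDerivAt_osc t s)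
    convert! h1 using 1
    push_cast
    have hsC : (s : ℂ) ≠ 0 := by exact_mod_cast hs0
    have htC : (t : ℂ) ≠ 0 := by exact_mod_cast ht.ne'
    field_simp
    ring_nf
    simp [Complex.I_sq]
  have hne : ∀ s ∈ Set.uIcc a b, s ≠ 0 := fun s hs => by
    rw [Set.uIcc_of_le hab] at hs; exact (ha.trans_le hs.1).ne'
  have hc : ContinuousOn (fun s : ℝ => (2 * t) * (s ^ 2)⁻¹) (Set.uIcc a b) := by
    refine continuousOn_const.mul (ContinuousOn.inv₀ (by fun_prop) fun s hs => ?_)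
    exact pow_ne_zero _ (hne s hs)
  have hi1 : IntervalIntegrable (osc t) volume a b := (continuous_osc t).intervalIntegrable _ _
  have hi2 : IntervalIntegrable (fun s : ℝ => Complex.I * (((2 * t) * (s ^ 2)⁻¹ : ℝ) : ℂ) * osc t s)
      volume a b := by
    apply ContinuousOn.intervalIntegrable
    exact (continuousOn_const.mul (Complex.continuous_ofReal.comp_continuousOn hc)).mul
      (continuous_osc t).continuousOn
  have h := intervalIntegral.integral_eq_sub_of_hasDerivAt hd (hi1.add hi2)
  rw [intervalIntegral.integral_add hi1 hi2] at h
  have hb : ‖∫ s in a..b, Complex.I * (((2 * t) * (s ^ 2)⁻¹ : ℝ) : ℂ) * osc t s‖ ≤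
      2 * t * a⁻¹ - 2 * t * b⁻¹ := by
    have h3 : ∫ s in a..b, (2 * t) * (s ^ 2)⁻¹ = 2 * t * a⁻¹ - 2 * t * b⁻¹ := by
      have h4 : ∀ s ∈ Set.uIcc a b, HasDerivAt (fun s : ℝ => -(2 * t * s⁻¹))
          ((2 * t) * (s ^ 2)⁻¹) s := by
        intro s hs
        convert! ((hasDerivAt_inv (hne s hs)).const_mul (2 * t)).neg using 1
        ring
      rw [intervalIntegral.integral_eq_sub_of_hasDerivAt h4 hc.intervalIntegrable]
      ring
    rw [← h3]
    refine intervalIntegral.norm_integral_le_of_norm_le hab ?_ hc.intervalIntegrable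
    refine Filter.Eventually.of_forall fun s _ => ?_
    rw [norm_mul, norm_mul, norm_osc, Complex.norm_I, Complex.norm_real, Real.norm_eq_abs,
      abs_of_nonneg (by positivity)]
    simp
  have hB : ∀ s : ℝ, 0 < s → ‖(-Complex.I) * (((2 * t) * s⁻¹ : ℝ) : ℂ) * osc t s‖ = 2 * t * s⁻¹ := by
    intro s hs
    rw [norm_mul, norm_mul, norm_osc, norm_neg, Complex.norm_I, Complex.norm_real,
      Real.norm_eq_abs, abs_of_nonneg (by positivity)]
    simp
  rw [eq_sub_of_add_eq h]
  refine (norm_sub_le _ _).trans ((add_le_add (norm_sub_le _ _) hb).trans ?_)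
  rw [hB b (ha.trans_le hab), hB a ha]
  apply le_of_eq
  ring

/-- The cut at √t balances the trivial bound against the tail bound: √t + 4t/√t. -/
theorem norm_integral_osc_zero (t b : ℝ) (ht : 0 < t) (hb : 0 ≤ b) :
    ‖∫ s in (0 : ℝ)..b, osc t s‖ ≤ 5 * √t := by
  have hst : 0 < √t := Real.sqrt_pos.mpr ht
  have hshort : ∀ c, 0 ≤ c → c ≤ √t → ‖∫ s in (0 : ℝ)..c, osc t s‖ ≤ √t := by
    intro c hc0 hc
    refine (intervalIntegral.norm_integral_le_of_norm_le_const (C := 1)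
      fun s _ => (norm_osc t s).le).trans ?_
    simpa [abs_of_nonneg hc0] using hc
  rcases le_total b (√t) with h | h
  · linarith [hshort b hb h]
  · have h1 := norm_integral_osc_tail t (√t) b ht hst h
    have h2 : 4 * t / √t = 4 * √t := by
      rw [mul_div_assoc, Real.div_sqrt]
    have h3 := intervalIntegral.integral_add_adjacent_intervals
      ((continuous_osc t).intervalIntegrable (μ := volume) 0 (√t))
      ((continuous_osc t).intervalIntegrable (μ := volume) (√t) b)
    rw [← h3]
    refine (norm_add_le _ _).trans ?_
    linarith [hshort (√t) hst.le le_rfl]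

theorem norm_integral_osc (t a b : ℝ) (ht : 0 < t) :
    ‖∫ s in a..b, osc t s‖ ≤ 10 * √t := by
  have h0 : ∀ c : ℝ, ‖∫ s in (0 : ℝ)..c, osc t s‖ ≤ 5 * √t := by
    intro c
    rcases le_total 0 c with h | h
    · exact norm_integral_osc_zero t c ht h
    · have h1 : ∫ s in (0 : ℝ)..c, osc t s = -∫ s in (0 : ℝ)..(-c), osc t s := by
        have h2 := intervalIntegral.integral_comp_neg (f := osc t) (a := 0) (b := c)
        have h3 : ∀ s, osc t (-s) = osc t s := fun s => by simp [osc]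
        simp only [h3, neg_zero] at h2
        rw [h2, intervalIntegral.integral_symm]
      rw [h1, norm_neg]
      exact norm_integral_osc_zero t (-c) ht (by linarith)
  rw [← intervalIntegral.integral_interval_sub_left
    ((continuous_osc t).intervalIntegrable (μ := volume) 0 b)
    ((continuous_osc t).intervalIntegrable (μ := volume) 0 a)]
  refine (norm_sub_le _ _).trans ?_
  linarith [h0 a, h0 b]

theorem continuous_osc_sub (t x : ℝ) : Continuous fun y => osc t (x - y) := by
  unfold osc; fun_prop

/-- Integration by parts against the primitive of the oscillating factor, which is bounded by 10√t
whatever x and the endpoint are. -/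
theorem norm_integral_osc_mul (g : ℝ → ℝ) (hg : ContDiff ℝ 1 g) (p r x t : ℝ) (hpr : p ≤ r)
    (ht : 0 < t) :
    ‖∫ y in p..r, osc t (x - y) * (g y : ℂ)‖ ≤ 10 * √t * (|g r| + ∫ y in p..r, |deriv g y|) := by
  have hW : ∀ y, ‖∫ s in p..y, osc t (x - s)‖ ≤ 10 * √t := by
    intro y
    rw [intervalIntegral.integral_comp_sub_left (osc t) x]
    exact norm_integral_osc _ _ _ ht
  have hWd : ∀ y ∈ Set.uIcc p r, HasDerivAt (fun y => ∫ s in p..y, osc t (x - s))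
      (osc t (x - y)) y := fun y _ =>
    intervalIntegral.integral_hasDerivAt_right ((continuous_osc_sub t x).intervalIntegrable _ _)
      ((continuous_osc_sub t x).stronglyMeasurableAtFilter _ _) (continuous_osc_sub t x).continuousAt
  have hgd : ∀ y ∈ Set.uIcc p r, HasDerivAt (fun y => (g y : ℂ)) ((deriv g y : ℝ) : ℂ) y :=
    fun y _ => ((hg.differentiable one_ne_zero) y).hasDerivAt.ofReal_comp
  have hg' : Continuous (deriv g) := hg.continuous_deriv le_rfl
  have hgc : Continuous fun y => ((deriv g y : ℝ) : ℂ) := Complex.continuous_ofReal.comp hg'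
  have h := intervalIntegral.integral_mul_deriv_eq_deriv_mul hgd hWd
    (hgc.intervalIntegrable _ _) ((continuous_osc_sub t x).intervalIntegrable _ _)
  simp only [intervalIntegral.integral_same, mul_zero, sub_zero] at h
  simp_rw [mul_comm (osc t (x - _))]
  rw [h, mul_add]
  refine (norm_sub_le _ _).trans (add_le_add ?_ ?_)
  · rw [norm_mul, Complex.norm_real, Real.norm_eq_abs, mul_comm]
    exact mul_le_mul_of_nonneg_right (hW r) (abs_nonneg _)
  · rw [← intervalIntegral.integral_const_mul]
    refine intervalIntegral.norm_integral_le_of_norm_le hpr ?_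
      ((hg'.abs.const_mul (10 * √t)).intervalIntegrable _ _)
    refine Filter.Eventually.of_forall fun y _ => ?_
    rw [norm_mul, Complex.norm_real, Real.norm_eq_abs, mul_comm]
    exact mul_le_mul_of_nonneg_right (hW y) (abs_nonneg _)

/-- The normalisation `(4πi)^{-1/2}` of the free propagator. -/
noncomputable def propConst : ℂ := 1 / ((√(2 * Real.pi) : ℝ) * (1 + Complex.I))

theorem freeProp_eq (g : ℝ → ℝ) (p r x t : ℝ) :
    freeProp g p r x t =
      propConst * ((√t)⁻¹ : ℝ) * ∫ y in p..r, osc t (x - y) * (g y : ℂ) := rfl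

/-- The spatial derivative of `freeProp`. -/
noncomputable def freePropDeriv (g : ℝ → ℝ) (p r x t : ℝ) : ℂ :=
  propConst * ((√t)⁻¹ : ℝ) *
    ∫ y in p..r, Complex.I * (((x - y) / (2 * t) : ℝ) : ℂ) * osc t (x - y) * (g y : ℂ)

/-- Oscillation compensates the singular factor t^{-1/2} and gives the bound 1; the trivial estimate
of the integral keeps the decay t^{-1/2}. Uniformity in x is essential later. -/
theorem norm_freeProp_le (g : ℝ → ℝ) (hg : ContDiff ℝ 1 g) (p r : ℝ) (hpr : p ≤ r) :
    ∃ C, 0 ≤ C ∧ ∀ x t, 0 < t → ‖freeProp g p r x t‖ ≤ C * min 1 (√t)⁻¹ := by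
  have hI : 0 ≤ ∫ y in p..r, |deriv g y| :=
    intervalIntegral.integral_nonneg hpr fun _ _ => abs_nonneg _
  have hI2 : 0 ≤ ∫ y in p..r, |g y| :=
    intervalIntegral.integral_nonneg hpr fun _ _ => abs_nonneg _
  refine ⟨‖propConst‖ * (10 * (|g r| + ∫ y in p..r, |deriv g y|) + ∫ y in p..r, |g y|),
    by positivity, fun x t ht => ?_⟩
  have hst : 0 < √t := Real.sqrt_pos.mpr ht
  have h1 := norm_integral_osc_mul g hg p r x t hpr ht
  have h2 : ‖∫ y in p..r, osc t (x - y) * (g y : ℂ)‖ ≤ ∫ y in p..r, |g y| := by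
    refine intervalIntegral.norm_integral_le_of_norm_le hpr ?_
      (hg.continuous.abs.intervalIntegrable _ _)
    refine Filter.Eventually.of_forall fun y _ => ?_
    rw [norm_mul, norm_osc, one_mul, Complex.norm_real, Real.norm_eq_abs]
  rw [freeProp_eq, norm_mul, norm_mul, Complex.norm_real, Real.norm_eq_abs,
    abs_of_pos (by positivity), mul_assoc, mul_assoc]
  refine mul_le_mul_of_nonneg_left ?_ (norm_nonneg _)
  rcases min_choice 1 (√t)⁻¹ with h | h <;> rw [h]
  · calc (√t)⁻¹ * ‖∫ y in p..r, osc t (x - y) * (g y : ℂ)‖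
        ≤ (√t)⁻¹ * (10 * √t * (|g r| + ∫ y in p..r, |deriv g y|)) := by gcongr
      _ = 10 * (|g r| + ∫ y in p..r, |deriv g y|) := by field_simp
      _ ≤ _ := by linarith
  · rw [mul_comm]
    gcongr
    linarith [h2, abs_nonneg (g r)]

/-- The x-derivative of the kernel is minus its y-derivative. Integration by parts moves it onto g
and leaves boundary terms of modulus |g p| and |g r|, so only the normalising t^{-1/2} remains. -/
theorem norm_freePropDeriv_le (g : ℝ → ℝ) (hg : ContDiff ℝ 1 g) (p r : ℝ) (hpr : p ≤ r) :
    ∃ C, 0 ≤ C ∧ ∀ x t, 0 < t → ‖freePropDeriv g p r x t‖ ≤ C * (√t)⁻¹ := by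
  have hI : 0 ≤ ∫ y in p..r, |deriv g y| :=
    intervalIntegral.integral_nonneg hpr fun _ _ => abs_nonneg _
  refine ⟨‖propConst‖ * (|g r| + |g p| + ∫ y in p..r, |deriv g y|), by positivity,
    fun x t ht => ?_⟩
  have hg' : Continuous (deriv g) := hg.continuous_deriv le_rfl
  have hE : ∀ y ∈ Set.uIcc p r, HasDerivAt (fun y => -osc t (x - y))
      (Complex.I * (((x - y) / (2 * t) : ℝ) : ℂ) * osc t (x - y)) y := by
    intro y _
    have h1 : HasDerivAt (fun y : ℝ => x - y) (-1) y := by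
      simpa using (hasDerivAt_id y).const_sub x
    convert! ((hasDerivAt_osc t (x - y)).scomp y h1).neg using 1
    simp
  have hgd : ∀ y ∈ Set.uIcc p r, HasDerivAt (fun y => (g y : ℂ)) ((deriv g y : ℝ) : ℂ) y :=
    fun y _ => ((hg.differentiable one_ne_zero) y).hasDerivAt.ofReal_comp
  have hgc : Continuous fun y => ((deriv g y : ℝ) : ℂ) := Complex.continuous_ofReal.comp hg'
  have h := intervalIntegral.integral_deriv_mul_eq_sub hE hgd
    (by apply Continuous.intervalIntegrable; have := continuous_osc_sub t x; fun_prop)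
    (hgc.intervalIntegrable _ _)
  have hi1 : IntervalIntegrable
      (fun y => Complex.I * (((x - y) / (2 * t) : ℝ) : ℂ) * osc t (x - y) * (g y : ℂ))
      volume p r := by
    apply Continuous.intervalIntegrable
    have := continuous_osc_sub t x
    have := hg.continuous
    fun_prop
  have hi2 : IntervalIntegrable (fun y => -osc t (x - y) * ((deriv g y : ℝ) : ℂ)) volume p r := by
    apply Continuous.intervalIntegrable
    have := continuous_osc_sub t x
    fun_prop
  rw [intervalIntegral.integral_add hi1 hi2] at h
  rw [freePropDeriv, norm_mul, norm_mul, Complex.norm_real, Real.norm_eq_abs,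
    abs_of_nonneg (by positivity), eq_sub_of_add_eq h, mul_assoc, mul_assoc,
    mul_comm ((√t)⁻¹)]
  gcongr
  refine (norm_sub_le _ _).trans (add_le_add ((norm_sub_le _ _).trans (le_of_eq ?_)) ?_)
  · simp [norm_osc]
  · refine intervalIntegral.norm_integral_le_of_norm_le hpr ?_ (hg'.abs.intervalIntegrable _ _)
    refine Filter.Eventually.of_forall fun y _ => ?_
    rw [norm_mul, norm_neg, norm_osc, one_mul, Complex.norm_real, Real.norm_eq_abs]

theorem hasDerivAt_freeProp (g : ℝ → ℝ) (hg : Continuous g) (p r x t : ℝ) :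
    HasDerivAt (fun x => freeProp g p r x t) (freePropDeriv g p r x t) x := by
  simp_rw [freeProp_eq, freePropDeriv]
  refine HasDerivAt.const_mul _ ?_
  obtain ⟨C, hC⟩ := (isCompact_uIcc (a := p) (b := r)).exists_bound_of_continuousOn
    (f := fun y => g y * (|x| + 1 + |y|) / (2 * |t|)) (by fun_prop)
  refine (intervalIntegral.hasDerivAt_integral_of_dominated_loc_of_deriv_le
    (F := fun x y => osc t (x - y) * (g y : ℂ))
    (F' := fun x y => Complex.I * (((x - y) / (2 * t) : ℝ) : ℂ) * osc t (x - y) * (g y : ℂ))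
    (μ := volume) (bound := fun _ => C)
    (Metric.ball_mem_nhds x one_pos) ?_ ?_ ?_ ?_ ?_ ?_).2
  · refine Filter.Eventually.of_forall fun x => ?_
    have := continuous_osc_sub t x
    apply Continuous.aestronglyMeasurable
    fun_prop
  · apply Continuous.intervalIntegrable
    have := continuous_osc_sub t x
    fun_prop
  · have := continuous_osc_sub t x
    apply Continuous.aestronglyMeasurable
    fun_prop
  · refine Filter.Eventually.of_forall fun y hy z hz => ?_
    refine le_trans ?_ (hC y (Set.uIoc_subset_uIcc hy))
    simp only [norm_mul, norm_osc, Complex.norm_I, Complex.norm_real, norm_div, Real.norm_eq_abs,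
      one_mul, mul_one, abs_two, abs_abs]
    rw [div_mul_eq_mul_div, mul_comm, abs_of_nonneg (by positivity : 0 ≤ |x| + 1 + |y|)]
    gcongr
    have h1 : |z - x| < 1 := by simpa [Real.dist_eq] using hz
    calc |z - y| = |(z - x) + x - y| := by ring_nf
      _ ≤ |z - x| + |x| + |y| := (abs_sub _ _).trans (by gcongr; exact abs_add_le _ _)
      _ ≤ |x| + 1 + |y| := by linarith
  · simp
  · refine Filter.Eventually.of_forall fun y hy z hz => ?_
    have h1 : HasDerivAt (fun z : ℝ => z - y) 1 z := (hasDerivAt_id z).sub_const y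
    convert! ((hasDerivAt_osc t (z - y)).scomp z h1).mul_const (g y : ℂ) using 1
    simp

theorem measurable_osc_uncurry : Measurable fun z : ℝ × ℝ => osc z.1 z.2 := by
  unfold osc; fun_prop

theorem measurable_freeProp (g : ℝ → ℝ) (hg : Continuous g) (p r : ℝ) (hpr : p ≤ r) :
    Measurable fun z : ℝ × ℝ => freeProp g p r z.1 z.2 := by
  simp_rw [freeProp_eq, intervalIntegral.integral_of_le hpr]
  refine Measurable.mul (by fun_prop) ?_
  refine StronglyMeasurable.measurable ?_
  refine StronglyMeasurable.integral_prod_right'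
    (f := fun w : (ℝ × ℝ) × ℝ => osc w.1.2 (w.1.1 - w.2) * (g w.2 : ℂ)) ?_
  refine Measurable.stronglyMeasurable ?_
  refine Measurable.mul ?_ (by fun_prop)
  exact measurable_osc_uncurry.comp
    (g := fun z : ℝ × ℝ => osc z.1 z.2) (f := fun w : (ℝ × ℝ) × ℝ => (w.1.2, w.1.1 - w.2))
    (by fun_prop)

theorem measurable_freePropDeriv (g : ℝ → ℝ) (hg : Continuous g) (p r : ℝ) (hpr : p ≤ r) :
    Measurable fun z : ℝ × ℝ => freePropDeriv g p r z.1 z.2 := by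
  simp_rw [freePropDeriv, intervalIntegral.integral_of_le hpr]
  refine Measurable.mul (by fun_prop) ?_
  refine StronglyMeasurable.measurable ?_
  refine StronglyMeasurable.integral_prod_right'
    (f := fun w : (ℝ × ℝ) × ℝ => Complex.I * (((w.1.1 - w.2) / (2 * w.1.2) : ℝ) : ℂ) *
      osc w.1.2 (w.1.1 - w.2) * (g w.2 : ℂ)) ?_
  refine Measurable.stronglyMeasurable ?_
  refine Measurable.mul (Measurable.mul (by fun_prop) ?_) (by fun_prop)
  exact measurable_osc_uncurry.comp
    (g := fun z : ℝ × ℝ => osc z.1 z.2) (f := fun w : (ℝ × ℝ) × ℝ => (w.1.2, w.1.1 - w.2))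
    (by fun_prop)

/-! ### Tensor products and the time majorant -/

/-- The integrable majorant `t^{-1/2} min(1, t^{-1/2})²`. -/
noncomputable def timeBound (t : ℝ) : ℝ := (√t)⁻¹ * (min 1 (√t)⁻¹) ^ 2

theorem timeBound_nonneg (t : ℝ) : 0 ≤ timeBound t := by
  unfold timeBound; positivity

theorem timeBound_le (t : ℝ) : timeBound t ≤ (√t)⁻¹ := by
  have h0 : (0 : ℝ) ≤ min 1 (√t)⁻¹ := by positivity
  have h1 : (min 1 (√t)⁻¹) ^ 2 ≤ 1 := pow_le_one₀ h0 (min_le_left _ _)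
  exact mul_le_of_le_one_right (by positivity) h1

theorem timeBound_integrableOn : IntegrableOn timeBound (Set.Ioi 0) := by
  have hm : Measurable timeBound := by unfold timeBound; fun_prop
  rw [← Set.Ioc_union_Ioi_eq_Ioi (zero_le_one' ℝ)]
  refine IntegrableOn.union ?_ ?_
  · have h1 := (intervalIntegral.intervalIntegrable_rpow' (a := 0) (b := 1)
      (r := -(1 / 2)) (by norm_num)).1
    refine Integrable.mono' h1 hm.aestronglyMeasurable ?_
    refine (ae_restrict_iff' measurableSet_Ioc).mpr (Filter.Eventually.of_forall fun t ht => ?_)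
    rw [Real.norm_eq_abs, abs_of_nonneg (timeBound_nonneg t), Real.rpow_neg ht.1.le,
      ← Real.sqrt_eq_rpow]
    exact timeBound_le t
  · have h1 := integrableOn_Ioi_rpow_of_lt (a := -(3 / 2)) (by norm_num) one_pos
    refine Integrable.mono' h1 hm.aestronglyMeasurable ?_
    refine (ae_restrict_iff' measurableSet_Ioi).mpr (Filter.Eventually.of_forall fun t ht => ?_)
    have ht0 : 0 < t := one_pos.trans ht
    rw [Real.norm_eq_abs, abs_of_nonneg (timeBound_nonneg t), Real.rpow_neg ht0.le]
    have h2 : t ^ (3 / 2 : ℝ) = (√t) ^ 3 := by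
      rw [Real.sqrt_eq_rpow, ← Real.rpow_natCast, ← Real.rpow_mul ht0.le]; norm_num
    rw [h2, timeBound]
    calc (√t)⁻¹ * (min 1 (√t)⁻¹) ^ 2 ≤ (√t)⁻¹ * ((√t)⁻¹) ^ 2 := by
          gcongr; exact min_le_right _ _
      _ = _ := by field_simp

/-- A tensor product density on a box: the one-dimensional factors `g j` on `(p j, r j)`. -/
structure BoxProfile (n : ℕ) where
  /-- the factors -/
  g : Fin n → ℝ → ℝ
  /-- the lower ends -/
  p : Fin n → ℝ
  /-- the upper ends -/
  r : Fin n → ℝ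
  contDiff : ∀ j, ContDiff ℝ 1 (g j)
  le : ∀ j, p j ≤ r j

namespace BoxProfile

variable {n : ℕ} (D : BoxProfile n)

/-- The free Schrödinger evolution of the density. -/
noncomputable def wave (x : EuclideanSpace ℝ (Fin n)) (t : ℝ) : ℂ :=
  ∏ j, freeProp (D.g j) (D.p j) (D.r j) (x j) t

/-- The `j`-th partial derivative of `wave`. -/
noncomputable def wavePartial (x : EuclideanSpace ℝ (Fin n)) (t : ℝ) (j : Fin n) : ℂ :=
  (∏ i ∈ Finset.univ.erase j, freeProp (D.g i) (D.p i) (D.r i) (x i) t) *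
    freePropDeriv (D.g j) (D.p j) (D.r j) (x j) t

/-- The Fréchet derivative of `wave`. -/
noncomputable def waveDeriv (x : EuclideanSpace ℝ (Fin n)) (t : ℝ) :
    EuclideanSpace ℝ (Fin n) →L[ℝ] ℂ :=
  ∑ j, ContinuousLinearMap.smulRight (EuclideanSpace.proj j : EuclideanSpace ℝ (Fin n) →L[ℝ] ℝ)
    (D.wavePartial x t j)

theorem waveDeriv_apply (x v : EuclideanSpace ℝ (Fin n)) (t : ℝ) :
    D.waveDeriv x t v = ∑ j, (v j : ℂ) * D.wavePartial x t j := by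
  simp [waveDeriv]

theorem hasFDerivAt_wave (x : EuclideanSpace ℝ (Fin n)) (t : ℝ) :
    HasFDerivAt (fun x => D.wave x t) (D.waveDeriv x t) x := by
  have h1 : ∀ j : Fin n, HasFDerivAt
      (fun x : EuclideanSpace ℝ (Fin n) => freeProp (D.g j) (D.p j) (D.r j) (x j) t)
      (ContinuousLinearMap.smulRight (EuclideanSpace.proj j : EuclideanSpace ℝ (Fin n) →L[ℝ] ℝ)
        (freePropDeriv (D.g j) (D.p j) (D.r j) (x j) t)) x := by
    intro j
    have h2 := hasDerivAt_freeProp (D.g j) (D.contDiff j).continuous (D.p j) (D.r j) (x j) t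
    have h3 : HasFDerivAt (fun x : EuclideanSpace ℝ (Fin n) => x j)
      (EuclideanSpace.proj j : EuclideanSpace ℝ (Fin n) →L[ℝ] ℝ) x :=
      (EuclideanSpace.proj j : EuclideanSpace ℝ (Fin n) →L[ℝ] ℝ).hasFDerivAt
    convert! h2.hasFDerivAt.comp x h3 using 1
  have h := HasFDerivAt.finsetProd (u := Finset.univ) (x := x) fun j _ => h1 j
  have e : D.waveDeriv x t = ∑ i, (∏ j ∈ Finset.univ.erase i,
      freeProp (D.g j) (D.p j) (D.r j) (x j) t) • ContinuousLinearMap.smulRight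
        (EuclideanSpace.proj i : EuclideanSpace ℝ (Fin n) →L[ℝ] ℝ)
        (freePropDeriv (D.g i) (D.p i) (D.r i) (x i) t) := by
    ext v
    rw [waveDeriv_apply]
    simp only [wavePartial, sum_apply, smul_apply, ContinuousLinearMap.smulRight_apply,
      smul_eq_mul]
    refine Finset.sum_congr rfl fun j _ => ?_
    simp
    ring
  rw [e]
  exact h

theorem measurable_wave :
    Measurable fun z : EuclideanSpace ℝ (Fin n) × ℝ => D.wave z.1 z.2 := by
  unfold wave
  refine Finset.measurable_prod _ fun j _ => ?_
  exact (measurable_freeProp (D.g j) (D.contDiff j).continuous (D.p j) (D.r j) (D.le j)).comp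
    (f := fun z : EuclideanSpace ℝ (Fin n) × ℝ => (z.1 j, z.2)) (by fun_prop)

theorem measurable_wavePartial (j : Fin n) :
    Measurable fun z : EuclideanSpace ℝ (Fin n) × ℝ => D.wavePartial z.1 z.2 j := by
  unfold wavePartial
  refine Measurable.mul (Finset.measurable_prod _ fun i _ => ?_) ?_
  · exact (measurable_freeProp (D.g i) (D.contDiff i).continuous (D.p i) (D.r i) (D.le i)).comp
      (f := fun z : EuclideanSpace ℝ (Fin n) × ℝ => (z.1 i, z.2)) (by fun_prop)
  · exact (measurable_freePropDeriv (D.g j) (D.contDiff j).continuous (D.p j) (D.r j)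
      (D.le j)).comp (f := fun z : EuclideanSpace ℝ (Fin n) × ℝ => (z.1 j, z.2)) (by fun_prop)

/-- Three factors min(1, t^{-1/2}) are kept and the other n - 3 are bounded by 1. Two factors would
leave only t^{-1} at infinity. -/
theorem norm_wave_le (hn : 3 ≤ n) :
    ∃ C, 0 ≤ C ∧ ∀ x t, 0 < t → ‖D.wave x t‖ ≤ C * timeBound t := by
  choose C hC0 hC using fun j => norm_freeProp_le (D.g j) (D.contDiff j) (D.p j) (D.r j) (D.le j)
  refine ⟨∏ j, C j, Finset.prod_nonneg fun j _ => hC0 j, fun x t ht => ?_⟩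
  have h0 : (0 : ℝ) ≤ min 1 (√t)⁻¹ := by positivity
  rw [wave, norm_prod]
  refine (Finset.prod_le_prod (fun _ _ => norm_nonneg _) fun j _ => hC j (x j) t ht).trans ?_
  rw [Finset.prod_mul_distrib, Finset.prod_const, Finset.card_univ, Fintype.card_fin]
  refine mul_le_mul_of_nonneg_left ?_ (Finset.prod_nonneg fun j _ => hC0 j)
  refine (pow_le_pow_of_le_one h0 (min_le_left _ _) hn).trans ?_
  rw [timeBound, pow_succ, mul_comm]
  gcongr
  exact min_le_right _ _

/-- The n - 1 ≥ 2 undifferentiated factors supply the squared minimum, the differentiated one the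
factor t^{-1/2}. -/
theorem norm_wavePartial_le (hn : 3 ≤ n) :
    ∃ C, 0 ≤ C ∧ ∀ x t j, 0 < t → ‖D.wavePartial x t j‖ ≤ C * timeBound t := by
  choose C hC0 hC using fun j => norm_freeProp_le (D.g j) (D.contDiff j) (D.p j) (D.r j) (D.le j)
  choose C' hC0' hC' using
    fun j => norm_freePropDeriv_le (D.g j) (D.contDiff j) (D.p j) (D.r j) (D.le j)
  have hK : ∀ j, 0 ≤ (∏ i ∈ Finset.univ.erase j, C i) * C' j := fun j =>
    mul_nonneg (Finset.prod_nonneg fun j _ => hC0 j) (hC0' j)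
  refine ⟨∑ j, (∏ i ∈ Finset.univ.erase j, C i) * C' j, Finset.sum_nonneg fun j _ => hK j,
    fun x t j ht => ?_⟩
  have h0 : (0 : ℝ) ≤ min 1 (√t)⁻¹ := by positivity
  refine le_trans ?_ (mul_le_mul_of_nonneg_right
    (Finset.single_le_sum (fun j _ => hK j) (Finset.mem_univ j)) (timeBound_nonneg t))
  rw [wavePartial, norm_mul, norm_prod]
  have h1 : ∏ i ∈ Finset.univ.erase j, ‖freeProp (D.g i) (D.p i) (D.r i) (x i) t‖ ≤
      (∏ i ∈ Finset.univ.erase j, C i) * (min 1 (√t)⁻¹) ^ 2 := by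
    refine (Finset.prod_le_prod (fun _ _ => norm_nonneg _) fun j _ => hC j (x j) t ht).trans ?_
    rw [Finset.prod_mul_distrib, Finset.prod_const, Finset.card_erase_of_mem (Finset.mem_univ j),
      Finset.card_univ, Fintype.card_fin]
    exact mul_le_mul_of_nonneg_left (pow_le_pow_of_le_one h0 (min_le_left _ _) (by omega))
      (Finset.prod_nonneg fun j _ => hC0 j)
  refine (mul_le_mul h1 (hC' j (x j) t ht) (norm_nonneg _)
    (mul_nonneg (Finset.prod_nonneg fun j _ => hC0 j) (by positivity))).trans (le_of_eq ?_)
  rw [timeBound]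
  ring

theorem norm_waveDeriv_le (hn : 3 ≤ n) :
    ∃ C, 0 ≤ C ∧ ∀ x t, 0 < t → ‖D.waveDeriv x t‖ ≤ C * timeBound t := by
  obtain ⟨C, hC0, hC⟩ := D.norm_wavePartial_le hn
  refine ⟨n * C, by positivity, fun x t ht => ?_⟩
  refine ContinuousLinearMap.opNorm_le_bound _
    (mul_nonneg (by positivity) (timeBound_nonneg t)) fun v => ?_
  rw [waveDeriv_apply]
  refine (norm_sum_le _ _).trans ?_
  have : ∀ j ∈ Finset.univ, ‖(v j : ℂ) * D.wavePartial x t j‖ ≤ C * timeBound t * ‖v‖ := by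
    intro j _
    rw [norm_mul, mul_comm, Complex.norm_real]
    exact mul_le_mul (hC x t j ht) (PiLp.norm_apply_le v j) (norm_nonneg _)
      (mul_nonneg hC0 (timeBound_nonneg t))
  refine (Finset.sum_le_sum this).trans (le_of_eq ?_)
  simp
  ring

/-! ### The potential and its C¹ regularity -/

/-- The time factor `exp(iκ²t)`. -/
noncomputable def _root_.Diffraction.phase (κ t : ℝ) : ℂ :=
  Complex.exp (Complex.I * (κ : ℂ) ^ 2 * (t : ℂ))

theorem _root_.Diffraction.norm_phase (κ t : ℝ) : ‖phase κ t‖ = 1 := by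
  have : Complex.I * (κ : ℂ) ^ 2 * (t : ℂ) = ((κ ^ 2 * t : ℝ) : ℂ) * Complex.I := by
    push_cast; ring
  rw [phase, this, Complex.norm_exp_ofReal_mul_I]

theorem _root_.Diffraction.continuous_phase (κ : ℝ) : Continuous (phase κ) := by
  unfold phase; fun_prop

theorem integrableOn_phase_wave (hn : 3 ≤ n) (κ : ℝ) (x : EuclideanSpace ℝ (Fin n)) :
    IntegrableOn (fun t => phase κ t * D.wave x t) (Set.Ioi 0) := by
  obtain ⟨C, hC0, hC⟩ := D.norm_wave_le hn
  refine Integrable.mono' (timeBound_integrableOn.const_mul C) ?_ ?_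
  · exact ((continuous_phase κ).measurable.mul
      (D.measurable_wave.comp measurable_prodMk_left)).aestronglyMeasurable
  · refine (ae_restrict_iff' measurableSet_Ioi).mpr (Filter.Eventually.of_forall fun t ht => ?_)
    rw [norm_mul, norm_phase, one_mul]
    exact hC x t ht

theorem integrableOn_phase_waveDeriv (hn : 3 ≤ n) (κ : ℝ) (x : EuclideanSpace ℝ (Fin n)) :
    IntegrableOn (fun t => phase κ t • D.waveDeriv x t) (Set.Ioi 0) := by
  obtain ⟨C, hC0, hC⟩ := D.norm_waveDeriv_le hn
  refine Integrable.mono' (timeBound_integrableOn.const_mul C) ?_ ?_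
  · refine (continuous_phase κ).aestronglyMeasurable.smul ?_
    refine Finset.aestronglyMeasurable_fun_sum _ fun j _ => ?_
    exact (ContinuousLinearMap.smulRightL ℝ (EuclideanSpace ℝ (Fin n)) ℂ
      (EuclideanSpace.proj j)).continuous.comp_aestronglyMeasurable
      ((D.measurable_wavePartial j).comp measurable_prodMk_left).aestronglyMeasurable
  · refine (ae_restrict_iff' measurableSet_Ioi).mpr (Filter.Eventually.of_forall fun t ht => ?_)
    rw [norm_smul, norm_phase, one_mul]
    exact hC x t ht

/-- The potential `i ∫_0^∞ exp(iκ²t) (wave at time t) dt`. -/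
noncomputable def pot (κ : ℝ) (x : EuclideanSpace ℝ (Fin n)) : ℂ :=
  Complex.I * ∫ t in Set.Ioi (0 : ℝ), phase κ t * D.wave x t

/-- The derivative of `pot`. -/
noncomputable def potDeriv (κ : ℝ) (x : EuclideanSpace ℝ (Fin n)) :
    EuclideanSpace ℝ (Fin n) →L[ℝ] ℂ :=
  Complex.I • ∫ t in Set.Ioi (0 : ℝ), phase κ t • D.waveDeriv x t

theorem hasFDerivAt_pot (hn : 3 ≤ n) (κ : ℝ) (x : EuclideanSpace ℝ (Fin n)) :
    HasFDerivAt (D.pot κ) (D.potDeriv κ x) x := by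
  obtain ⟨C, hC0, hC⟩ := D.norm_waveDeriv_le hn
  refine HasFDerivAt.const_mul ?_ _
  refine hasFDerivAt_integral_of_dominated_of_fderiv_le (𝕜 := ℝ)
    (F' := fun x t => phase κ t • D.waveDeriv x t) (bound := fun t => C * timeBound t)
    Filter.univ_mem ?_ (D.integrableOn_phase_wave hn κ x)
    (D.integrableOn_phase_waveDeriv hn κ x).aestronglyMeasurable ?_
    (timeBound_integrableOn.const_mul C) ?_
  · exact Filter.Eventually.of_forall fun x => (D.integrableOn_phase_wave hn κ x).aestronglyMeasurable
  · refine (ae_restrict_iff' measurableSet_Ioi).mpr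
      (Filter.Eventually.of_forall fun t ht x _ => ?_)
    rw [norm_smul, norm_phase, one_mul]
    exact hC x t ht
  · exact Filter.Eventually.of_forall fun t x _ => (D.hasFDerivAt_wave x t).const_mul _

theorem continuous_freePropDeriv (g : ℝ → ℝ) (hg : Continuous g) (p r t : ℝ) :
    Continuous fun x => freePropDeriv g p r x t := by
  unfold freePropDeriv
  refine continuous_const.mul ?_
  refine intervalIntegral.continuous_parametric_intervalIntegral_of_continuous' ?_ _ _
  unfold osc
  fun_prop

theorem continuous_freeProp (g : ℝ → ℝ) (hg : Continuous g) (p r t : ℝ) :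
    Continuous fun x => freeProp g p r x t :=
  continuous_iff_continuousAt.mpr fun x => (hasDerivAt_freeProp g hg p r x t).continuousAt

theorem continuous_waveDeriv (t : ℝ) : Continuous fun x => D.waveDeriv x t := by
  unfold waveDeriv
  refine continuous_finsetSum _ fun j _ => ?_
  refine (ContinuousLinearMap.smulRightL ℝ (EuclideanSpace ℝ (Fin n)) ℂ
      (EuclideanSpace.proj j)).continuous.comp ?_
  unfold wavePartial
  refine Continuous.mul (continuous_finsetProd _ fun i _ => ?_) ?_
  · exact (continuous_freeProp _ (D.contDiff i).continuous _ _ t).comp (by fun_prop)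
  · exact (continuous_freePropDeriv _ (D.contDiff j).continuous _ _ t).comp (by fun_prop)

theorem contDiff_pot (hn : 3 ≤ n) (κ : ℝ) : ContDiff ℝ 1 (D.pot κ) := by
  rw [contDiff_one_iff_hasFDerivAt]
  refine ⟨D.potDeriv κ, ?_, D.hasFDerivAt_pot hn κ⟩
  obtain ⟨C, hC0, hC⟩ := D.norm_waveDeriv_le hn
  have hc : Continuous fun x => ∫ t in Set.Ioi (0 : ℝ), phase κ t • D.waveDeriv x t := by
    refine continuous_of_dominated (bound := fun t => C * timeBound t)
      (fun x => (D.integrableOn_phase_waveDeriv hn κ x).aestronglyMeasurable) (fun x => ?_)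
      (timeBound_integrableOn.const_mul C) ?_
    · refine (ae_restrict_iff' measurableSet_Ioi).mpr
        (Filter.Eventually.of_forall fun t ht => ?_)
      rw [norm_smul, norm_phase, one_mul]
      exact hC x t ht
    · exact Filter.Eventually.of_forall fun t => (D.continuous_waveDeriv t).fun_const_smul _
  exact hc.fun_const_smul _

theorem fderiv_pot_apply (hn : 3 ≤ n) (κ : ℝ) (x v : EuclideanSpace ℝ (Fin n)) :
    fderiv ℝ (D.pot κ) x v =
      Complex.I * ∫ t in Set.Ioi (0 : ℝ), phase κ t * D.waveDeriv x t v := by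
  rw [(D.hasFDerivAt_pot hn κ x).fderiv, potDeriv, smul_apply,
    ContinuousLinearMap.integral_apply (D.integrableOn_phase_waveDeriv hn κ x)]
  simp

/-! ### The evolution as an integral over the box -/

/-- The box carrying the density. -/
def box : Set (EuclideanSpace ℝ (Fin n)) := {y | ∀ j, y j ∈ Set.Ioc (D.p j) (D.r j)}

/-- The tensor product of the factors. -/
noncomputable def weight (y : EuclideanSpace ℝ (Fin n)) : ℂ := ∏ j, (D.g j (y j) : ℂ)

theorem measurableSet_box : MeasurableSet D.box := by
  have : D.box = ⋂ j, {y | y j ∈ Set.Ioc (D.p j) (D.r j)} := by ext; simp [box]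
  rw [this]
  refine MeasurableSet.iInter fun j => ?_
  exact measurableSet_Ioc.preimage (by fun_prop)

theorem continuous_weight : Continuous D.weight := by
  unfold weight
  refine continuous_finsetProd _ fun j _ => ?_
  have := (D.contDiff j).continuous
  fun_prop

theorem exists_norm_le : ∃ K, 0 < K ∧ ∀ y ∈ D.box, ‖y‖ ≤ K := by
  refine ⟨1 + ∑ j, (|D.p j| + |D.r j|), by positivity, fun y hy => ?_⟩
  have h1 : ‖y‖ ≤ ∑ j, ‖y j‖ := by
    have h := (EuclideanSpace.basisFun (Fin n) ℝ).sum_repr y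
    conv_lhs => rw [← h]
    refine (norm_sum_le _ _).trans (Finset.sum_le_sum fun j _ => ?_)
    simp [norm_smul]
  have h2 : ∑ j, ‖y j‖ ≤ ∑ j, (|D.p j| + |D.r j|) := by
    refine Finset.sum_le_sum fun j _ => ?_
    rw [Real.norm_eq_abs, abs_le]
    have := hy j
    constructor
    · linarith [this.1, neg_abs_le (D.p j), abs_nonneg (D.r j)]
    · linarith [this.2, le_abs_self (D.r j), abs_nonneg (D.p j)]
  linarith

theorem volume_box_lt_top : volume D.box < ⊤ := by
  obtain ⟨K, hK0, hK⟩ := D.exists_norm_le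
  exact (measure_mono fun y hy => mem_closedBall_zero_iff.mpr (hK y hy)).trans_lt
    (isCompact_closedBall (0 : EuclideanSpace ℝ (Fin n)) K).measure_lt_top

theorem integrableOn_box {f : EuclideanSpace ℝ (Fin n) → ℂ} (hf : Continuous f) :
    IntegrableOn f D.box := by
  obtain ⟨K, hK0, hK⟩ := D.exists_norm_le
  exact (hf.continuousOn.integrableOn_compact
    (isCompact_closedBall (0 : EuclideanSpace ℝ (Fin n)) K)).mono_set
    fun y hy => mem_closedBall_zero_iff.mpr (hK y hy)

/-- Fubini for products. The box is half-open so that it agrees with the interval integrals factor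
by factor. -/
theorem prod_intervalIntegral (f : Fin n → ℝ → ℂ) :
    ∏ j, ∫ y in (D.p j)..(D.r j), f j y = ∫ y in D.box, ∏ j, f j (y j) := by
  have hi : ∀ j, ∫ y in (D.p j)..(D.r j), f j y =
      ∫ y, (Set.Ioc (D.p j) (D.r j)).indicator (f j) y := fun j => by
    rw [intervalIntegral.integral_of_le (D.le j), integral_indicator measurableSet_Ioc]
  simp_rw [hi]
  rw [← integral_fintype_prod_volume_eq_prod, ← integral_indicator D.measurableSet_box,
    ← (PiLp.volume_preserving_toLp (Fin n)).integral_comp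
      (MeasurableEquiv.toLp 2 (Fin n → ℝ)).measurableEmbedding]
  congr 1
  funext y
  by_cases h : WithLp.toLp 2 y ∈ D.box
  · rw [Set.indicator_of_mem h]
    refine Finset.prod_congr rfl fun j _ => ?_
    rw [Set.indicator_of_mem (h j)]
  · rw [Set.indicator_of_notMem h]
    have h' : ∃ j, ¬ (y j ∈ Set.Ioc (D.p j) (D.r j)) := by
      by_contra! hc
      exact h hc
    obtain ⟨j, hj⟩ := h'
    exact Finset.prod_eq_zero (Finset.mem_univ j) (Set.indicator_of_notMem hj _)

theorem prod_osc (x y : EuclideanSpace ℝ (Fin n)) (t : ℝ) :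
    ∏ j, osc t (x j - y j) = osc t ‖x - y‖ := by
  simp only [osc]
  rw [← Complex.exp_sum, ← Finset.mul_sum, EuclideanSpace.norm_sq_eq, Finset.sum_div]
  simp only [Real.norm_eq_abs, sq_abs, PiLp.sub_apply]
  push_cast
  rfl

/-- The product of the one-dimensional phases depends only on ‖x - y‖. This radial kernel is what
the radiation estimate and the Fourier representation work with. -/
theorem wave_eq (x : EuclideanSpace ℝ (Fin n)) (t : ℝ) :
    D.wave x t = (propConst * ((√t)⁻¹ : ℝ)) ^ n *
      ∫ y in D.box, osc t ‖x - y‖ * D.weight y := by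
  simp_rw [wave, freeProp_eq]
  rw [Finset.prod_mul_distrib, prod_intervalIntegral, Finset.prod_const, Finset.card_univ,
    Fintype.card_fin]
  simp_rw [Finset.prod_mul_distrib, prod_osc, weight]

theorem wavePartial_eq (x : EuclideanSpace ℝ (Fin n)) (t : ℝ) (j : Fin n) :
    D.wavePartial x t j = (propConst * ((√t)⁻¹ : ℝ)) ^ n *
      ∫ y in D.box, Complex.I * (((x j - y j) / (2 * t) : ℝ) : ℂ) *
        osc t ‖x - y‖ * D.weight y := by
  have h1 : ∀ i, (if i = j then freePropDeriv (D.g i) (D.p i) (D.r i) (x i) t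
      else freeProp (D.g i) (D.p i) (D.r i) (x i) t) = propConst * ((√t)⁻¹ : ℝ) *
      ∫ y in (D.p i)..(D.r i), (if i = j then Complex.I * (((x i - y) / (2 * t) : ℝ) : ℂ) else 1) *
        (osc t (x i - y) * (D.g i y : ℂ)) := by
    intro i
    split_ifs with h
    · simp only [freePropDeriv, mul_assoc]
    · simp [freeProp_eq]
  have h2 : D.wavePartial x t j = ∏ i, (if i = j then freePropDeriv (D.g i) (D.p i) (D.r i) (x i) t
      else freeProp (D.g i) (D.p i) (D.r i) (x i) t) := by
    rw [← Finset.prod_erase_mul _ _ (Finset.mem_univ j), if_pos rfl, wavePartial]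
    congr 1
    refine Finset.prod_congr rfl fun i hi => ?_
    rw [if_neg (Finset.ne_of_mem_erase hi)]
  rw [h2]
  simp_rw [h1]
  rw [Finset.prod_mul_distrib, prod_intervalIntegral, Finset.prod_const, Finset.card_univ,
    Fintype.card_fin]
  congr 2
  funext y
  rw [Finset.prod_mul_distrib, Finset.prod_mul_distrib, prod_osc, Finset.prod_ite_eq',
    if_pos (Finset.mem_univ j), weight]
  ring

theorem continuous_osc_norm_sub (t : ℝ) (x : EuclideanSpace ℝ (Fin n)) :
    Continuous fun y => osc t ‖x - y‖ :=
  (continuous_osc t).comp (by fun_prop)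

/-- Exposes the amplitude ⟨x - y, v⟩/(2t), which for radial v is close to ‖x - y‖/(2t). -/
theorem waveDeriv_eq (x v : EuclideanSpace ℝ (Fin n)) (t : ℝ) :
    D.waveDeriv x t v = (propConst * ((√t)⁻¹ : ℝ)) ^ n *
      ∫ y in D.box, Complex.I * ((inner ℝ (x - y) v / (2 * t) : ℝ) : ℂ) *
        osc t ‖x - y‖ * D.weight y := by
  rw [waveDeriv_apply]
  simp_rw [wavePartial_eq]
  have h1 : ∀ y, Complex.I * ((inner ℝ (x - y) v / (2 * t) : ℝ) : ℂ) * osc t ‖x - y‖ *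
      D.weight y = ∑ j, (v j : ℂ) * (Complex.I * (((x j - y j) / (2 * t) : ℝ) : ℂ) *
        osc t ‖x - y‖ * D.weight y) := by
    intro y
    rw [PiLp.inner_apply]
    push_cast
    rw [Finset.sum_div, Finset.mul_sum, Finset.sum_mul, Finset.sum_mul]
    refine Finset.sum_congr rfl fun j _ => ?_
    simp
    ring
  simp_rw [h1]
  rw [integral_finsetSum, Finset.mul_sum]
  · refine Finset.sum_congr rfl fun j _ => ?_
    rw [integral_const_mul]
    ring
  · intro j _
    apply D.integrableOn_box
    have := continuous_osc_norm_sub t x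
    have := D.continuous_weight
    fun_prop

end BoxProfile

/-! ### Small times: contour shift in z = 1/t -/

/-- The oscillatory integrand of the fundamental solution in the variable `z = 1/t`, damped by
`exp(-εz)`. -/
noncomputable def contourFun (m ε A d : ℝ) (z : ℂ) : ℂ :=
  z ^ (m : ℂ) * Complex.exp (-(ε : ℂ) * z + Complex.I * ((A : ℂ) / z) + Complex.I * (d : ℂ) * z)

theorem differentiableAt_contourFun (m ε A d : ℝ) (z : ℂ) (hz : 0 < z.re) :
    DifferentiableAt ℂ (contourFun m ε A d) z := by
  have hz0 : z ≠ 0 := by intro h; rw [h] at hz; simp at hz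
  have h1 : DifferentiableAt ℂ (fun z : ℂ => z ^ (m : ℂ)) z :=
    differentiableAt_id.cpow_const (Or.inl hz)
  unfold contourFun
  refine h1.mul (DifferentiableAt.cexp ?_)
  refine ((differentiableAt_id.const_mul _).add
    (((differentiableAt_const _).div differentiableAt_id hz0).const_mul _)).add
    (differentiableAt_id.const_mul _)

/-- Above the real axis e^{idz} decays at rate d while e^{iA/z} grows; since |z| ≥ c the growth
consumes at most a quarter of that rate. -/
theorem norm_contourFun_le {m ε A d c a b : ℝ} (hA : 0 ≤ A) (hc : 0 < c) (h1 : A ≤ d / 4 * c ^ 2)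
    (ha : c ≤ a) (hb : 0 ≤ b) :
    ‖contourFun m ε A d (a + b * Complex.I)‖ ≤
      ‖(a + b * Complex.I : ℂ)‖ ^ m * Real.exp (-(ε * a) - 3 / 4 * d * b) := by
  have ha0 : 0 < a := hc.trans_le ha
  rw [contourFun, norm_mul, Complex.norm_cpow_real, Complex.norm_exp]
  refine mul_le_mul_of_nonneg_left ?_ (by positivity)
  rw [Real.exp_le_exp]
  have h2 : (-(ε : ℂ) * (a + b * Complex.I) + Complex.I * ((A : ℂ) / (a + b * Complex.I)) +
      Complex.I * (d : ℂ) * (a + b * Complex.I)).re = -(ε * a) + A * b / (a ^ 2 + b ^ 2) - d * b := by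
    simp [Complex.div_im, Complex.normSq_apply]
    ring
  rw [h2]
  have h3 : A * b / (a ^ 2 + b ^ 2) ≤ d / 4 * b := by
    rw [div_le_iff₀ (by positivity)]
    have h4 : A ≤ d / 4 * a ^ 2 := by
      have hd : 0 ≤ d := by
        by_contra! hd
        nlinarith [sq_pos_of_pos hc]
      refine h1.trans ?_
      gcongr
    have hd : 0 ≤ d := by
      by_contra! hd
      nlinarith [sq_pos_of_pos hc]
    have h5 : 0 ≤ d / 4 * b * b ^ 2 := by positivity
    nlinarith [mul_le_mul_of_nonneg_right h4 hb]
  linarith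

theorem norm_add_mul_I_le (a b : ℝ) (ha : 0 ≤ a) (hb : 0 ≤ b) :
    ‖(a + b * Complex.I : ℂ)‖ ≤ a + b := by
  refine (norm_add_le _ _).trans ?_
  simp [abs_of_nonneg ha, abs_of_nonneg hb]

theorem le_norm_add_mul_I (a b : ℝ) : a ≤ ‖(a + b * Complex.I : ℂ)‖ := by
  simpa using (Complex.re_le_norm (a + b * Complex.I : ℂ))

theorem rpow_le_of_ge {c s m : ℝ} {N : ℕ} (hc : 0 < c) (hs : c ≤ s) (hm : m ≤ N) :
    s ^ m ≤ c ^ (m - N) * s ^ N := by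
  have hs0 : 0 < s := hc.trans_le hs
  have h1 : s ^ (m - N) ≤ c ^ (m - N) :=
    Real.rpow_le_rpow_of_nonpos hc hs (by linarith)
  calc s ^ m = s ^ (m - N) * s ^ N := by
        rw [← Real.rpow_natCast s N, ← Real.rpow_add hs0]; simp
    _ ≤ _ := by gcongr

/-- Turns the power |z|^m on the vertical side into an exponential of rate |m|/c, which another
quarter of the decay rate d absorbs. -/
theorem rpow_add_le_exp {c b m : ℝ} (hc : 0 < c) {s : ℝ} (hcs : c ≤ s)
    (hs : s ≤ c + b) : s ^ m ≤ c ^ m * Real.exp (|m| / c * b) := by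
  have hs0 : 0 < s := hc.trans_le hcs
  have hb : 0 ≤ b := by linarith
  have h1 : s / c ≤ Real.exp (b / c) := by
    have := Real.add_one_le_exp (b / c)
    refine le_trans ?_ this
    rw [div_add_one hc.ne']
    gcongr
    linarith
  have h2 : 1 ≤ s / c := by rwa [one_le_div hc]
  have h3 : s ^ m = c ^ m * (s / c) ^ m := by
    rw [← Real.mul_rpow hc.le (by positivity), mul_div_cancel₀ _ hc.ne']
  rw [h3]
  gcongr
  calc (s / c) ^ m ≤ (s / c) ^ |m| := Real.rpow_le_rpow_of_exponent_le h2 (le_abs_self m)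
    _ ≤ (Real.exp (b / c)) ^ |m| := by gcongr
    _ = _ := by rw [← Real.exp_mul]; congr 1; ring

/-- Cauchy's theorem on the rectangle with corners c and X + iX. On the left side the net decay rate
d/2 yields the main term, independent of ε. The top and the right side yield the error term, which
vanishes as X → ∞; on the right side the damping ε is responsible. -/
theorem norm_integral_contourFun_le {m ε A d c X : ℝ} {N : ℕ} (hA : 0 ≤ A) (hc : 0 < c)
    (hd : 0 < d) (hε : 0 < ε) (h1 : A ≤ d / 4 * c ^ 2) (h2 : |m| ≤ d / 4 * c) (hm : m ≤ N)
    (hX : c ≤ X) :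
    ‖∫ s in c..X, contourFun m ε A d s‖ ≤ 2 * c ^ m / d +
      2 * (c ^ (m - N) * (2 * X) ^ N * Real.exp (-(min ε (3 / 4 * d) * X)) * X) := by
  have hX0 : 0 < X := hc.trans_le hX
  have hrect := Complex.integral_boundary_rect_eq_zero_of_differentiableOn
    (contourFun m ε A d) (c : ℂ) (X + X * Complex.I) (by
      intro z hz
      refine (differentiableAt_contourFun m ε A d z ?_).differentiableWithinAt
      have hz' := hz.1
      simp only [Set.mem_preimage, Complex.ofReal_re, Complex.add_re, Complex.mul_re,
        Complex.I_re, mul_zero, Complex.ofReal_im, Complex.I_im, mul_one, sub_self, add_zero] at hz'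
      rw [Set.uIcc_of_le hX] at hz'
      exact hc.trans_le hz'.1)
  simp only [Complex.ofReal_re, Complex.ofReal_im, Complex.add_re, Complex.mul_re, Complex.I_re,
    mul_zero, Complex.I_im, mul_one, sub_self, add_zero, Complex.add_im, Complex.mul_im, zero_add,
    Complex.ofReal_zero, zero_mul, smul_eq_mul] at hrect
  set K := c ^ (m - N) * (2 * X) ^ N * Real.exp (-(min ε (3 / 4 * d) * X)) with hK
  have hK0 : 0 ≤ K := by positivity
  have hfar : ∀ a b : ℝ, c ≤ a → 0 ≤ b → a ≤ X → b ≤ X → (a = X ∨ b = X) →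
      ‖contourFun m ε A d (a + b * Complex.I)‖ ≤ K := by
    intro a b ha hb haX hbX hor
    have ha0 : 0 < a := hc.trans_le ha
    refine (norm_contourFun_le hA hc h1 ha hb).trans ?_
    have hn1 := le_norm_add_mul_I a b
    have hn2 := norm_add_mul_I_le a b ha0.le hb
    refine mul_le_mul ?_ ?_ (Real.exp_pos _).le (by positivity)
    · refine (rpow_le_of_ge hc (ha.trans hn1) hm).trans ?_
      gcongr
      linarith
    · rw [Real.exp_le_exp]
      rcases hor with rfl | rfl
      · have := mul_le_mul_of_nonneg_right (min_le_left ε (3 / 4 * d)) ha0.le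
        nlinarith [mul_nonneg hd.le hb]
      · have := mul_le_mul_of_nonneg_right (min_le_right ε (3 / 4 * d)) hb
        nlinarith [mul_pos hε ha0]
  have htop : ‖∫ x in c..X, contourFun m ε A d (x + X * Complex.I)‖ ≤ K * X := by
    refine (intervalIntegral.norm_integral_le_of_norm_le_const (C := K) fun s hs => ?_).trans ?_
    · rw [Set.uIoc_of_le hX] at hs
      exact hfar s X hs.1.le hX0.le hs.2 le_rfl (Or.inr rfl)
    · rw [abs_of_nonneg (by linarith)]
      gcongr
      linarith
  have hright : ‖∫ y in (0 : ℝ)..X, contourFun m ε A d (X + y * Complex.I)‖ ≤ K * X := by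
    refine (intervalIntegral.norm_integral_le_of_norm_le_const (C := K) fun s hs => ?_).trans ?_
    · rw [Set.uIoc_of_le hX0.le] at hs
      exact hfar X s hX hs.1.le le_rfl hs.2 (Or.inl rfl)
    · simp [abs_of_pos hX0]
  have hleft : ‖∫ y in (0 : ℝ)..X, contourFun m ε A d (c + y * Complex.I)‖ ≤ 2 * c ^ m / d := by
    have hpt : ∀ y ∈ Set.Ioc 0 X, ‖contourFun m ε A d (c + y * Complex.I)‖ ≤
        c ^ m * Real.exp (-(d / 2) * y) := by
      intro y hy
      refine (norm_contourFun_le hA hc h1 le_rfl hy.1.le).trans ?_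
      have h3 := rpow_add_le_exp (m := m) hc (le_norm_add_mul_I c y)
        (norm_add_mul_I_le c y hc.le hy.1.le)
      refine (mul_le_mul_of_nonneg_right h3 (Real.exp_pos _).le).trans ?_
      rw [mul_assoc, ← Real.exp_add]
      gcongr
      have h4 : |m| / c ≤ d / 4 := by rwa [div_le_iff₀ hc]
      nlinarith [mul_le_mul_of_nonneg_right h4 hy.1.le, mul_pos hε hc]
    refine (intervalIntegral.norm_integral_le_of_norm_le hX0.le
      (Filter.Eventually.of_forall hpt)
      (by apply Continuous.intervalIntegrable; fun_prop)).trans ?_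
    rw [intervalIntegral.integral_const_mul]
    have h5 : ∫ y in (0 : ℝ)..X, Real.exp (-(d / 2) * y) =
        (2 / d) * (1 - Real.exp (-(d / 2) * X)) := by
      rw [intervalIntegral.integral_comp_mul_left (fun y => Real.exp y) (by linarith), integral_exp]
      simp
      field_simp
      ring
    rw [h5]
    have h6 := Real.exp_pos (-(d / 2) * X)
    calc c ^ m * (2 / d * (1 - Real.exp (-(d / 2) * X))) ≤ c ^ m * (2 / d * 1) := by
          gcongr; linarith
      _ = _ := by ring
  have heq : ∫ s in c..X, contourFun m ε A d s =
      (∫ x in c..X, contourFun m ε A d (x + X * Complex.I)) -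
      Complex.I * (∫ y in (0 : ℝ)..X, contourFun m ε A d (X + y * Complex.I)) +
      Complex.I * (∫ y in (0 : ℝ)..X, contourFun m ε A d (c + y * Complex.I)) := by
    linear_combination hrect
  rw [heq]
  refine (norm_add_le _ _).trans ((add_le_add (norm_sub_le _ _) le_rfl).trans ?_)
  rw [norm_mul, norm_mul, Complex.norm_I, one_mul, one_mul]
  linarith

theorem tendsto_contour_error (C δ : ℝ) (N : ℕ) (hδ : 0 < δ) :
    Tendsto (fun X : ℝ => 2 * (C * (2 * X) ^ N * Real.exp (-(δ * X)) * X)) atTop (𝓝 0) := by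
  have h1 := (isLittleO_pow_exp_pos_mul_atTop (N + 1) hδ).tendsto_div_nhds_zero
  have h2 := h1.const_mul (2 * C * 2 ^ N)
  rw [mul_zero] at h2
  refine h2.congr fun X => ?_
  rw [Real.exp_neg, mul_pow]
  field_simp
  ring

theorem phase_mul_osc (κ t ρ : ℝ) :
    phase κ t * osc t ρ = Complex.exp (Complex.I * ((κ ^ 2 * t + ρ ^ 2 / (4 * t) : ℝ) : ℂ)) := by
  rw [phase, osc, ← Complex.exp_add]
  congr 1
  push_cast
  ring

theorem inv_sqrt_pow_mul_exp_le (k : ℕ) {ε t : ℝ} (hε : 0 < ε) (ht : 0 < t) :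
    (√t)⁻¹ ^ k * Real.exp (-(ε / t)) ≤ (k.factorial : ℝ) / ε ^ k * √t ^ k := by
  have h1 := Real.pow_div_factorial_le_exp (x := ε / t) (by positivity) k
  have hst : 0 < √t := Real.sqrt_pos.mpr ht
  have hf : (0 : ℝ) < k.factorial := by exact_mod_cast Nat.factorial_pos k
  have h2 : Real.exp (-(ε / t)) ≤ ((ε / t) ^ k / (k.factorial : ℝ))⁻¹ := by
    rw [Real.exp_neg]
    exact inv_anti₀ (by positivity) h1
  refine (mul_le_mul_of_nonneg_left h2 (by positivity)).trans (le_of_eq ?_)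
  have h3 : t ^ k = √t ^ k * √t ^ k := by rw [← mul_pow, Real.mul_self_sqrt ht.le]
  rw [inv_div, div_pow, h3, inv_pow]
  field_simp

/-- The kernel `t^{-k/2} exp(-ε/t) exp(i(κ²t + ρ²/(4t)))`. -/
noncomputable def dampedKernel (k : ℕ) (ε κ ρ t : ℝ) : ℂ :=
  (((√t)⁻¹ ^ k * Real.exp (-(ε / t)) : ℝ) : ℂ) * (phase κ t * osc t ρ)

theorem measurable_dampedKernel (k : ℕ) (ε κ ρ : ℝ) : Measurable (dampedKernel k ε κ ρ) := by
  unfold dampedKernel phase osc; fun_prop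

theorem norm_dampedKernel (k : ℕ) (ε κ ρ t : ℝ) :
    ‖dampedKernel k ε κ ρ t‖ = (√t)⁻¹ ^ k * Real.exp (-(ε / t)) := by
  rw [dampedKernel, norm_mul, norm_mul, norm_phase, norm_osc, Complex.norm_real, Real.norm_eq_abs,
    abs_of_nonneg (by positivity)]
  simp

theorem integrableOn_dampedKernel (k : ℕ) {ε : ℝ} (hε : 0 < ε) (κ ρ T : ℝ) :
    IntegrableOn (dampedKernel k ε κ ρ) (Set.Ioc 0 T) := by
  refine Measure.integrableOn_of_bounded (M := (k.factorial : ℝ) / ε ^ k * √T ^ k)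
    measure_Ioc_lt_top.ne
    (measurable_dampedKernel k ε κ ρ).aestronglyMeasurable ?_
  refine (ae_restrict_iff' measurableSet_Ioc).mpr (Filter.Eventually.of_forall fun t ht => ?_)
  rw [norm_dampedKernel]
  refine (inv_sqrt_pow_mul_exp_le k hε ht.1).trans ?_
  gcongr
  exact ht.2

/-- The substitution z = 1/t: the Jacobian t^{-2} turns t^{-k/2} into z^{k/2-2}, and the phase
becomes κ²/z + (ρ²/4)z. -/
theorem dampedKernel_eq_contourFun (k : ℕ) (ε κ ρ t : ℝ) (ht : 0 < t) :
    contourFun ((k : ℝ) / 2 - 2) ε (κ ^ 2) (ρ ^ 2 / 4) ((t⁻¹ : ℝ) : ℂ) * (((t ^ 2)⁻¹ : ℝ) : ℂ) =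
      dampedKernel k ε κ ρ t := by
  have htC : (t : ℂ) ≠ 0 := by exact_mod_cast ht.ne'
  rw [contourFun, dampedKernel, phase_mul_osc, ← Complex.ofReal_cpow (by positivity)]
  have h1 : (t⁻¹) ^ ((k : ℝ) / 2 - 2) * (t ^ 2)⁻¹ = (√t)⁻¹ ^ k := by
    rw [← inv_pow t 2, ← Real.rpow_natCast (t⁻¹) 2, ← Real.rpow_add (by positivity),
      ← Real.sqrt_inv, Real.sqrt_eq_rpow, ← Real.rpow_natCast, ← Real.rpow_mul (by positivity)]
    congr 1
    push_cast
    ring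
  rw [← h1]
  push_cast
  have h2 : Complex.exp (-(ε : ℂ) * (t : ℂ)⁻¹ + Complex.I * ((κ : ℂ) ^ 2 / (t : ℂ)⁻¹) +
      Complex.I * ((ρ : ℂ) ^ 2 / 4) * (t : ℂ)⁻¹) = Complex.exp (-((ε : ℂ) / t)) *
      Complex.exp (Complex.I * ((κ : ℂ) ^ 2 * t + (ρ : ℂ) ^ 2 / (4 * t))) := by
    rw [← Complex.exp_add]
    congr 1
    field_simp
    ring
  rw [h2]
  ring

/-- Non-stationary part of the oscillatory time integral. -/
theorem norm_integral_dampedKernel_le (k : ℕ) {ε κ ρ T : ℝ} (hε : 0 < ε) (hρ : 0 < ρ)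
    (hT : 0 < T) (h1 : κ ^ 2 * T ^ 2 ≤ ρ ^ 2 / 16) (h2 : |(k : ℝ) / 2 - 2| * T ≤ ρ ^ 2 / 16) :
    ‖∫ t in Set.Ioc 0 T, dampedKernel k ε κ ρ t‖ ≤ 8 * (√T)⁻¹ ^ k * T ^ 2 / ρ ^ 2 := by
  set m : ℝ := (k : ℝ) / 2 - 2 with hm
  have hmk : m ≤ (k : ℕ) := by
    have : (0 : ℝ) ≤ k := Nat.cast_nonneg k
    rw [hm]; linarith
  have hsub : ∀ X, T⁻¹ ≤ X → ∫ t in X⁻¹..T, dampedKernel k ε κ ρ t =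
      ∫ s in T⁻¹..X, contourFun m ε (κ ^ 2) (ρ ^ 2 / 4) (s : ℂ) := by
    intro X hX
    have hX0 : 0 < X := (inv_pos.mpr hT).trans_le hX
    have hXT : X⁻¹ ≤ T := inv_le_of_inv_le₀ hT hX
    have hpos : ∀ t ∈ Set.uIcc T X⁻¹, 0 < t := by
      intro t ht
      rw [Set.uIcc_of_ge hXT] at ht
      exact (inv_pos.mpr hX0).trans_le ht.1
    have h3 := intervalIntegral.integral_deriv_smul_comp' (a := T) (b := X⁻¹)
      (f := fun t : ℝ => t⁻¹) (f' := fun t => -(t ^ 2)⁻¹)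
      (g := fun s : ℝ => contourFun m ε (κ ^ 2) (ρ ^ 2 / 4) (s : ℂ))
      (fun t ht => hasDerivAt_inv (hpos t ht).ne')
      (ContinuousOn.neg (ContinuousOn.inv₀ (by fun_prop) fun t ht => pow_ne_zero _ (hpos t ht).ne'))
      (by
        rintro _ ⟨t, ht, rfl⟩
        refine ContinuousAt.continuousWithinAt ?_
        exact ContinuousAt.comp (f := fun s : ℝ => (s : ℂ)) (x := t⁻¹)
          (g := contourFun m ε (κ ^ 2) (ρ ^ 2 / 4))
          (differentiableAt_contourFun m ε _ _ _
            (by simpa using hpos t ht)).continuousAt Complex.continuous_ofReal.continuousAt)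
    simp only [inv_inv] at h3
    rw [← h3, intervalIntegral.integral_symm, ← intervalIntegral.integral_neg]
    refine intervalIntegral.integral_congr fun t ht => ?_
    simp only [Function.comp_apply]
    rw [← dampedKernel_eq_contourFun k ε κ ρ t (hpos t ht), ← hm, Complex.real_smul]
    push_cast
    ring
  have hlim : Tendsto (fun X : ℝ => ∫ t in X⁻¹..T, dampedKernel k ε κ ρ t) atTop
      (𝓝 (∫ t in Set.Ioc 0 T, dampedKernel k ε κ ρ t)) := by
    rw [← intervalIntegral.integral_of_le hT.le]
    have hint : IntervalIntegrable (dampedKernel k ε κ ρ) volume 0 T :=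
      (intervalIntegrable_iff_integrableOn_Ioc_of_le hT.le).mpr
        (integrableOn_dampedKernel k hε κ ρ T)
    have hc : ContinuousWithinAt (fun a => ∫ t in a..T, dampedKernel k ε κ ρ t)
        (Set.Icc 0 T) 0 := by
      have := intervalIntegral.continuousOn_primitive_interval_left
        (μ := volume) (f := dampedKernel k ε κ ρ) (a := 0) (b := T) (by
          rw [Set.uIcc_of_le hT.le, integrableOn_Icc_iff_integrableOn_Ioc]
          exact integrableOn_dampedKernel k hε κ ρ T)
      rw [Set.uIcc_of_le hT.le] at this
      exact this 0 (Set.left_mem_Icc.mpr hT.le)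
    refine hc.tendsto.comp ?_
    refine tendsto_nhdsWithin_iff.mpr ⟨tendsto_inv_atTop_zero, ?_⟩
    filter_upwards [eventually_ge_atTop T⁻¹] with X hX
    have hX0 : 0 < X := (inv_pos.mpr hT).trans_le hX
    exact ⟨(inv_pos.mpr hX0).le, inv_le_of_inv_le₀ hT hX⟩
  have herr := tendsto_contour_error ((T⁻¹) ^ (m - k)) (min ε (3 / 4 * (ρ ^ 2 / 4))) k
    (lt_min hε (by positivity))
  have hlim2 := herr.const_add (2 * (T⁻¹) ^ m / (ρ ^ 2 / 4))
  rw [add_zero] at hlim2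
  have hle := le_of_tendsto_of_tendsto hlim.norm hlim2 (by
    filter_upwards [eventually_ge_atTop T⁻¹] with X hX
    rw [hsub X hX]
    refine norm_integral_contourFun_le (sq_nonneg κ) (inv_pos.mpr hT) (by positivity) hε ?_ ?_
      hmk hX
    · rw [inv_pow, ← div_eq_mul_inv, le_div_iff₀ (by positivity)]
      linarith
    · rw [← div_eq_mul_inv, le_div_iff₀ hT]
      linarith)
  refine hle.trans (le_of_eq ?_)
  -- The main term 2c^m/d of the contour bound, read at c = 1/T and d = ρ²/4.
  have h5 : (T⁻¹) ^ m = (√T)⁻¹ ^ k * T ^ 2 := by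
    rw [← Real.sqrt_inv, Real.sqrt_eq_rpow, ← Real.rpow_natCast, ← Real.rpow_mul (by positivity),
      ← Real.rpow_natCast T 2, ← inv_inv T, Real.inv_rpow (by positivity : 0 ≤ T⁻¹),
      ← Real.rpow_neg (by positivity), inv_inv, ← Real.rpow_add (by positivity), hm]
    congr 1
    push_cast
    ring
  rw [h5]
  field_simp
  ring

/-! ### Large times: cancellation at the stationary point -/

theorem inv_sqrt_pow_eq_rpow (k : ℕ) {t : ℝ} (ht : 0 ≤ t) :
    (√t)⁻¹ ^ k = t ^ (-((k : ℝ) / 2)) := by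
  rw [← Real.sqrt_inv, Real.sqrt_eq_rpow, ← Real.rpow_natCast, ← Real.rpow_mul (by positivity),
    Real.inv_rpow ht, ← Real.rpow_neg ht]
  congr 2
  ring

theorem integrableOn_inv_sqrt_pow {k : ℕ} (hk : 3 ≤ k) {T : ℝ} (hT : 0 < T) :
    IntegrableOn (fun t : ℝ => (√t)⁻¹ ^ k) (Set.Ioi T) := by
  have hk' : (3 : ℝ) ≤ k := by exact_mod_cast hk
  refine (integrableOn_Ioi_rpow_of_lt (a := -((k : ℝ) / 2)) (by linarith) hT).congr_fun
    (fun t ht => ?_) measurableSet_Ioi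
  exact (inv_sqrt_pow_eq_rpow k (hT.trans ht).le).symm

theorem integral_inv_sqrt_pow_le {k : ℕ} (hk : 3 ≤ k) {T : ℝ} (hT : 0 < T) :
    ∫ t in Set.Ioi T, (√t)⁻¹ ^ (k + 2) ≤ (√T)⁻¹ ^ k := by
  have hk' : (3 : ℝ) ≤ k := by exact_mod_cast hk
  have h1 : ∫ t in Set.Ioi T, (√t)⁻¹ ^ (k + 2) =
      ∫ t in Set.Ioi T, t ^ (-((k : ℝ) / 2) - 1) := by
    refine setIntegral_congr_fun measurableSet_Ioi fun t ht => ?_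
    rw [inv_sqrt_pow_eq_rpow _ (hT.trans ht).le]
    congr 1
    push_cast
    ring
  rw [h1, integral_Ioi_rpow_of_lt (by linarith) hT, inv_sqrt_pow_eq_rpow k hT.le,
    sub_add_cancel, neg_div_neg_eq]
  exact div_le_self (by positivity) (by linarith)

/-- Stationary part of the oscillatory time integral, with the amplitude of the radiation
condition: one integration by parts suffices. -/
theorem norm_integral_radiating_le {k : ℕ} (hk : 3 ≤ k) {κ ρ T : ℝ} (hκ : 0 < κ) (hρ : 0 ≤ ρ)
    (hT : 0 < T) :
    ‖∫ t in Set.Ioi T, (((√t)⁻¹ ^ k * (ρ / (2 * t) - κ) : ℝ) : ℂ) * Complex.I *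
      (phase κ t * osc t ρ)‖ ≤ 2 * (√T)⁻¹ ^ k / κ := by
  have hk' : (3 : ℝ) ≤ k := by exact_mod_cast hk
  -- Up to sign, the amplitude divided by the derivative of the phase. That derivative is (κ -
  -- ρ/(2t))(κ + ρ/(2t)), so its zero cancels with the zero of the amplitude and B is regular across
  -- the stationary point.
  set B : ℝ → ℝ := fun t => t ^ (1 - (k : ℝ) / 2) * (κ * t + ρ / 2)⁻¹ with hB
  set B' : ℝ → ℝ := fun t => (1 - (k : ℝ) / 2) * t ^ (1 - (k : ℝ) / 2 - 1) * (κ * t + ρ / 2)⁻¹ +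
    t ^ (1 - (k : ℝ) / 2) * (-κ / (κ * t + ρ / 2) ^ 2) with hB'
  set e : ℝ → ℂ := fun t => phase κ t * osc t ρ with he
  have hden : ∀ t, 0 < t → 0 < κ * t + ρ / 2 := fun t ht => by positivity
  have hBd : ∀ t, 0 < t → HasDerivAt B (B' t) t := by
    intro t ht
    have h1 : HasDerivAt (fun t : ℝ => κ * t + ρ / 2) κ t := by
      simpa using ((hasDerivAt_id t).const_mul κ).add_const (ρ / 2)
    exact (Real.hasDerivAt_rpow_const (Or.inl ht.ne')).mul (h1.fun_inv (hden t ht).ne')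
  have hBnonneg : ∀ t, 0 < t → 0 ≤ B t := fun t ht => by
    have := hden t ht
    positivity
  have hBle : ∀ t, 0 < t → B t ≤ (√t)⁻¹ ^ k / κ := by
    intro t ht
    have h1 : t ^ (1 - (k : ℝ) / 2) = t * (√t)⁻¹ ^ k := by
      rw [inv_sqrt_pow_eq_rpow k ht.le, sub_eq_add_neg, Real.rpow_add ht, Real.rpow_one]
    rw [hB]
    simp only
    rw [h1, ← div_eq_mul_inv, div_le_div_iff₀ (hden t ht) hκ]
    have : 0 ≤ (√t)⁻¹ ^ k := by positivity
    nlinarith [mul_nonneg this hρ]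
  have hB'neg : ∀ t ∈ Set.Ioi T, B' t ≤ 0 := by
    intro t ht
    have ht0 : 0 < t := hT.trans ht
    have hd := hden t ht0
    have h1 : 0 ≤ t ^ (1 - (k : ℝ) / 2 - 1) * (κ * t + ρ / 2)⁻¹ := by positivity
    have h2 : 0 ≤ t ^ (1 - (k : ℝ) / 2) * (κ / (κ * t + ρ / 2) ^ 2) := by positivity
    have h3 : B' t = (1 - (k : ℝ) / 2) * (t ^ (1 - (k : ℝ) / 2 - 1) * (κ * t + ρ / 2)⁻¹) -
        t ^ (1 - (k : ℝ) / 2) * (κ / (κ * t + ρ / 2) ^ 2) := by rw [hB']; ring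
    rw [h3]
    nlinarith
  have hst : Tendsto (fun t : ℝ => (√t)⁻¹ ^ k / κ) atTop (𝓝 0) := by
    have h1 : Tendsto (fun t : ℝ => (√t)⁻¹) atTop (𝓝 0) :=
      tendsto_inv_atTop_zero.comp Real.tendsto_sqrt_atTop
    have h2 := (h1.pow k).div_const κ
    rwa [zero_pow (by omega), zero_div] at h2
  have hBlim : Tendsto B atTop (𝓝 0) := by
    refine tendsto_of_tendsto_of_tendsto_of_le_of_le' tendsto_const_nhds hst ?_ ?_
    · filter_upwards [eventually_gt_atTop 0] with t ht using hBnonneg t ht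
    · filter_upwards [eventually_gt_atTop 0] with t ht using hBle t ht
  have hBder : ∀ t ∈ Set.Ici T, HasDerivAt B (B' t) t := fun t ht => hBd t (hT.trans_le ht)
  have hB'int : IntegrableOn B' (Set.Ioi T) :=
    integrableOn_Ioi_deriv_of_nonpos' hBder hB'neg hBlim
  have hB'val : ∫ t in Set.Ioi T, B' t = 0 - B T :=
    integral_Ioi_of_hasDerivAt_of_nonpos' hBder hB'neg hBlim
  have hene : ∀ t, ‖e t‖ = 1 := fun t => by
    rw [he]; simp only; rw [norm_mul, norm_phase, norm_osc, one_mul]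
  have hem : Measurable e := by rw [he]; unfold phase osc; fun_prop
  have hed : ∀ t, 0 < t → HasDerivAt e
      (e t * (Complex.I * ((κ ^ 2 - ρ ^ 2 / (4 * t ^ 2) : ℝ) : ℂ))) t := by
    intro t ht
    have h1 : HasDerivAt (fun t : ℝ => κ ^ 2 * t + ρ ^ 2 / (4 * t)) (κ ^ 2 - ρ ^ 2 / (4 * t ^ 2)) t := by
      have h2 : HasDerivAt (fun t : ℝ => 4 * t) 4 t := by
        simpa using (hasDerivAt_id t).const_mul (4 : ℝ)
      have h3 := (h2.fun_inv (by positivity)).const_mul (ρ ^ 2)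
      have h4 := ((hasDerivAt_id t).const_mul (κ ^ 2)).add h3
      convert! h4 using 1
      field_simp
      ring
    have h5 := (h1.ofReal_comp.const_mul Complex.I).cexp
    have h6 : e = fun t => Complex.exp (Complex.I * ((κ ^ 2 * t + ρ ^ 2 / (4 * t) : ℝ) : ℂ)) := by
      funext t; rw [he]; simp only [phase_mul_osc]
    rw [h6]
    exact h5
  set f : ℝ → ℂ := fun t => (((√t)⁻¹ ^ k * (ρ / (2 * t) - κ) : ℝ) : ℂ) * Complex.I * e t with hf
  have hfint : IntegrableOn f (Set.Ioi T) := by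
    refine Integrable.mono' ((integrableOn_inv_sqrt_pow hk hT).mul_const (ρ / (2 * T) + κ)) ?_ ?_
    · refine Measurable.aestronglyMeasurable ?_
      rw [hf]
      exact Measurable.mul (by fun_prop) hem
    · refine (ae_restrict_iff' measurableSet_Ioi).mpr (Filter.Eventually.of_forall fun t ht => ?_)
      have ht0 : 0 < t := hT.trans ht
      rw [hf]
      simp only
      rw [norm_mul, norm_mul, hene, Complex.norm_I, mul_one, mul_one, Complex.norm_real,
        norm_mul, Real.norm_eq_abs, Real.norm_eq_abs, abs_of_nonneg (by positivity)]
      gcongr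
      refine (abs_sub _ _).trans ?_
      rw [abs_of_nonneg (by positivity), abs_of_pos hκ]
      gcongr
      exact (le_of_lt ht)
  have hprod : ∀ t ∈ Set.Ici T, HasDerivAt (fun t => (B t : ℂ) * e t)
      ((B' t : ℂ) * e t - f t) t := by
    intro t ht
    have ht0 : 0 < t := hT.trans_le ht
    convert! (hBd t ht0).ofReal_comp.mul (hed t ht0) using 1
    have h1 : t ^ (1 - (k : ℝ) / 2) = t * (√t)⁻¹ ^ k := by
      rw [inv_sqrt_pow_eq_rpow k ht0.le, sub_eq_add_neg, Real.rpow_add ht0, Real.rpow_one]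
    have h2 : B t * (κ ^ 2 - ρ ^ 2 / (4 * t ^ 2)) = -((√t)⁻¹ ^ k * (ρ / (2 * t) - κ)) := by
      rw [hB]
      simp only
      rw [h1]
      have := (hden t ht0).ne'
      field_simp
      ring
    have h3 : f t = (((√t)⁻¹ ^ k * (ρ / (2 * t) - κ) : ℝ) : ℂ) * Complex.I * e t := rfl
    rw [h3, show (√t)⁻¹ ^ k * (ρ / (2 * t) - κ) = -(B t * (κ ^ 2 - ρ ^ 2 / (4 * t ^ 2))) by
      rw [h2]; ring]
    push_cast
    ring
  have hBe : IntegrableOn (fun t => (B' t : ℂ) * e t) (Set.Ioi T) := by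
    refine Integrable.mono' hB'int.norm ?_ ?_
    · exact (Complex.continuous_ofReal.comp_aestronglyMeasurable hB'int.aestronglyMeasurable).mul
        hem.aestronglyMeasurable
    · refine Filter.Eventually.of_forall fun t => ?_
      rw [norm_mul, hene, mul_one, Complex.norm_real]
  have hlim : Tendsto (fun t => (B t : ℂ) * e t) atTop (𝓝 0) := by
    rw [tendsto_zero_iff_norm_tendsto_zero]
    have := hBlim.norm
    rw [norm_zero] at this
    refine this.congr fun t => Eq.symm ?_
    rw [norm_mul, hene, mul_one, Complex.norm_real]
  have hfin := integral_Ioi_of_hasDerivAt_of_tendsto' hprod (hBe.sub hfint) hlim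
  rw [integral_sub hBe hfint] at hfin
  have hval : ∫ t in Set.Ioi T, f t = (∫ t in Set.Ioi T, (B' t : ℂ) * e t) + (B T : ℂ) * e T := by
    linear_combination -hfin
  change ‖∫ t in Set.Ioi T, f t‖ ≤ _
  rw [hval]
  -- B decreases to 0, so its total variation on (T, ∞) is B(T), with no loss depending on ρ.
  have h7 : ‖∫ t in Set.Ioi T, (B' t : ℂ) * e t‖ ≤ B T := by
    have h8 : ∫ t in Set.Ioi T, -B' t = B T := by rw [integral_neg, hB'val]; ring
    rw [← h8]
    refine norm_integral_le_of_norm_le hB'int.neg ?_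
    refine (ae_restrict_iff' measurableSet_Ioi).mpr (Filter.Eventually.of_forall fun t ht => ?_)
    rw [norm_mul, hene, mul_one, Complex.norm_real, Real.norm_eq_abs, abs_of_nonpos (hB'neg t ht)]
  have h9 : ‖(B T : ℂ) * e T‖ = B T := by
    rw [norm_mul, hene, mul_one, Complex.norm_real, Real.norm_eq_abs,
      abs_of_nonneg (hBnonneg T hT)]
  refine (norm_add_le _ _).trans ?_
  rw [h9]
  have := hBle T hT
  calc _ ≤ B T + B T := by gcongr
    _ ≤ (√T)⁻¹ ^ k / κ + (√T)⁻¹ ^ k / κ := by gcongr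
    _ = _ := by ring

/-! ### The radiation condition for the potential -/

/-- The kernel of `⟨v, ∇u⟩ - iκu`. -/
noncomputable def radKernel (n : ℕ) (κ s ρ t : ℝ) : ℂ :=
  (((√t)⁻¹ ^ n * (s / (2 * t) - κ) : ℝ) : ℂ) * Complex.I * (phase κ t * osc t ρ)

theorem norm_radKernel_le (n : ℕ) {κ s t : ℝ} (ρ : ℝ) (hκ : 0 ≤ κ) (ht : 0 < t) :
    ‖radKernel n κ s ρ t‖ ≤ |s| / 2 * (√t)⁻¹ ^ (n + 2) + κ * (√t)⁻¹ ^ n := by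
  have h1 : (√t)⁻¹ ^ (n + 2) = (√t)⁻¹ ^ n * t⁻¹ := by
    rw [pow_add, inv_pow (√t) 2, Real.sq_sqrt ht.le]
  rw [radKernel, norm_mul, norm_mul, norm_mul, norm_phase, norm_osc, Complex.norm_I,
    Complex.norm_real, Real.norm_eq_abs, abs_mul, abs_of_nonneg (by positivity), h1]
  have h2 : |s / (2 * t) - κ| ≤ |s| / (2 * t) + κ := by
    refine (abs_sub _ _).trans ?_
    rw [abs_div, abs_of_nonneg hκ, abs_of_pos (by positivity : 0 < 2 * t)]
  calc _ ≤ (√t)⁻¹ ^ n * (|s| / (2 * t) + κ) := by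
        rw [mul_one, mul_one, mul_one]; gcongr
    _ = _ := by field_simp

namespace BoxProfile

variable {n : ℕ} (D : BoxProfile n)

/-- The combination `⟨v, ∇w⟩ - iκw` for the free evolution `w`. -/
noncomputable def radWave (κ : ℝ) (x v : EuclideanSpace ℝ (Fin n)) (t : ℝ) : ℂ :=
  phase κ t * (D.waveDeriv x t v - Complex.I * κ * D.wave x t)

theorem integrableOn_radWave (hn : 3 ≤ n) (κ : ℝ) (x v : EuclideanSpace ℝ (Fin n)) :
    IntegrableOn (D.radWave κ x v) (Set.Ioi 0) := by
  have h1 := (D.integrableOn_phase_waveDeriv hn κ x).apply_continuousLinearMap v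
  have h2 := (D.integrableOn_phase_wave hn κ x).const_mul (Complex.I * κ)
  refine (h1.sub h2).congr (Filter.Eventually.of_forall fun t => ?_)
  simp [radWave]
  ring

theorem fderiv_pot_sub (hn : 3 ≤ n) (κ : ℝ) (x v : EuclideanSpace ℝ (Fin n)) :
    fderiv ℝ (D.pot κ) x v - Complex.I * κ * D.pot κ x =
      Complex.I * ∫ t in Set.Ioi (0 : ℝ), D.radWave κ x v t := by
  have h1 := (D.integrableOn_phase_waveDeriv hn κ x).apply_continuousLinearMap v
  have h2 := (D.integrableOn_phase_wave hn κ x).const_mul (Complex.I * κ)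
  have h3 : ∫ t in Set.Ioi (0 : ℝ), D.radWave κ x v t =
      (∫ t in Set.Ioi (0 : ℝ), phase κ t * D.waveDeriv x t v) -
        ∫ t in Set.Ioi (0 : ℝ), Complex.I * κ * (phase κ t * D.wave x t) := by
    rw [← integral_sub _ h2]
    · congr 1; funext t; simp only [radWave]; ring
    · refine h1.congr (Filter.Eventually.of_forall fun t => ?_)
      simp
  rw [fderiv_pot_apply D hn, h3, integral_const_mul, pot]
  ring

theorem radWave_eq (κ : ℝ) (x v : EuclideanSpace ℝ (Fin n)) (t : ℝ) :
    D.radWave κ x v t = propConst ^ n *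
      ∫ y in D.box, radKernel n κ (inner ℝ (x - y) v) ‖x - y‖ t * D.weight y := by
  have hw := D.continuous_weight
  have ho := continuous_osc_norm_sub t x
  have h1 : IntegrableOn (fun y => Complex.I * ((inner ℝ (x - y) v / (2 * t) : ℝ) : ℂ) *
        osc t ‖x - y‖ * D.weight y) D.box := by
    apply D.integrableOn_box
    fun_prop
  have h2 : IntegrableOn (fun y => Complex.I * κ * (osc t ‖x - y‖ * D.weight y)) D.box := by
    apply D.integrableOn_box
    fun_prop
  rw [radWave, waveDeriv_eq, wave_eq, mul_left_comm (Complex.I * (κ : ℂ)),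
    ← mul_sub, ← integral_const_mul (Complex.I * (κ : ℂ)), ← integral_sub h1 h2, mul_pow, mul_left_comm, mul_assoc, ← integral_const_mul,
    ← integral_const_mul]
  congr 2
  funext y
  rw [radKernel]
  push_cast
  ring

/-- Fubini transfers a bound on the time integral of the kernel, uniform over the box, to the whole
expression. The factor h is 1 for large times; for small times it is the damping without which the
kernel is not absolutely integrable near t = 0. -/
theorem norm_integral_radWave_le {κ M : ℝ} (hκ : 0 ≤ κ) (x v : EuclideanSpace ℝ (Fin n))
    {S : Set ℝ} (hS : MeasurableSet S) (hS0 : S ⊆ Set.Ioi 0) {h : ℝ → ℝ} (hm : Measurable h)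
    (h1 : IntegrableOn (fun t => |h t| * (√t)⁻¹ ^ n) S)
    (h2 : IntegrableOn (fun t => |h t| * (√t)⁻¹ ^ (n + 2)) S)
    (hM : ∀ y ∈ D.box,
      ‖∫ t in S, (h t : ℂ) * radKernel n κ (inner ℝ (x - y) v) ‖x - y‖ t‖ ≤ M) :
    ‖∫ t in S, (h t : ℂ) * D.radWave κ x v t‖ ≤
      ‖propConst‖ ^ n * (M * ∫ y in D.box, ‖D.weight y‖) := by
  obtain ⟨K, hK0, hK⟩ := D.exists_norm_le
  have hwint : IntegrableOn D.weight D.box := D.integrableOn_box D.continuous_weight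
  have hint : Integrable (Function.uncurry fun (t : ℝ) (y : EuclideanSpace ℝ (Fin n)) =>
      (h t : ℂ) * radKernel n κ (inner ℝ (x - y) v) ‖x - y‖ t * D.weight y)
      ((volume.restrict S).prod (volume.restrict D.box)) := by
    have hb := ((h2.const_mul ((‖x‖ + K) * ‖v‖ / 2)).add (h1.const_mul κ)).mul_prod hwint.norm
    refine Integrable.mono' hb ?_ ?_
    · refine Measurable.aestronglyMeasurable ?_
      have := D.continuous_weight.measurable
      unfold radKernel phase osc Function.uncurry
      fun_prop
    · rw [Measure.prod_restrict]
      refine (ae_restrict_iff' (hS.prod D.measurableSet_box)).mpr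
        (Filter.Eventually.of_forall fun z hz => ?_)
      obtain ⟨t, y⟩ := z
      have ht : 0 < t := hS0 hz.1
      have hy := hK y hz.2
      simp only [Function.uncurry]
      rw [norm_mul, norm_mul, Complex.norm_real, Real.norm_eq_abs]
      refine mul_le_mul_of_nonneg_right ?_ (norm_nonneg _)
      have h3 : |inner ℝ (x - y) v| ≤ (‖x‖ + K) * ‖v‖ := by
        refine (abs_real_inner_le_norm _ _).trans ?_
        gcongr
        exact (norm_sub_le _ _).trans (by linarith)
      calc |h t| * ‖radKernel n κ (inner ℝ (x - y) v) ‖x - y‖ t‖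
          ≤ |h t| * (|inner ℝ (x - y) v| / 2 * (√t)⁻¹ ^ (n + 2) + κ * (√t)⁻¹ ^ n) := by
            gcongr; exact norm_radKernel_le n _ hκ ht
        _ ≤ |h t| * ((‖x‖ + K) * ‖v‖ / 2 * (√t)⁻¹ ^ (n + 2) + κ * (√t)⁻¹ ^ n) := by
            gcongr
        _ = _ := by simp only [Pi.add_apply]; ring
  have hswap := integral_integral_swap hint
  have he : ∫ t in S, (h t : ℂ) * D.radWave κ x v t = propConst ^ n *
      ∫ t in S, ∫ y in D.box,
        (h t : ℂ) * radKernel n κ (inner ℝ (x - y) v) ‖x - y‖ t * D.weight y := by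
    rw [← integral_const_mul]
    congr 1
    funext t
    rw [radWave_eq, mul_left_comm, ← integral_const_mul]
    simp_rw [mul_assoc]
  rw [he, norm_mul, norm_pow, hswap, ← integral_const_mul]
  refine mul_le_mul_of_nonneg_left ?_ (by positivity)
  refine norm_integral_le_of_norm_le (hwint.norm.const_mul M) ?_
  refine (ae_restrict_iff' D.measurableSet_box).mpr (Filter.Eventually.of_forall fun y hy => ?_)
  rw [integral_mul_const, norm_mul]
  exact mul_le_mul_of_nonneg_right (hM y hy) (norm_nonneg _)

/-- In the radial direction ⟨x - y, v⟩ differs from ‖x - y‖ by at most 2K. With ‖x - y‖ in its place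
`norm_integral_radiating_le` applies; the difference carries an extra t^{-1} and is integrated
absolutely. -/
theorem norm_radWave_large_time (hn : 3 ≤ n) {κ K T : ℝ} (hκ : 0 < κ) (hT : 0 < T)
    (hK : ∀ y ∈ D.box, ‖y‖ ≤ K) (hK0 : 0 ≤ K) (x v : EuclideanSpace ℝ (Fin n))
    (hv : inner ℝ x v = ‖x‖) (hv1 : ‖v‖ ≤ 1) :
    ‖∫ t in Set.Ioi T, D.radWave κ x v t‖ ≤
      ‖propConst‖ ^ n * (((2 / κ + K) * (√T)⁻¹ ^ n) * ∫ y in D.box, ‖D.weight y‖) := by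
  have h := D.norm_integral_radWave_le (M := (2 / κ + K) * (√T)⁻¹ ^ n) hκ.le x v
    (S := Set.Ioi T) measurableSet_Ioi (Set.Ioi_subset_Ioi hT.le) (h := fun _ => 1)
    measurable_const (by simpa using integrableOn_inv_sqrt_pow hn hT)
    (by simpa using integrableOn_inv_sqrt_pow (k := n + 2) (by omega) hT) ?_
  · simpa using h
  · intro y hy
    simp only [Complex.ofReal_one, one_mul]
    set ρ := ‖x - y‖ with hρ
    set s : ℝ := inner ℝ (x - y) v with hs
    have hdiff : |s - ρ| ≤ 2 * K := by
      have h1 : s = ‖x‖ - inner ℝ y v := by rw [hs, inner_sub_left, hv]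
      have h2 : |inner ℝ y v| ≤ K := (abs_real_inner_le_norm y v).trans
        ((mul_le_of_le_one_right (norm_nonneg _) hv1).trans (hK y hy))
      have h3 : |‖x‖ - ρ| ≤ K := by
        refine (abs_norm_sub_norm_le x (x - y)).trans ?_
        simpa using hK y hy
      calc |s - ρ| = |(‖x‖ - ρ) - inner ℝ y v| := by rw [h1]; ring_nf
        _ ≤ |‖x‖ - ρ| + |inner ℝ y v| := abs_sub _ _
        _ ≤ _ := by linarith
    have hem : Measurable fun t => phase κ t * osc t ρ := by unfold phase osc; fun_prop
    have hnorm : ∀ t, ‖phase κ t * osc t ρ‖ = 1 := fun t => by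
      rw [norm_mul, norm_phase, norm_osc, one_mul]
    have hi2 : IntegrableOn (fun t => (((√t)⁻¹ ^ (n + 2) : ℝ) : ℂ) *
        (((s - ρ) / 2 : ℝ) * Complex.I * (phase κ t * osc t ρ))) (Set.Ioi T) := by
      refine Integrable.mono' ((integrableOn_inv_sqrt_pow (k := n + 2) (by omega) hT).mul_const
        (|s - ρ| / 2)) ?_ ?_
      · refine Measurable.aestronglyMeasurable ?_
        exact Measurable.mul (by fun_prop) (hem.const_mul _)
      · refine Filter.Eventually.of_forall fun t => ?_
        rw [norm_mul, norm_mul, norm_mul, hnorm, Complex.norm_I, Complex.norm_real,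
          Complex.norm_real, Real.norm_eq_abs, Real.norm_eq_abs, abs_of_nonneg (by positivity),
          abs_div, abs_two, mul_one, mul_one]
    have hi1 : IntegrableOn (radKernel n κ ρ ρ) (Set.Ioi T) := by
      refine Integrable.mono'
        (((integrableOn_inv_sqrt_pow (k := n + 2) (by omega) hT).const_mul (|ρ| / 2)).add
        ((integrableOn_inv_sqrt_pow hn hT).const_mul κ)) ?_ ?_
      · refine Measurable.aestronglyMeasurable ?_
        unfold radKernel phase osc; fun_prop
      · refine (ae_restrict_iff' measurableSet_Ioi).mpr
          (Filter.Eventually.of_forall fun t ht => ?_)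
        exact norm_radKernel_le n ρ hκ.le (hT.trans ht)
    have hsplit : ∫ t in Set.Ioi T, radKernel n κ s ρ t = (∫ t in Set.Ioi T, radKernel n κ ρ ρ t) +
        ∫ t in Set.Ioi T, (((√t)⁻¹ ^ (n + 2) : ℝ) : ℂ) *
        (((s - ρ) / 2 : ℝ) * Complex.I * (phase κ t * osc t ρ)) := by
      rw [← integral_add hi1 hi2]
      refine setIntegral_congr_fun measurableSet_Ioi fun t ht => ?_
      have ht0 : 0 < t := hT.trans ht
      have h1 : (√t)⁻¹ ^ (n + 2) = (√t)⁻¹ ^ n * t⁻¹ := by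
        rw [pow_add, inv_pow (√t) 2, Real.sq_sqrt ht0.le]
      have h2 : (√t)⁻¹ ^ n * (s / (2 * t) - κ) = (√t)⁻¹ ^ n * (ρ / (2 * t) - κ) +
        (√t)⁻¹ ^ (n + 2) * ((s - ρ) / 2) := by
        rw [h1]; field_simp; ring
      simp only [radKernel]
      rw [h2, Complex.ofReal_add, Complex.ofReal_mul _ ((s - ρ) / 2)]
      ring
    rw [hsplit]
    refine (norm_add_le _ _).trans ?_
    have h3 := norm_integral_radiating_le hn hκ (norm_nonneg (x - y)) hT
    have h4 : ‖∫ t in Set.Ioi T, (((√t)⁻¹ ^ (n + 2) : ℝ) : ℂ) *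
        (((s - ρ) / 2 : ℝ) * Complex.I * (phase κ t * osc t ρ))‖ ≤ K * (√T)⁻¹ ^ n := by
      have h5 : ‖∫ t in Set.Ioi T, (((√t)⁻¹ ^ (n + 2) : ℝ) : ℂ) *
          (((s - ρ) / 2 : ℝ) * Complex.I * (phase κ t * osc t ρ))‖ ≤
          ∫ t in Set.Ioi T, K * (√t)⁻¹ ^ (n + 2) := by
        refine norm_integral_le_of_norm_le
          ((integrableOn_inv_sqrt_pow (k := n + 2) (by omega) hT).const_mul K) ?_
        refine Filter.Eventually.of_forall fun t => ?_
        rw [norm_mul, norm_mul, norm_mul, hnorm, Complex.norm_I, Complex.norm_real,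
          Complex.norm_real, Real.norm_eq_abs, Real.norm_eq_abs, abs_of_nonneg (by positivity),
          abs_div, abs_two, mul_one, mul_one, mul_comm]
        gcongr
        linarith
      rw [integral_const_mul] at h5
      exact h5.trans (mul_le_mul_of_nonneg_left (integral_inv_sqrt_pow_le hn hT) hK0)
    calc _ ≤ 2 * (√T)⁻¹ ^ n / κ + K * (√T)⁻¹ ^ n := add_le_add h3 h4
      _ = _ := by ring

/-- With ρ = ‖x - y‖ ≥ ‖x‖/2, the time T = ‖x‖/(8κ) is at most half of the stationary time ρ/(2κ).
The bound is proved with the damping e^{-ε/t} and a constant free of ε; then ε → 0 by dominated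
convergence, since `radWave`, unlike its kernel, is integrable at t = 0. -/
theorem norm_radWave_small_time (hn : 3 ≤ n) {κ K : ℝ} (hκ : 0 < κ)
    (hK : ∀ y ∈ D.box, ‖y‖ ≤ K) (x v : EuclideanSpace ℝ (Fin n)) (hv1 : ‖v‖ ≤ 1)
    (hx : 0 < ‖x‖) (hxK : 2 * K ≤ ‖x‖) (hx2 : 4 * ((n : ℝ) + 2) / κ ≤ ‖x‖) :
    ‖∫ t in Set.Ioc 0 (‖x‖ / (8 * κ)), D.radWave κ x v t‖ ≤
      ‖propConst‖ ^ n * ((2 / κ * (√(‖x‖ / (8 * κ)))⁻¹ ^ n) * ∫ y in D.box, ‖D.weight y‖) := by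
  set T := ‖x‖ / (8 * κ) with hTdef
  have hT : 0 < T := by positivity
  have hRT : ‖x‖ = 8 * κ * T := by rw [hTdef]; field_simp
  have hn' : (3 : ℝ) ≤ n := by exact_mod_cast hn
  have hε : ∀ ε : ℝ, 0 < ε →
      ‖∫ t in Set.Ioc 0 T, ((Real.exp (-(ε / t)) : ℝ) : ℂ) * D.radWave κ x v t‖ ≤
      ‖propConst‖ ^ n * ((2 / κ * (√T)⁻¹ ^ n) * ∫ y in D.box, ‖D.weight y‖) := by
    intro ε hε
    have hdamp : ∀ k : ℕ, IntegrableOn (fun t => |Real.exp (-(ε / t))| * (√t)⁻¹ ^ k)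
        (Set.Ioc 0 T) := by
      intro k
      refine ((integrableOn_dampedKernel k hε κ 0 T).norm).congr
        (Filter.Eventually.of_forall fun t => ?_)
      simp only [norm_dampedKernel]
      rw [abs_of_pos (Real.exp_pos _), mul_comm]
    refine D.norm_integral_radWave_le hκ.le x v measurableSet_Ioc (fun t ht => ht.1)
      (h := fun t => Real.exp (-(ε / t))) (by fun_prop) (hdamp n) (hdamp (n + 2)) fun y hy => ?_
    set ρ := ‖x - y‖ with hρ
    set s : ℝ := inner ℝ (x - y) v with hs
    have hρR : ‖x‖ / 2 ≤ ρ := by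
      have h1 : ‖x‖ ≤ ρ + ‖y‖ := by
        have := norm_add_le (x - y) y
        simpa using this
      linarith [hK y hy]
    have hρ0 : 0 < ρ := by linarith
    have hsρ : |s| ≤ ρ := (abs_real_inner_le_norm _ _).trans
      (mul_le_of_le_one_right (norm_nonneg _) hv1)
    have hρT : 4 * κ * T ≤ ρ := by rw [hRT] at hρR; linarith
    have hc1 : κ ^ 2 * T ^ 2 ≤ ρ ^ 2 / 16 := by
      have : (4 * κ * T) ^ 2 ≤ ρ ^ 2 := by gcongr
      nlinarith
    -- The lower bound 4(n + 2)/κ for ‖x‖ is chosen for this: |k/2 - 2| ≤ (n + 2)/2 ≤ κ‖x‖/8, and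
    -- κ‖x‖/8 times T is ‖x‖²/64.
    have hc2 : ∀ k : ℕ, k ≤ n + 2 → |(k : ℝ) / 2 - 2| * T ≤ ρ ^ 2 / 16 := by
      intro k hk
      have hk' : (k : ℝ) ≤ n + 2 := by exact_mod_cast hk
      have h1 : |(k : ℝ) / 2 - 2| ≤ ((n : ℝ) + 2) / 2 := by
        have : (0 : ℝ) ≤ k := Nat.cast_nonneg k
        rw [abs_le]; constructor <;> linarith
      have h2 : ((n : ℝ) + 2) ≤ ‖x‖ * κ / 4 := by
        rw [div_le_iff₀ hκ] at hx2
        linarith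
      have h3 : T * (‖x‖ * κ / 4 / 2) = ‖x‖ ^ 2 / 64 := by
        rw [hTdef]; field_simp; norm_num
      have h4 : (‖x‖ / 2) ^ 2 ≤ ρ ^ 2 := by gcongr
      calc |(k : ℝ) / 2 - 2| * T ≤ (‖x‖ * κ / 4 / 2) * T := by
            gcongr
            linarith
        _ = ‖x‖ ^ 2 / 64 := by rw [mul_comm, h3]
        _ ≤ _ := by nlinarith
    have hJ1 := norm_integral_dampedKernel_le n hε hρ0 hT hc1 (hc2 n (by omega))
    have hJ2 := norm_integral_dampedKernel_le (n + 2) hε hρ0 hT hc1 (hc2 (n + 2) le_rfl)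
    have hi1 := (integrableOn_dampedKernel n hε κ ρ T).const_mul (Complex.I * κ)
    have hi2 := (integrableOn_dampedKernel (n + 2) hε κ ρ T).const_mul (Complex.I * (s / 2 : ℝ))
    have hsplit : ∫ t in Set.Ioc 0 T, ((Real.exp (-(ε / t)) : ℝ) : ℂ) * radKernel n κ s ρ t =
        Complex.I * (s / 2 : ℝ) * (∫ t in Set.Ioc 0 T, dampedKernel (n + 2) ε κ ρ t) -
        Complex.I * κ * ∫ t in Set.Ioc 0 T, dampedKernel n ε κ ρ t := by
      rw [← integral_const_mul, ← integral_const_mul, ← integral_sub hi2 hi1]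
      refine setIntegral_congr_fun measurableSet_Ioc fun t ht => ?_
      have h1 : (√t)⁻¹ ^ (n + 2) = (√t)⁻¹ ^ n * t⁻¹ := by
        rw [pow_add, inv_pow (√t) 2, Real.sq_sqrt ht.1.le]
      simp only [radKernel, dampedKernel]
      rw [h1]
      push_cast
      have htC : (t : ℂ) ≠ 0 := by exact_mod_cast ht.1.ne'
      field_simp
    rw [hsplit]
    refine (norm_sub_le _ _).trans ?_
    rw [norm_mul, norm_mul, norm_mul, norm_mul, Complex.norm_I, Complex.norm_real,
      Complex.norm_real, one_mul, one_mul, Real.norm_eq_abs, Real.norm_eq_abs, abs_of_pos hκ,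
      abs_div, abs_two]
    have hq : (√T)⁻¹ ^ (n + 2) = (√T)⁻¹ ^ n * T⁻¹ := by
      rw [pow_add, inv_pow (√T) 2, Real.sq_sqrt hT.le]
    have hq0 : 0 ≤ (√T)⁻¹ ^ n := by positivity
    set q := (√T)⁻¹ ^ n with hqdef
    rw [hq] at hJ2
    calc |s| / 2 * ‖∫ t in Set.Ioc 0 T, dampedKernel (n + 2) ε κ ρ t‖ +
          κ * ‖∫ t in Set.Ioc 0 T, dampedKernel n ε κ ρ t‖
        ≤ ρ / 2 * (8 * (q * T⁻¹) * T ^ 2 / ρ ^ 2) + κ * (8 * q * T ^ 2 / ρ ^ 2) := by gcongr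
      _ = q * (4 * T / ρ + 8 * κ * (T / ρ) ^ 2) := by field_simp; ring
      -- From T/ρ ≤ 1/(4κ); the bracket equals 3/(2κ), rounded up to 2/κ.
      _ ≤ q * (4 * (1 / (4 * κ)) + 8 * κ * (1 / (4 * κ)) ^ 2) := by
          have h6 : T / ρ ≤ 1 / (4 * κ) := by
            rw [div_le_div_iff₀ hρ0 (by positivity)]; linarith
          have h7 : 0 ≤ T / ρ := by positivity
          rw [mul_div_assoc]
          gcongr
      _ ≤ 2 / κ * q := by
          have : 4 * (1 / (4 * κ)) + 8 * κ * (1 / (4 * κ)) ^ 2 = 3 / 2 / κ := by field_simp; norm_num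
          rw [this, mul_comm]
          gcongr
          norm_num
  have hlim : Tendsto (fun ε : ℝ =>
      ∫ t in Set.Ioc 0 T, ((Real.exp (-(ε / t)) : ℝ) : ℂ) * D.radWave κ x v t) (𝓝[>] 0)
      (𝓝 (∫ t in Set.Ioc 0 T, D.radWave κ x v t)) := by
    have hint : IntegrableOn (D.radWave κ x v) (Set.Ioc 0 T) :=
      (D.integrableOn_radWave hn κ x v).mono_set Set.Ioc_subset_Ioi_self
    refine tendsto_integral_filter_of_dominated_convergence (fun t => ‖D.radWave κ x v t‖)
      ?_ ?_ hint.norm ?_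
    · refine Filter.Eventually.of_forall fun ε => ?_
      refine AEStronglyMeasurable.mul ?_ hint.aestronglyMeasurable
      exact Measurable.aestronglyMeasurable (by fun_prop)
    · filter_upwards [self_mem_nhdsWithin] with ε hε0
      refine (ae_restrict_iff' measurableSet_Ioc).mpr
        (Filter.Eventually.of_forall fun t ht => ?_)
      rw [norm_mul, Complex.norm_real, Real.norm_eq_abs, abs_of_pos (Real.exp_pos _)]
      refine mul_le_of_le_one_left (norm_nonneg _) ?_
      rw [Real.exp_le_one_iff]
      have : 0 < ε / t := div_pos hε0 ht.1
      linarith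
    · refine Filter.Eventually.of_forall fun t => ?_
      have h1 : Tendsto (fun ε : ℝ => ((Real.exp (-(ε / t)) : ℝ) : ℂ) * D.radWave κ x v t) (𝓝 0)
          (𝓝 (((Real.exp (-(0 / t)) : ℝ) : ℂ) * D.radWave κ x v t)) := by
        apply Continuous.tendsto (f := fun ε : ℝ => ((Real.exp (-(ε / t)) : ℝ) : ℂ) * D.radWave κ x v t)
        fun_prop
      simp only [zero_div, neg_zero, Real.exp_zero, Complex.ofReal_one, one_mul] at h1
      exact h1.mono_left nhdsWithin_le_nhds
  refine le_of_tendsto hlim.norm ?_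
  filter_upwards [self_mem_nhdsWithin] with ε hε0 using hε ε hε0

/-- Sommerfeld's radiation condition for the potential. -/
theorem tendsto_radiation (hn : 3 ≤ n) {κ : ℝ} (hκ : 0 < κ) :
    Tendsto (fun x : EuclideanSpace ℝ (Fin n) => ((‖x‖ ^ (((n : ℝ) - 1) / 2) : ℝ) : ℂ) *
      (fderiv ℝ (D.pot κ) x (‖x‖⁻¹ • x) - Complex.I * (κ : ℂ) * D.pot κ x))
    (cocompact (EuclideanSpace ℝ (Fin n))) (𝓝 0) := by
  obtain ⟨K, hK0, hK⟩ := D.exists_norm_le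
  set W := ∫ y in D.box, ‖D.weight y‖ with hW
  have hW0 : 0 ≤ W := integral_nonneg fun _ => norm_nonneg _
  set C := ‖propConst‖ ^ n * ((2 / κ + (2 / κ + K)) * W) with hC
  -- Both time ranges contribute O(T^{-n/2}), and T^{-n/2} = (8κ)^{n/2} ‖x‖^{-n/2}; multiplied by
  -- ‖x‖^{(n-1)/2} this leaves ‖x‖^{-1/2}.
  have hlim : Tendsto (fun x : EuclideanSpace ℝ (Fin n) =>
      C * (8 * κ) ^ ((n : ℝ) / 2) * ‖x‖ ^ (-(1 / 2 : ℝ)))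
      (cocompact (EuclideanSpace ℝ (Fin n))) (𝓝 0) := by
    have h1 := (tendsto_rpow_neg_atTop (y := 1 / 2) (by norm_num)).comp
      (tendsto_norm_cocompact_atTop (E := EuclideanSpace ℝ (Fin n)))
    simpa using h1.const_mul (C * (8 * κ) ^ ((n : ℝ) / 2))
  refine squeeze_zero_norm' ?_ hlim
  have hev := (tendsto_norm_cocompact_atTop (E := EuclideanSpace ℝ (Fin n))).eventually_ge_atTop
    (max 1 (max (2 * K) (4 * ((n : ℝ) + 2) / κ)))
  filter_upwards [hev] with x hx
  have hx1 : 0 < ‖x‖ := one_pos.trans_le ((le_max_left _ _).trans hx)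
  have hx2 : 2 * K ≤ ‖x‖ := ((le_max_left _ _).trans (le_max_right _ _)).trans hx
  have hx3 : 4 * ((n : ℝ) + 2) / κ ≤ ‖x‖ := ((le_max_right _ _).trans (le_max_right _ _)).trans hx
  set v := ‖x‖⁻¹ • x with hv
  have hv1 : ‖v‖ ≤ 1 := by
    rw [hv, norm_smul, norm_inv, norm_norm, inv_mul_cancel₀ hx1.ne']
  have hxv : inner ℝ x v = ‖x‖ := by
    rw [hv, real_inner_smul_right, real_inner_self_eq_norm_sq]
    field_simp
  set T := ‖x‖ / (8 * κ) with hT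
  have hT0 : 0 < T := by positivity
  have hsmall := D.norm_radWave_small_time hn hκ hK x v hv1 hx1 hx2 hx3
  have hlarge := D.norm_radWave_large_time hn hκ hT0 hK hK0.le x v hxv hv1
  have hint := D.integrableOn_radWave hn κ x v
  have hsum : ∫ t in Set.Ioi (0 : ℝ), D.radWave κ x v t =
      (∫ t in Set.Ioc 0 T, D.radWave κ x v t) + ∫ t in Set.Ioi T, D.radWave κ x v t := by
    rw [← Set.Ioc_union_Ioi_eq_Ioi hT0.le, setIntegral_union (Set.Ioc_disjoint_Ioi le_rfl)
      measurableSet_Ioi (hint.mono_set Set.Ioc_subset_Ioi_self)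
      (hint.mono_set (Set.Ioi_subset_Ioi hT0.le))]
  rw [D.fderiv_pot_sub hn, norm_mul, norm_mul, Complex.norm_I, one_mul, Complex.norm_real,
    Real.norm_eq_abs, abs_of_nonneg (by positivity), hsum]
  have htot : ‖(∫ t in Set.Ioc 0 T, D.radWave κ x v t) + ∫ t in Set.Ioi T, D.radWave κ x v t‖ ≤
      C * (√T)⁻¹ ^ n := by
    refine (norm_add_le _ _).trans ((add_le_add hsmall hlarge).trans (le_of_eq ?_))
    rw [hC]; ring
  refine (mul_le_mul_of_nonneg_left htot (by positivity)).trans (le_of_eq ?_)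
  rw [inv_sqrt_pow_eq_rpow n hT0.le, hT, Real.div_rpow hx1.le (by positivity),
    Real.rpow_neg (by positivity : (0 : ℝ) ≤ 8 * κ), div_inv_eq_mul]
  have h5 : ‖x‖ ^ (((n : ℝ) - 1) / 2) * ‖x‖ ^ (-((n : ℝ) / 2)) = ‖x‖ ^ (-(1 / 2 : ℝ)) := by
    rw [← Real.rpow_add hx1]; congr 1; ring
  rw [← h5]
  ring

end BoxProfile

/-! ### The Schrödinger kernel as a Fourier multiplier -/

theorem propConst_re_pos : 0 < propConst.re := by
  have h : propConst = (((√(2 * Real.pi))⁻¹ / 2 : ℝ) : ℂ) * (1 - Complex.I) := by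
    have h1 : ((√(2 * Real.pi) : ℝ) : ℂ) ≠ 0 := by
      exact_mod_cast (Real.sqrt_pos.mpr (by positivity)).ne'
    have hI : (1 + Complex.I) ≠ 0 := by
      intro h
      have := congrArg Complex.re h
      simp at this
    rw [propConst]
    push_cast
    field_simp
    linear_combination Complex.I_sq
  rw [h]
  simp
  positivity

theorem propConst_sq : propConst ^ 2 = 1 / (4 * Real.pi * Complex.I) := by
  have h1 : ((√(2 * Real.pi) : ℝ) : ℂ) ^ 2 = 2 * Real.pi := by
    rw [← Complex.ofReal_pow, Real.sq_sqrt (by positivity)]; push_cast; ring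
  have h2 : (1 + Complex.I) ^ 2 = 2 * Complex.I := by
    linear_combination Complex.I_sq
  rw [propConst, div_pow, mul_pow, h1, h2]
  ring

/-- Fixes the branch: `propConst` has positive real part, hence is the principal root of its square.
-/
theorem gaussian_const_eq (n : ℕ) {t : ℝ} (ht : 0 < t) :
    ((Real.pi : ℂ) / (4 * Real.pi ^ 2 * (t * Complex.I))) ^ ((n : ℂ) / 2) =
      (propConst * ((√t)⁻¹ : ℝ)) ^ n := by
  have hpi : (Real.pi : ℂ) ≠ 0 := by exact_mod_cast Real.pi_ne_zero
  have hst : ((√t : ℝ) : ℂ) ^ 2 = t := by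
    rw [← Complex.ofReal_pow, Real.sq_sqrt ht.le]
  have hst0 : ((√t : ℝ) : ℂ) ≠ 0 := by exact_mod_cast (Real.sqrt_pos.mpr ht).ne'
  have h1 : (Real.pi : ℂ) / (4 * Real.pi ^ 2 * (t * Complex.I)) =
      (propConst * ((√t)⁻¹ : ℝ)) ^ 2 := by
    rw [mul_pow, propConst_sq, ← hst]
    push_cast
    field_simp
  have hre : 0 < (propConst * ((√t)⁻¹ : ℝ)).re := by
    rw [Complex.re_mul_ofReal]
    have := propConst_re_pos
    positivity
  rw [h1, div_eq_mul_inv, Complex.cpow_nat_mul, Complex.sq_cpow_two_inv hre]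

open FourierTransform in
-- The Fourier transform is moved from f to a modulated Gaussian, whose transform is a Gaussian
-- centred at y.
theorem integral_gaussian_fourier {n : ℕ} (f : SchwartzMap (EuclideanSpace ℝ (Fin n)) ℂ)
    {b : ℂ} (hb : 0 < b.re) (y : EuclideanSpace ℝ (Fin n)) :
    ((Real.pi : ℂ) / b) ^ ((n : ℂ) / 2) *
      (∫ x, Complex.exp (-Real.pi ^ 2 * ‖y - x‖ ^ 2 / b) * f x) =
    ∫ ξ, Complex.exp (-b * ‖ξ‖ ^ 2 + 2 * Real.pi * Complex.I * (inner ℝ y ξ : ℝ)) *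
      (𝓕 (f : EuclideanSpace ℝ (Fin n) → ℂ)) ξ := by
  have J : Integrable (fun w : EuclideanSpace ℝ (Fin n) =>
      Complex.exp (-b * ‖w‖ ^ 2 + 2 * Real.pi * Complex.I * (inner ℝ y w : ℝ))) :=
    GaussianFourier.integrable_cexp_neg_mul_sq_norm_add hb _ _
  have h1 : ∫ x, (𝓕 (fun w : EuclideanSpace ℝ (Fin n) =>
      Complex.exp (-b * ‖w‖ ^ 2 + 2 * Real.pi * Complex.I * (inner ℝ y w : ℝ)))) x • f x =
      ∫ ξ, Complex.exp (-b * ‖ξ‖ ^ 2 + 2 * Real.pi * Complex.I * (inner ℝ y ξ : ℝ)) •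
      (𝓕 (f : EuclideanSpace ℝ (Fin n) → ℂ)) ξ := by
    simpa using! (VectorFourier.integral_fourierIntegral_smul_eq_flip
      (L := innerₗ (EuclideanSpace ℝ (Fin n)))
      Real.continuous_fourierChar continuous_inner J f.integrable)
  rw [← integral_const_mul]
  simp only [smul_eq_mul] at h1
  rw [← h1]
  congr 1
  funext x
  rw [fourier_gaussian_innerProductSpace' hb]
  simp [mul_assoc]

open FourierTransform in
/-- The free Schrödinger kernel as a Fourier multiplier. -/
theorem integral_osc_mul_schwartz {n : ℕ} (f : SchwartzMap (EuclideanSpace ℝ (Fin n)) ℂ)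
    {t : ℝ} (ht : 0 < t) (y : EuclideanSpace ℝ (Fin n)) :
    (propConst * ((√t)⁻¹ : ℝ)) ^ n * (∫ x, osc t ‖x - y‖ * f x) =
    ∫ ξ, Complex.exp (2 * Real.pi * Complex.I * (inner ℝ y ξ : ℝ)) *
      (Complex.exp (-(4 * Real.pi ^ 2 * (t * Complex.I)) * ‖ξ‖ ^ 2) *
      (𝓕 (f : EuclideanSpace ℝ (Fin n) → ℂ)) ξ) := by
  have hpi : (Real.pi : ℂ) ≠ 0 := by exact_mod_cast Real.pi_ne_zero
  have htC : (t : ℂ) ≠ 0 := by exact_mod_cast ht.ne'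
  have hFint : Integrable (𝓕 (f : EuclideanSpace ℝ (Fin n) → ℂ)) := (𝓕 f).integrable
  -- The Gaussian identity needs Re b > 0, so imaginary time is reached as the limit δ → 0+; both
  -- sides converge by domination because f and its transform are integrable.
  set b : ℝ → ℂ := fun δ => 4 * Real.pi ^ 2 * (δ + t * Complex.I) with hb
  have hb0 : b 0 = 4 * Real.pi ^ 2 * (t * Complex.I) := by simp [hb]
  have hbcont : Continuous b := by rw [hb]; fun_prop
  have hbre : ∀ δ, (b δ).re = 4 * Real.pi ^ 2 * δ := by
    intro δ
    have : b δ = ((4 * Real.pi ^ 2 * δ : ℝ) : ℂ) + ((4 * Real.pi ^ 2 * t : ℝ) : ℂ) * Complex.I := by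
      rw [hb]; push_cast; ring
    rw [this]; simp [-Complex.ofReal_mul, -Complex.ofReal_pow]
  have hbne : ∀ δ, b δ ≠ 0 := by
    intro δ h
    have h1 : (δ : ℂ) + t * Complex.I = 0 := by
      rw [hb] at h
      simpa [hpi] using h
    have := congrArg Complex.im h1
    simp at this
    exact ht.ne' this
  have hL : Tendsto (fun δ : ℝ => ((Real.pi : ℂ) / b δ) ^ ((n : ℂ) / 2) *
      (∫ x, Complex.exp (-Real.pi ^ 2 * ‖y - x‖ ^ 2 / b δ) * f x)) (𝓝[>] 0)
      (𝓝 ((propConst * ((√t)⁻¹ : ℝ)) ^ n * (∫ x, osc t ‖x - y‖ * f x))) := by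
    refine Tendsto.mul ?_ ?_
    · rw [← gaussian_const_eq n ht, ← hb0]
      refine Tendsto.mono_left (ContinuousAt.tendsto ?_) nhdsWithin_le_nhds
      refine ContinuousAt.cpow (continuousAt_const.div hbcont.continuousAt (hbne 0))
        continuousAt_const ?_
      right
      -- The limit lies on the negative imaginary axis, away from the branch cut, so the complex
      -- power is continuous there.
      have h2 : (Real.pi : ℂ) / b 0 = ((-(1 / (4 * Real.pi * t)) : ℝ) : ℂ) * Complex.I := by
        rw [hb0]
        push_cast
        field_simp
        simp
      rw [h2]
      simp [-Complex.ofReal_neg, -Complex.ofReal_div]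
      exact ht.ne'
    · refine tendsto_integral_filter_of_dominated_convergence (fun x => ‖f x‖) ?_ ?_
        f.integrable.norm ?_
      · refine Filter.Eventually.of_forall fun δ => Continuous.aestronglyMeasurable ?_
        have := f.continuous
        fun_prop
      · filter_upwards [self_mem_nhdsWithin] with δ hδ
        refine Filter.Eventually.of_forall fun x => ?_
        rw [norm_mul, Complex.norm_exp]
        refine mul_le_of_le_one_left (norm_nonneg _) (Real.exp_le_one_iff.mpr ?_)
        have h3 : -(Real.pi : ℂ) ^ 2 * (‖y - x‖ : ℂ) ^ 2 / b δ =
            ((-(Real.pi ^ 2 * ‖y - x‖ ^ 2) : ℝ) : ℂ) * (b δ)⁻¹ := by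
          push_cast; ring
        rw [h3, Complex.re_ofReal_mul, Complex.inv_re, hbre]
        have h4 : 0 ≤ 4 * Real.pi ^ 2 * δ / Complex.normSq (b δ) := by
          have := Complex.normSq_nonneg (b δ)
          have hδ' : (0 : ℝ) < δ := hδ
          positivity
        have h5 : 0 ≤ Real.pi ^ 2 * ‖y - x‖ ^ 2 := by positivity
        nlinarith
      · refine Filter.Eventually.of_forall fun x => ?_
        have h6 : osc t ‖x - y‖ = Complex.exp (-Real.pi ^ 2 * ‖y - x‖ ^ 2 / b 0) := by
          rw [osc, hb0, norm_sub_rev]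
          congr 1
          push_cast
          field_simp
          simp
        rw [h6]
        refine Tendsto.mono_left (ContinuousAt.tendsto ?_) nhdsWithin_le_nhds
        refine ContinuousAt.mul (ContinuousAt.cexp ?_) continuousAt_const
        exact continuousAt_const.div hbcont.continuousAt (hbne 0)
  have hR : Tendsto (fun δ : ℝ => ∫ ξ, Complex.exp (-(b δ) * ‖ξ‖ ^ 2 +
      2 * Real.pi * Complex.I * (inner ℝ y ξ : ℝ)) *
      (𝓕 (f : EuclideanSpace ℝ (Fin n) → ℂ)) ξ) (𝓝[>] 0)
      (𝓝 (∫ ξ, Complex.exp (2 * Real.pi * Complex.I * (inner ℝ y ξ : ℝ)) *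
      (Complex.exp (-(4 * Real.pi ^ 2 * (t * Complex.I)) * ‖ξ‖ ^ 2) *
      (𝓕 (f : EuclideanSpace ℝ (Fin n) → ℂ)) ξ))) := by
    refine tendsto_integral_filter_of_dominated_convergence
      (fun ξ => ‖(𝓕 (f : EuclideanSpace ℝ (Fin n) → ℂ)) ξ‖) ?_ ?_ hFint.norm ?_
    · refine Filter.Eventually.of_forall fun δ => ?_
      refine AEStronglyMeasurable.mul (Continuous.aestronglyMeasurable ?_)
        hFint.aestronglyMeasurable
      fun_prop
    · filter_upwards [self_mem_nhdsWithin] with δ hδ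
      refine Filter.Eventually.of_forall fun ξ => ?_
      rw [norm_mul, Complex.norm_exp]
      refine mul_le_of_le_one_left (norm_nonneg _) (Real.exp_le_one_iff.mpr ?_)
      have h3 : -(b δ) * (‖ξ‖ : ℂ) ^ 2 + 2 * Real.pi * Complex.I * (inner ℝ y ξ : ℝ) =
          ((‖ξ‖ ^ 2 : ℝ) : ℂ) * (-(b δ)) + ((2 * Real.pi * inner ℝ y ξ : ℝ) : ℂ) * Complex.I := by
        push_cast; ring
      rw [h3, Complex.add_re, Complex.re_ofReal_mul, Complex.neg_re, hbre,
        Complex.re_ofReal_mul, Complex.I_re, mul_zero, add_zero]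
      have hδ' : (0 : ℝ) < δ := hδ
      have h5 : 0 ≤ ‖ξ‖ ^ 2 * (4 * Real.pi ^ 2 * δ) := by positivity
      linarith
    · refine Filter.Eventually.of_forall fun ξ => ?_
      rw [← mul_assoc, ← Complex.exp_add, add_comm (2 * (Real.pi : ℂ) * Complex.I * _), ← hb0]
      refine Tendsto.mono_left (ContinuousAt.tendsto ?_) nhdsWithin_le_nhds
      fun_prop
  refine tendsto_nhds_unique hL (hR.congr' ?_)
  filter_upwards [self_mem_nhdsWithin] with δ hδ
  refine (integral_gaussian_fourier f ?_ y).symm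
  rw [hbre]
  have hδ' : (0 : ℝ) < δ := hδ
  positivity

open FourierTransform Laplacian in
theorem fourier_laplacian_apply {n : ℕ} (f : SchwartzMap (EuclideanSpace ℝ (Fin n)) ℂ)
    (ξ : EuclideanSpace ℝ (Fin n)) :
    𝓕 (Δ f) ξ = -(4 * Real.pi ^ 2 * ‖ξ‖ ^ 2 : ℝ) * 𝓕 f ξ := by
  have hg : Function.HasTemperateGrowth (fun x : EuclideanSpace ℝ (Fin n) => ‖x‖ ^ 2) := by fun_prop
  rw [SchwartzMap.laplacian_eq_fourierMultiplierCLM, SchwartzMap.fourierMultiplierCLM_apply,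
    FourierTransform.fourier_smul, FourierTransform.fourier_fourierInv_eq, smul_apply,
    SchwartzMap.smulLeftCLM_apply_apply hg]
  simp
  ring

/-! ### The Helmholtz equation in the sense of distributions -/

namespace BoxProfile

variable {n : ℕ} (D : BoxProfile n)

/-- The (inverse) Fourier transform of the density. -/
noncomputable def dual (ξ : EuclideanSpace ℝ (Fin n)) : ℂ :=
  ∫ y in D.box, D.weight y * Complex.exp (2 * Real.pi * Complex.I * (inner ℝ y ξ : ℝ))

theorem norm_exp_inner (y ξ : EuclideanSpace ℝ (Fin n)) :
    ‖Complex.exp (2 * Real.pi * Complex.I * (inner ℝ y ξ : ℝ))‖ = 1 := by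
  have : 2 * (Real.pi : ℂ) * Complex.I * (inner ℝ y ξ : ℝ) =
      ((2 * Real.pi * inner ℝ y ξ : ℝ) : ℂ) * Complex.I := by push_cast; ring
  rw [this, Complex.norm_exp_ofReal_mul_I]

theorem norm_dual_le (ξ : EuclideanSpace ℝ (Fin n)) :
    ‖D.dual ξ‖ ≤ ∫ y in D.box, ‖D.weight y‖ := by
  refine norm_integral_le_of_norm_le (D.integrableOn_box D.continuous_weight).norm ?_
  refine Filter.Eventually.of_forall fun y => ?_
  rw [norm_mul, norm_exp_inner, mul_one]

theorem integral_dual_swap {h : EuclideanSpace ℝ (Fin n) → ℂ} (hh : Integrable h) :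
    ∫ ξ, h ξ * D.dual ξ = ∫ y in D.box, D.weight y *
      ∫ ξ, Complex.exp (2 * Real.pi * Complex.I * (inner ℝ y ξ : ℝ)) * h ξ := by
  have hw := D.integrableOn_box D.continuous_weight
  have hint : Integrable (Function.uncurry fun (ξ y : EuclideanSpace ℝ (Fin n)) =>
      (h ξ * D.weight y) * Complex.exp (2 * Real.pi * Complex.I * (inner ℝ y ξ : ℝ)))
      (volume.prod (volume.restrict D.box)) := by
    refine Integrable.mono (hh.mul_prod hw) ?_ ?_
    · refine AEStronglyMeasurable.mul (hh.mul_prod hw).aestronglyMeasurable ?_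
      refine Continuous.aestronglyMeasurable ?_
      fun_prop
    · refine Filter.Eventually.of_forall fun z => ?_
      simp only [Function.uncurry]
      rw [norm_mul, norm_exp_inner, mul_one]
  have := integral_integral_swap hint
  calc ∫ ξ, h ξ * D.dual ξ = ∫ ξ, ∫ y in D.box,
        (h ξ * D.weight y) * Complex.exp (2 * Real.pi * Complex.I * (inner ℝ y ξ : ℝ)) := by
        congr 1; funext ξ
        rw [dual, ← integral_const_mul]
        simp_rw [mul_assoc]
    _ = _ := this
    _ = _ := by
        congr 1; funext y
        rw [← integral_const_mul]
        congr 1; funext ξ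
        ring

open FourierTransform in
-- The kernel is symmetric, so Fubini lets the evolution act on the Schwartz function, where it is a
-- Fourier multiplier; the rough density enters only through its bounded transform.
theorem integral_wave_mul {t : ℝ} (ht : 0 < t)
    (f : SchwartzMap (EuclideanSpace ℝ (Fin n)) ℂ) :
    ∫ x, D.wave x t * f x =
      ∫ ξ, (Complex.exp (-(4 * Real.pi ^ 2 * (t * Complex.I)) * ‖ξ‖ ^ 2) *
        (𝓕 (f : EuclideanSpace ℝ (Fin n) → ℂ)) ξ) * D.dual ξ := by
  have hw := D.integrableOn_box D.continuous_weight
  have hFint : Integrable (𝓕 (f : EuclideanSpace ℝ (Fin n) → ℂ)) := (𝓕 f).integrable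
  have hh : Integrable fun ξ => Complex.exp (-(4 * Real.pi ^ 2 * (t * Complex.I)) * ‖ξ‖ ^ 2) *
      (𝓕 (f : EuclideanSpace ℝ (Fin n) → ℂ)) ξ := by
    refine hFint.bdd_mul (c := 1) (Continuous.aestronglyMeasurable (by fun_prop)) ?_
    refine Filter.Eventually.of_forall fun ξ => ?_
    have : -(4 * (Real.pi : ℂ) ^ 2 * (t * Complex.I)) * ‖ξ‖ ^ 2 =
      ((-(4 * Real.pi ^ 2 * t * ‖ξ‖ ^ 2) : ℝ) : ℂ) * Complex.I := by push_cast; ring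
    rw [this, Complex.norm_exp_ofReal_mul_I]
  rw [D.integral_dual_swap hh]
  simp_rw [← integral_osc_mul_schwartz f ht, wave_eq]
  have hint : Integrable (Function.uncurry fun (x y : EuclideanSpace ℝ (Fin n)) =>
      (f x * D.weight y) * osc t ‖x - y‖) (volume.prod (volume.restrict D.box)) := by
    refine Integrable.mono (f.integrable.mul_prod hw) ?_ ?_
    · refine AEStronglyMeasurable.mul (f.integrable.mul_prod hw).aestronglyMeasurable ?_
      refine Continuous.aestronglyMeasurable ?_
      exact (continuous_osc t).comp (by fun_prop)
    · refine Filter.Eventually.of_forall fun z => ?_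
      simp only [Function.uncurry]
      rw [norm_mul, norm_osc, mul_one]
  have hs := integral_integral_swap hint
  set q := (propConst * ((√t)⁻¹ : ℝ)) ^ n
  calc ∫ x, q * (∫ y in D.box, osc t ‖x - y‖ * D.weight y) * f x
      = q * ∫ x, ∫ y in D.box, (f x * D.weight y) * osc t ‖x - y‖ := by
        rw [← integral_const_mul]
        congr 1; funext x
        rw [mul_assoc, ← integral_mul_const]
        congr 2; funext y; ring
    _ = q * ∫ y in D.box, ∫ x, (f x * D.weight y) * osc t ‖x - y‖ := by rw [hs]
    _ = _ := by
        rw [← integral_const_mul]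
        congr 1; funext y
        have h1 : ∀ x, f x * D.weight y * osc t ‖x - y‖ =
          D.weight y * (osc t ‖x - y‖ * f x) := fun x => by ring
        simp_rw [h1]
        rw [integral_const_mul]
        ring

open FourierTransform Laplacian in
/-- The potential solves the Helmholtz equation in the sense of distributions. -/
theorem integral_pot_mul_helmholtz (hn : 3 ≤ n) (κ : ℝ) (φ : EuclideanSpace ℝ (Fin n) → ℂ)
    (hφ : ContDiff ℝ ∞ φ) (hc : HasCompactSupport φ) :
    -(∫ x, D.pot κ x * (Laplacian.laplacian φ x + (κ : ℂ) ^ 2 * φ x)) =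
      ∫ y in D.box, D.weight y * φ y := by
  set f : SchwartzMap (EuclideanSpace ℝ (Fin n)) ℂ := hc.toSchwartzMap hφ with hf
  have hfφ : (f : EuclideanSpace ℝ (Fin n) → ℂ) = φ := rfl
  set f2 : SchwartzMap (EuclideanSpace ℝ (Fin n)) ℂ := Δ f + ((κ : ℂ) ^ 2) • f with hf2
  have hf2φ : ∀ x, f2 x = Laplacian.laplacian φ x + (κ : ℂ) ^ 2 * φ x := by
    intro x
    rw [hf2, add_apply, smul_apply, SchwartzMap.laplacian_apply, hfφ, smul_eq_mul]
  set lam : EuclideanSpace ℝ (Fin n) → ℝ := fun ξ => κ ^ 2 - 4 * Real.pi ^ 2 * ‖ξ‖ ^ 2 with hlam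
  set Fh : EuclideanSpace ℝ (Fin n) → ℂ := 𝓕 (f : EuclideanSpace ℝ (Fin n) → ℂ) with hFh
  have hFcoe : ∀ ξ, (𝓕 f) ξ = Fh ξ := fun ξ => by rw [SchwartzMap.fourier_coe]
  have hF2 : ∀ ξ, (𝓕 (f2 : EuclideanSpace ℝ (Fin n) → ℂ)) ξ = (lam ξ : ℂ) * Fh ξ := by
    intro ξ
    have h1 : (𝓕 (f2 : EuclideanSpace ℝ (Fin n) → ℂ)) ξ = (𝓕 f2) ξ := by
      rw [SchwartzMap.fourier_coe]
    rw [h1, hf2, FourierTransform.fourier_add, FourierTransform.fourier_smul, add_apply,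
      smul_apply, fourier_laplacian_apply, hFcoe, hlam, smul_eq_mul]
    push_cast
    ring
  have hFint : Integrable Fh := (𝓕 f).integrable
  have hFint2 : Integrable fun ξ => ‖ξ‖ ^ 2 * ‖Fh ξ‖ := (𝓕 f).integrable_pow_mul volume 2
  have hdm : AEStronglyMeasurable D.dual := by
    unfold dual
    refine Continuous.aestronglyMeasurable ?_
    refine continuous_of_dominated (bound := fun y => ‖D.weight y‖) (fun ξ => ?_) (fun ξ => ?_)
      (D.integrableOn_box D.continuous_weight).norm ?_
    · have := D.continuous_weight
      exact Continuous.aestronglyMeasurable (by fun_prop)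
    · refine Filter.Eventually.of_forall fun y => ?_
      rw [norm_mul, norm_exp_inner, mul_one]
    · exact Filter.Eventually.of_forall fun y => by fun_prop
  set m : EuclideanSpace ℝ (Fin n) → ℂ := fun ξ => Fh ξ * D.dual ξ with hm
  have hmint : Integrable m :=
    hFint.mul_bdd (c := ∫ y in D.box, ‖D.weight y‖) hdm
      (Filter.Eventually.of_forall fun ξ => D.norm_dual_le ξ)
  have hlamc : Continuous lam := by rw [hlam]; fun_prop
  have hlmint : Integrable fun ξ => ‖(lam ξ : ℂ) * m ξ‖ := by
    have hb : Integrable fun ξ => (κ ^ 2 * ‖Fh ξ‖ + 4 * Real.pi ^ 2 * (‖ξ‖ ^ 2 * ‖Fh ξ‖)) *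
        ∫ y in D.box, ‖D.weight y‖ :=
      ((hFint.norm.const_mul (κ ^ 2)).add (hFint2.const_mul (4 * Real.pi ^ 2))).mul_const _
    refine hb.mono' ?_ ?_
    · exact ((Complex.continuous_ofReal.comp hlamc).aestronglyMeasurable.mul
        hmint.aestronglyMeasurable).norm
    · refine Filter.Eventually.of_forall fun ξ => ?_
      rw [norm_norm, norm_mul, Complex.norm_real, hm]
      simp only
      rw [norm_mul, ← mul_assoc]
      refine mul_le_mul ?_ (D.norm_dual_le ξ) (norm_nonneg _) (by positivity)
      have : ‖lam ξ‖ ≤ κ ^ 2 + 4 * Real.pi ^ 2 * ‖ξ‖ ^ 2 := by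
        rw [hlam]
        refine (norm_sub_le _ _).trans ?_
        rw [Real.norm_eq_abs, Real.norm_eq_abs, abs_of_nonneg (by positivity),
          abs_of_nonneg (by positivity)]
      calc ‖lam ξ‖ * ‖Fh ξ‖ ≤ (κ ^ 2 + 4 * Real.pi ^ 2 * ‖ξ‖ ^ 2) * ‖Fh ξ‖ := by gcongr
        _ = _ := by ring
  -- On the Fourier side the pairing e^{iκ²t}⟨wave, φ⟩ is defined and differentiable for all t,
  -- including t = 0, where the kernel representation breaks down. The derivative is dominated
  -- because the transform of f decays faster than ‖ξ‖^{-2} in the integrable sense of `hFint2`.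
  set S : ℝ → ℂ := fun t => ∫ ξ, Complex.exp (((lam ξ * t : ℝ) : ℂ) * Complex.I) * m ξ with hS
  set S' : ℝ → ℂ := fun t => ∫ ξ, Complex.exp (((lam ξ * t : ℝ) : ℂ) * Complex.I) *
    (Complex.I * ((lam ξ : ℂ) * m ξ)) with hS'
  have hexp : ∀ t, AEStronglyMeasurable
      (fun ξ => Complex.exp (((lam ξ * t : ℝ) : ℂ) * Complex.I)) := fun t =>
    Continuous.aestronglyMeasurable (by fun_prop)
  have hSd : ∀ t, HasDerivAt S (S' t) t := by
    intro t
    refine (hasDerivAt_integral_of_dominated_loc_of_deriv_le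
      (F := fun t ξ => Complex.exp (((lam ξ * t : ℝ) : ℂ) * Complex.I) * m ξ)
      (F' := fun t ξ => Complex.exp (((lam ξ * t : ℝ) : ℂ) * Complex.I) *
        (Complex.I * ((lam ξ : ℂ) * m ξ)))
      (bound := fun ξ => ‖(lam ξ : ℂ) * m ξ‖) Filter.univ_mem ?_ ?_ ?_ ?_ hlmint ?_).2
    · exact Filter.Eventually.of_forall fun t => (hexp t).mul hmint.aestronglyMeasurable
    · refine hmint.bdd_mul (c := 1) (hexp t) (Filter.Eventually.of_forall fun ξ => ?_)
      rw [Complex.norm_exp_ofReal_mul_I]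
    · exact (hexp t).mul (((Complex.continuous_ofReal.comp hlamc).aestronglyMeasurable.mul
        hmint.aestronglyMeasurable).const_mul _)
    · refine Filter.Eventually.of_forall fun ξ t _ => ?_
      rw [norm_mul, Complex.norm_exp_ofReal_mul_I, one_mul, norm_mul, Complex.norm_I, one_mul]
    · refine Filter.Eventually.of_forall fun ξ t _ => ?_
      have h1 : HasDerivAt (fun t : ℝ => lam ξ * t) (lam ξ) t := by
        simpa using (hasDerivAt_id t).const_mul (lam ξ)
      convert! ((h1.ofReal_comp.mul_const Complex.I).cexp.mul_const (m ξ)) using 1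
      ring
  have hphase : ∀ t ξ, Complex.exp (((lam ξ * t : ℝ) : ℂ) * Complex.I) =
      phase κ t * Complex.exp (-(4 * Real.pi ^ 2 * (t * Complex.I)) * ‖ξ‖ ^ 2) := by
    intro t ξ
    rw [phase, ← Complex.exp_add, hlam]
    congr 1
    push_cast
    ring
  have hSt : ∀ t, 0 < t → S t = phase κ t * ∫ x, D.wave x t * f x := by
    intro t ht
    rw [D.integral_wave_mul ht, ← integral_const_mul, hS]
    simp only [hphase, hm]
    congr 1; funext ξ
    ring
  have hS't : ∀ t, 0 < t → S' t = Complex.I * (phase κ t * ∫ x, D.wave x t * f2 x) := by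
    intro t ht
    rw [D.integral_wave_mul ht, ← integral_const_mul, ← integral_const_mul, hS']
    simp only [hphase, hm, hF2]
    congr 1; funext ξ
    ring
  obtain ⟨C, hC0, hC⟩ := D.norm_wave_le hn
  have hbound : ∀ (h : SchwartzMap (EuclideanSpace ℝ (Fin n)) ℂ) t, 0 < t →
      ‖∫ x, D.wave x t * h x‖ ≤ C * timeBound t * ∫ x, ‖h x‖ := by
    intro h t ht
    rw [← integral_const_mul]
    refine norm_integral_le_of_norm_le (h.integrable.norm.const_mul _) ?_
    refine Filter.Eventually.of_forall fun x => ?_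
    rw [norm_mul]
    exact mul_le_mul_of_nonneg_right (hC x t ht) (norm_nonneg _)
  have hS0 : S 0 = ∫ y in D.box, D.weight y * φ y := by
    have h1 : S 0 = ∫ ξ, Fh ξ * D.dual ξ := by simp [hS, hm]
    rw [h1, D.integral_dual_swap hFint]
    congr 1; funext y
    congr 1
    have h2 := congrFun (Continuous.fourierInv_fourier_eq f.continuous f.integrable hFint) y
    rw [Real.fourierInv_eq'] at h2
    rw [← hfφ, ← h2]
    congr 1; funext ξ
    rw [smul_eq_mul, real_inner_comm]
    congr 2
    push_cast
    ring
  have hSlim : Tendsto S atTop (𝓝 0) := by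
    have h1 : Tendsto (fun t : ℝ => C * (√t)⁻¹ * ∫ x, ‖f x‖) atTop (𝓝 0) := by
      have h2 : Tendsto (fun t : ℝ => (√t)⁻¹) atTop (𝓝 0) :=
        tendsto_inv_atTop_zero.comp Real.tendsto_sqrt_atTop
      simpa using (h2.const_mul C).mul_const (∫ x, ‖f x‖)
    refine squeeze_zero_norm' ?_ h1
    filter_upwards [eventually_gt_atTop 0] with t ht
    rw [hSt t ht, norm_mul, norm_phase, one_mul]
    refine (hbound f t ht).trans ?_
    have : 0 ≤ ∫ x, ‖f x‖ := integral_nonneg fun _ => norm_nonneg _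
    gcongr
    exact timeBound_le t
  have hpm : Measurable fun t => phase κ t := (continuous_phase κ).measurable
  have hjoint : Integrable (Function.uncurry fun (x : EuclideanSpace ℝ (Fin n)) (t : ℝ) =>
      (phase κ t * D.wave x t) * f2 x) (volume.prod (volume.restrict (Set.Ioi 0))) := by
    have hb := f2.integrable (μ := volume).norm.mul_prod (timeBound_integrableOn.const_mul C)
    refine hb.mono' ?_ ?_
    · refine AEStronglyMeasurable.mul ?_ ?_
      · exact ((hpm.comp measurable_snd).mul D.measurable_wave).aestronglyMeasurable
      · have := f2.continuous
        exact Continuous.aestronglyMeasurable (by fun_prop)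
    · have hprod : (volume : Measure (EuclideanSpace ℝ (Fin n))).prod
          (volume.restrict (Set.Ioi (0 : ℝ))) =
          (volume.prod volume).restrict (Set.univ ×ˢ Set.Ioi (0 : ℝ)) := by
        rw [← Measure.prod_restrict, Measure.restrict_univ]
      rw [hprod]
      refine (ae_restrict_iff' (MeasurableSet.univ.prod measurableSet_Ioi)).mpr
        (Filter.Eventually.of_forall fun z hz => ?_)
      simp only [Function.uncurry]
      rw [norm_mul, norm_mul, norm_phase, one_mul, mul_comm]
      exact mul_le_mul_of_nonneg_left (hC z.1 z.2 hz.2) (norm_nonneg _)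
  have hswap := integral_integral_swap hjoint
  have hmain : ∫ x, D.pot κ x * (Laplacian.laplacian φ x + (κ : ℂ) ^ 2 * φ x) =
      ∫ t in Set.Ioi (0 : ℝ), S' t := by
    calc ∫ x, D.pot κ x * (Laplacian.laplacian φ x + (κ : ℂ) ^ 2 * φ x)
        = Complex.I * ∫ x, ∫ t in Set.Ioi (0 : ℝ), (phase κ t * D.wave x t) * f2 x := by
          rw [← integral_const_mul]
          congr 1; funext x
          rw [pot, ← hf2φ, integral_mul_const, mul_assoc]
      _ = Complex.I * ∫ t in Set.Ioi (0 : ℝ), ∫ x, (phase κ t * D.wave x t) * f2 x := by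
          rw [hswap]
      _ = _ := by
          rw [← integral_const_mul]
          refine setIntegral_congr_fun measurableSet_Ioi fun t ht => ?_
          rw [hS't t ht, ← integral_const_mul (phase κ t)]
          simp_rw [mul_assoc]
  have hS'int : IntegrableOn S' (Set.Ioi 0) := by
    have h1 := hjoint.integral_prod_right.const_mul Complex.I
    refine IntegrableOn.congr_fun (f := fun t => Complex.I *
      ∫ x, (phase κ t * D.wave x t) * f2 x) h1 (fun t ht => ?_) measurableSet_Ioi
    rw [hS't t ht, ← integral_const_mul (phase κ t)]
    simp_rw [mul_assoc]
  -- The integral of S' over (0, ∞) is 0 - S(0), and S(0) is the pairing of the density with φ by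
  -- Fourier inversion.
  have hftc := integral_Ioi_of_hasDerivAt_of_tendsto' (fun t _ => hSd t) hS'int hSlim
  rw [hmain, hftc, hS0]
  ring

end BoxProfile

/-! ### From distributional to weak solutions -/

/-- The bilinear gradient product `∑_j ∂_j v ∂_j φ`. -/
noncomputable def gradDot {n : ℕ} (v φ : EuclideanSpace ℝ (Fin n) → ℂ)
    (x : EuclideanSpace ℝ (Fin n)) : ℂ :=
  ∑ j, fderiv ℝ v x (EuclideanSpace.basisFun (Fin n) ℝ j) *
    fderiv ℝ φ x (EuclideanSpace.basisFun (Fin n) ℝ j)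

/-- The weak form of `-(Δ + κ²) v = G`, tested against compactly supported `C¹` functions. -/
def WeakHelmholtz {n : ℕ} (κ : ℝ) (G v : EuclideanSpace ℝ (Fin n) → ℂ) : Prop :=
  ∀ φ : EuclideanSpace ℝ (Fin n) → ℂ, ContDiff ℝ 1 φ → HasCompactSupport φ →
    ∫ x, (gradDot v φ x - (κ : ℂ) ^ 2 * (v x * φ x)) = ∫ x, G x * φ x

section WeakForm

variable {n : ℕ} {v φ : EuclideanSpace ℝ (Fin n) → ℂ}

theorem continuous_fderiv_apply_const (hv : ContDiff ℝ 1 v) (e : EuclideanSpace ℝ (Fin n)) :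
    Continuous fun x => fderiv ℝ v x e :=
  (hv.continuous_fderiv one_ne_zero).clm_apply continuous_const

theorem continuous_gradDot (hv : ContDiff ℝ 1 v) (hφ : ContDiff ℝ 1 φ) :
    Continuous (gradDot v φ) :=
  continuous_finsetSum _ fun _ _ =>
    (continuous_fderiv_apply_const hv _).mul (continuous_fderiv_apply_const hφ _)

theorem hasCompactSupport_fderiv_apply (hc : HasCompactSupport φ)
    (e : EuclideanSpace ℝ (Fin n)) : HasCompactSupport fun x => fderiv ℝ φ x e :=
  hc.fderiv_apply ℝ e

theorem integrable_mul_of_hasCompactSupport {w q : EuclideanSpace ℝ (Fin n) → ℂ}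
    (hw : LocallyIntegrable w) (hq : Continuous q) (hc : HasCompactSupport q) :
    Integrable fun x => w x * q x := by
  have := hw.integrable_smul_right_of_hasCompactSupport hq hc
  simpa using this

theorem integral_mul_laplacian (hv : ContDiff ℝ 1 v) (hφ : ContDiff ℝ ∞ φ)
    (hc : HasCompactSupport φ) :
    ∫ x, v x * Laplacian.laplacian φ x = -∫ x, gradDot v φ x := by
  have hφ1 : ContDiff ℝ 1 φ := hφ.of_le (by exact_mod_cast le_top)
  set e := EuclideanSpace.basisFun (Fin n) ℝ with he
  have hd : ∀ j, ContDiff ℝ 1 fun x => fderiv ℝ φ x (e j) := fun j =>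
    (hφ.fderiv_right (m := 1) (by norm_cast)).clm_apply contDiff_const
  have hL : ∀ x, Laplacian.laplacian φ x =
      ∑ j, fderiv ℝ (fun y => fderiv ℝ φ y (e j)) x (e j) := by
    intro x
    rw [InnerProductSpace.laplacian_eq_iteratedFDeriv_orthonormalBasis φ e]
    refine Finset.sum_congr rfl fun j _ => ?_
    rw [iteratedFDeriv_two_apply]
    have h1 : DifferentiableAt ℝ (fderiv ℝ φ) x :=
      ((hφ.fderiv_right (m := 1) (by norm_cast)).differentiable one_ne_zero) x
    have := (h1.hasFDerivAt.clm_apply (hasFDerivAt_const (e j) x)).fderiv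
    rw [this]
    simp
  have hcj : ∀ j, HasCompactSupport fun x => fderiv ℝ φ x (e j) := fun j =>
    hasCompactSupport_fderiv_apply hc _
  have hi1 : ∀ j, Integrable fun x => v x * fderiv ℝ (fun y => fderiv ℝ φ y (e j)) x (e j) :=
    fun j => integrable_mul_of_hasCompactSupport hv.continuous.locallyIntegrable
      (continuous_fderiv_apply_const (hd j) _) (hasCompactSupport_fderiv_apply (hcj j) _)
  have hi2 : ∀ j, Integrable fun x => fderiv ℝ v x (e j) * fderiv ℝ φ x (e j) :=
    fun j => integrable_mul_of_hasCompactSupport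
      (continuous_fderiv_apply_const hv _).locallyIntegrable
      (hd j).continuous (hcj j)
  simp_rw [hL, Finset.mul_sum, gradDot]
  rw [integral_finsetSum _ fun j _ => hi1 j, integral_finsetSum _ fun j _ => hi2 j,
    ← Finset.sum_neg_distrib]
  refine Finset.sum_congr rfl fun j _ => ?_
  exact integral_mul_fderiv_eq_neg_fderiv_mul_of_integrable (hi2 j) (hi1 j)
    (integrable_mul_of_hasCompactSupport hv.continuous.locallyIntegrable (hd j).continuous (hcj j))
    (fun x _ => hv.differentiable one_ne_zero x) (fun x _ => (hd j).differentiable one_ne_zero x)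

/-- A shrinking sequence of mollifiers. -/
noncomputable def mollifier (n k : ℕ) : ContDiffBump (0 : EuclideanSpace ℝ (Fin n)) where
  rIn := 1 / (2 * ((k : ℝ) + 1))
  rOut := 1 / ((k : ℝ) + 1)
  rIn_pos := by positivity
  rIn_lt_rOut := by
    have : (0 : ℝ) < (k : ℝ) + 1 := by positivity
    exact one_div_lt_one_div_of_lt this (by linarith)

open ContinuousLinearMap in
/-- Convolution of a test function with a mollifier. -/
noncomputable def mollify {n : ℕ} (k : ℕ) (q : EuclideanSpace ℝ (Fin n) → ℂ) :
    EuclideanSpace ℝ (Fin n) → ℂ :=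
  MeasureTheory.convolution ((mollifier n k).normed volume) q (lsmul ℝ ℝ) volume

theorem mollifier_rOut_le_one (k : ℕ) : (mollifier n k).rOut ≤ 1 := by
  change 1 / ((k : ℝ) + 1) ≤ 1
  rw [div_le_one (by positivity)]
  have : (0 : ℝ) ≤ k := by positivity
  linarith

theorem tendsto_mollify {q : EuclideanSpace ℝ (Fin n) → ℂ} (hq : Continuous q)
    (x : EuclideanSpace ℝ (Fin n)) : Tendsto (fun k => mollify k q x) atTop (𝓝 (q x)) :=
  ContDiffBump.convolution_tendsto_right_of_continuous (φ := mollifier n)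
    tendsto_one_div_add_atTop_nhds_zero_nat hq x

theorem norm_mollify_sub_le {q : EuclideanSpace ℝ (Fin n) → ℂ} (hq : Continuous q) {C : ℝ}
    (k : ℕ) (x : EuclideanSpace ℝ (Fin n))
    (h : ∀ y ∈ Metric.ball x 1, ‖q y - q x‖ ≤ C) : ‖mollify k q x - q x‖ ≤ C := by
  rw [← dist_eq_norm]
  refine ContDiffBump.dist_normed_convolution_le hq.aestronglyMeasurable fun y hy => ?_
  rw [dist_eq_norm]
  exact h y (Metric.ball_subset_ball (mollifier_rOut_le_one k) hy)

theorem contDiff_mollify {q : EuclideanSpace ℝ (Fin n) → ℂ} (hq : Continuous q) (k : ℕ) :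
    ContDiff ℝ ∞ (mollify k q) :=
  (mollifier n k).hasCompactSupport_normed.contDiff_convolution_left _
    (mollifier n k).contDiff_normed hq.locallyIntegrable

theorem hasCompactSupport_mollify {q : EuclideanSpace ℝ (Fin n) → ℂ} (hq : HasCompactSupport q)
    (k : ℕ) : HasCompactSupport (mollify k q) :=
  (mollifier n k).hasCompactSupport_normed.convolution _ hq

open ContinuousLinearMap in
theorem fderiv_mollify_apply (hφ : ContDiff ℝ 1 φ) (hc : HasCompactSupport φ) (k : ℕ)
    (x e : EuclideanSpace ℝ (Fin n)) :
    fderiv ℝ (mollify k φ) x e = mollify k (fun y => fderiv ℝ φ y e) x := by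
  have hl : LocallyIntegrable ((mollifier n k).normed volume)
      (volume : Measure (EuclideanSpace ℝ (Fin n))) :=
    ((mollifier n k).contDiff_normed (n := 0)).continuous.locallyIntegrable
  have h := (hc.hasFDerivAt_convolution_right (lsmul ℝ ℝ) hl hφ x).fderiv
  rw [mollify, h, convolution_precompR_apply _ hl (hc.fderiv ℝ)
    (hφ.continuous_fderiv one_ne_zero)]
  rfl

theorem tendsto_integral_mul_mollify {w q : EuclideanSpace ℝ (Fin n) → ℂ}
    (hw : LocallyIntegrable w) (hq : Continuous q) (hc : HasCompactSupport q) :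
    Tendsto (fun k => ∫ x, w x * mollify k q x) atTop (𝓝 (∫ x, w x * q x)) := by
  obtain ⟨C, hC⟩ := hq.bounded_above_of_compact_support hc
  have hC0 : 0 ≤ C := (norm_nonneg _).trans (hC 0)
  obtain ⟨R, hR⟩ := hc.isCompact.isBounded.subset_closedBall (0 : EuclideanSpace ℝ (Fin n))
  have hz : ∀ y, R < ‖y‖ → q y = 0 := by
    intro y hy
    by_contra hne
    have := hR (subset_tsupport q hne)
    rw [mem_closedBall_zero_iff] at this
    linarith
  set K := Metric.closedBall (0 : EuclideanSpace ℝ (Fin n)) (R + 1) with hK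
  have hwK : IntegrableOn w K := hw.integrableOn_isCompact (isCompact_closedBall _ _)
  -- With |q| ≤ C, the mollification differs from q by at most 2C, hence the constant 3C; it
  -- vanishes outside the ball of radius R + 1 because every mollifier has radius at most 1.
  refine tendsto_integral_of_dominated_convergence
    (K.indicator fun x => ‖w x‖ * (3 * C)) ?_ ?_ ?_ ?_
  · intro k
    exact hw.aestronglyMeasurable.mul (contDiff_mollify hq k).continuous.aestronglyMeasurable
  · rw [integrable_indicator_iff Metric.isClosed_closedBall.measurableSet]
    exact hwK.norm.mul_const _
  · intro k
    refine Eventually.of_forall fun x => ?_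
    by_cases hx : x ∈ K
    · rw [Set.indicator_of_mem hx, norm_mul]
      refine mul_le_mul_of_nonneg_left ?_ (norm_nonneg _)
      have h1 := norm_mollify_sub_le hq k x (C := 2 * C) fun y _ =>
        (norm_sub_le _ _).trans (by linarith [hC y, hC x])
      have h2 := norm_add_le (mollify k q x - q x) (q x)
      rw [sub_add_cancel] at h2
      linarith [hC x]
    · rw [Set.indicator_of_notMem hx]
      have hx' : R + 1 < ‖x‖ := by
        rw [hK, mem_closedBall_zero_iff] at hx
        linarith
      have hqx : q x = 0 := hz x (by linarith)
      have h1 := norm_mollify_sub_le hq k x (C := 0) fun y hy => by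
        have h3 : R < ‖y‖ := by
          rw [Metric.mem_ball, dist_eq_norm] at hy
          have := norm_sub_norm_le x y
          rw [norm_sub_rev] at this
          linarith
        simp [hz y h3, hqx]
      rw [hqx, sub_zero] at h1
      rw [norm_mul]
      have : ‖mollify k q x‖ = 0 := le_antisymm h1 (norm_nonneg _)
      rw [this, mul_zero]
  · refine Eventually.of_forall fun x => ?_
    exact (tendsto_mollify hq x).const_mul _

theorem integrable_gradDot (hv : ContDiff ℝ 1 v) (hφ : ContDiff ℝ 1 φ)
    (hc : HasCompactSupport φ) : Integrable (gradDot v φ) :=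
  integrable_finsetSum _ fun _ _ => integrable_mul_of_hasCompactSupport
    (continuous_fderiv_apply_const hv _).locallyIntegrable
    (continuous_fderiv_apply_const hφ _) (hasCompactSupport_fderiv_apply hc _)

theorem integral_gradDot (hv : ContDiff ℝ 1 v) (hφ : ContDiff ℝ 1 φ)
    (hc : HasCompactSupport φ) : ∫ x, gradDot v φ x =
      ∑ j, ∫ x, fderiv ℝ v x (EuclideanSpace.basisFun (Fin n) ℝ j) *
        fderiv ℝ φ x (EuclideanSpace.basisFun (Fin n) ℝ j) :=
  integral_finsetSum _ fun _ _ => integrable_mul_of_hasCompactSupport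
    (continuous_fderiv_apply_const hv _).locallyIntegrable
    (continuous_fderiv_apply_const hφ _) (hasCompactSupport_fderiv_apply hc _)

/-- A `C¹` solution of the Helmholtz equation in the sense of distributions is a weak solution. -/
theorem weakHelmholtz_of_distributional {κ : ℝ} {G : EuclideanSpace ℝ (Fin n) → ℂ}
    (hv : ContDiff ℝ 1 v) (hG : LocallyIntegrable G)
    (h : ∀ φ : EuclideanSpace ℝ (Fin n) → ℂ, ContDiff ℝ ∞ φ → HasCompactSupport φ →
      -(∫ x, v x * (Laplacian.laplacian φ x + (κ : ℂ) ^ 2 * φ x)) = ∫ x, G x * φ x) :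
    WeakHelmholtz κ G v := by
  have hsmooth : ∀ φ : EuclideanSpace ℝ (Fin n) → ℂ, ContDiff ℝ ∞ φ → HasCompactSupport φ →
      (∫ x, gradDot v φ x) - (κ : ℂ) ^ 2 * ∫ x, v x * φ x = ∫ x, G x * φ x := by
    intro φ hφ hc
    have hi1 : Integrable fun x => v x * φ x := integrable_mul_of_hasCompactSupport
      hv.continuous.locallyIntegrable hφ.continuous hc
    have hlapc : Continuous (Laplacian.laplacian φ) := by
      have := (InnerProductSpace.laplacian_eq_iteratedFDeriv_orthonormalBasis φ
        (EuclideanSpace.basisFun (Fin n) ℝ))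
      rw [this]
      refine continuous_finsetSum _ fun j _ => ?_
      have h2 : Continuous (iteratedFDeriv ℝ 2 φ) :=
        (contDiff_infty.1 hφ 2).continuous_iteratedFDeriv le_rfl
      exact (continuous_eval_const _).comp h2
    have hlaps : HasCompactSupport (Laplacian.laplacian φ) := by
      refine hc.mono' fun x hx => ?_
      by_contra hxs
      apply hx
      rw [InnerProductSpace.laplacian_eq_iteratedFDeriv_orthonormalBasis φ
        (EuclideanSpace.basisFun (Fin n) ℝ)]
      have h0 : iteratedFDeriv ℝ 2 φ x = 0 := by
        by_contra hne
        exact hxs (support_iteratedFDeriv_subset 2 hne)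
      simp [h0]
    have hi2 : Integrable fun x => v x * Laplacian.laplacian φ x :=
      integrable_mul_of_hasCompactSupport hv.continuous.locallyIntegrable hlapc hlaps
    rw [← h φ hφ hc]
    have : ∀ x, v x * (Laplacian.laplacian φ x + (κ : ℂ) ^ 2 * φ x) =
        v x * Laplacian.laplacian φ x + (κ : ℂ) ^ 2 * (v x * φ x) := fun x => by ring
    simp_rw [this]
    rw [integral_add hi2 (hi1.const_mul _), integral_mul_laplacian hv hφ hc, integral_const_mul]
    ring
  -- Only first derivatives of φ remain, so mollification extends the identity to C¹ test functions.
  -- This is needed because Green's identity will be tested with a cutoff times another solution,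
  -- which is only C¹.
  intro φ hφ hc
  have hi1 : Integrable fun x => v x * φ x := integrable_mul_of_hasCompactSupport
    hv.continuous.locallyIntegrable hφ.continuous hc
  rw [integral_sub (integrable_gradDot hv hφ hc) (hi1.const_mul _), integral_const_mul]
  have hl : Tendsto (fun k => (∫ x, gradDot v (mollify k φ) x) -
      (κ : ℂ) ^ 2 * ∫ x, v x * mollify k φ x) atTop
      (𝓝 ((∫ x, gradDot v φ x) - (κ : ℂ) ^ 2 * ∫ x, v x * φ x)) := by
    refine Tendsto.sub ?_ ((tendsto_integral_mul_mollify hv.continuous.locallyIntegrable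
      hφ.continuous hc).const_mul _)
    rw [integral_gradDot hv hφ hc]
    have : ∀ k, ∫ x, gradDot v (mollify k φ) x =
        ∑ j, ∫ x, fderiv ℝ v x (EuclideanSpace.basisFun (Fin n) ℝ j) *
          mollify k (fun y => fderiv ℝ φ y (EuclideanSpace.basisFun (Fin n) ℝ j)) x := by
      intro k
      rw [integral_gradDot hv ((contDiff_mollify hφ.continuous k).of_le (by exact_mod_cast le_top))
        (hasCompactSupport_mollify hc k)]
      simp_rw [fderiv_mollify_apply hφ hc]
    simp_rw [this]
    refine tendsto_finsetSum _ fun j _ => ?_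
    exact tendsto_integral_mul_mollify (continuous_fderiv_apply_const hv _).locallyIntegrable
      (continuous_fderiv_apply_const hφ _) (hasCompactSupport_fderiv_apply hc _)
  have hr := tendsto_integral_mul_mollify hG hφ.continuous hc
  refine tendsto_nhds_unique hl (hr.congr fun k => ?_)
  exact (hsmooth _ (contDiff_mollify hφ.continuous k) (hasCompactSupport_mollify hc k)).symm

end WeakForm

/-! ### Radial cutoffs -/

/-- A smooth step: `1` on `(-∞, 1]`, `0` on `[2, ∞)`. -/
noncomputable def step (s : ℝ) : ℝ := Real.smoothTransition (2 - s)

theorem contDiff_step : ContDiff ℝ ∞ step :=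
  Real.smoothTransition.contDiff.comp (contDiff_const.sub contDiff_id)

theorem step_eq_one {s : ℝ} (hs : s ≤ 1) : step s = 1 :=
  Real.smoothTransition.one_of_one_le (by linarith)

theorem step_eq_zero {s : ℝ} (hs : 2 ≤ s) : step s = 0 :=
  Real.smoothTransition.zero_of_nonpos (by linarith)

theorem deriv_step_nonpos (s : ℝ) : deriv step s ≤ 0 := by
  have : Antitone step := fun a b hab => Real.smoothTransition.monotone (by linarith)
  exact this.deriv_nonpos

theorem continuous_deriv_step : Continuous (deriv step) :=
  contDiff_step.continuous_deriv (by exact_mod_cast le_top)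

theorem deriv_step_eq_zero_of_lt {s : ℝ} (hs : s < 1) : deriv step s = 0 := by
  have : step =ᶠ[𝓝 s] fun _ => 1 := by
    filter_upwards [Iio_mem_nhds hs] with x hx using step_eq_one (le_of_lt hx)
  rw [this.deriv_eq]
  simp

theorem deriv_step_eq_zero_of_gt {s : ℝ} (hs : 2 < s) : deriv step s = 0 := by
  have : step =ᶠ[𝓝 s] fun _ => 0 := by
    filter_upwards [Ioi_mem_nhds hs] with x hx using step_eq_zero (le_of_lt hx)
  rw [this.deriv_eq]
  simp

theorem exists_abs_deriv_step_le : ∃ C, 0 ≤ C ∧ ∀ s, |deriv step s| ≤ C := by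
  have hc : HasCompactSupport (deriv step) := by
    refine HasCompactSupport.of_support_subset_isCompact (isCompact_Icc (a := 1) (b := 2))
      fun s hs => ?_
    constructor
    · by_contra h
      exact hs (deriv_step_eq_zero_of_lt (not_le.1 h))
    · by_contra h
      exact hs (deriv_step_eq_zero_of_gt (not_le.1 h))
  obtain ⟨C, hC⟩ := continuous_deriv_step.bounded_above_of_compact_support hc
  exact ⟨C, (norm_nonneg _).trans (hC 0), fun s => hC s⟩

section Cutoff

variable {n : ℕ}

/-- A radial cutoff, equal to `1` for `‖x‖ ≤ R` and to `0` for `‖x‖ ≥ 2R`. -/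
noncomputable def cutoff (R : ℝ) (x : EuclideanSpace ℝ (Fin n)) : ℝ := step (‖x‖ ^ 2 / R ^ 2)

/-- The nonnegative weight `σ` with `∇ cutoff = -σ x`. -/
noncomputable def cutWeight (R : ℝ) (x : EuclideanSpace ℝ (Fin n)) : ℝ :=
  -(2 * deriv step (‖x‖ ^ 2 / R ^ 2) / R ^ 2)

theorem contDiff_cutoff (R : ℝ) : ContDiff ℝ ∞ (cutoff R : EuclideanSpace ℝ (Fin n) → ℝ) :=
  contDiff_step.comp ((contDiff_norm_sq ℝ).div_const _)

theorem hasFDerivAt_cutoff (R : ℝ) (x : EuclideanSpace ℝ (Fin n)) :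
    HasFDerivAt (cutoff R) (-(cutWeight R x) • innerSL ℝ x) x := by
  have h1 : HasFDerivAt (fun x : EuclideanSpace ℝ (Fin n) => ‖x‖ ^ 2 / R ^ 2)
      ((R ^ 2)⁻¹ • (2 • innerSL ℝ x)) x := by
    have := (hasStrictFDerivAt_norm_sq x).hasFDerivAt.const_mul ((R ^ 2)⁻¹)
    simpa only [div_eq_inv_mul] using this
  have h2 : HasDerivAt step (deriv step (‖x‖ ^ 2 / R ^ 2)) (‖x‖ ^ 2 / R ^ 2) :=
    (contDiff_step.differentiable (by simp) _).hasDerivAt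
  have h3 := h2.comp_hasFDerivAt x h1
  refine h3.congr_fderiv ?_
  ext y
  simp [cutWeight]
  ring

theorem cutoff_eq_one {R : ℝ} (hR : 0 < R) {x : EuclideanSpace ℝ (Fin n)} (hx : ‖x‖ ≤ R) :
    cutoff R x = 1 := by
  refine step_eq_one ?_
  rw [div_le_one (by positivity)]
  exact pow_le_pow_left₀ (norm_nonneg _) hx 2

theorem hasCompactSupport_cutoff {R : ℝ} (hR : 0 < R) :
    HasCompactSupport (cutoff R : EuclideanSpace ℝ (Fin n) → ℝ) := by
  refine HasCompactSupport.of_support_subset_isCompact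
    (isCompact_closedBall (0 : EuclideanSpace ℝ (Fin n)) (2 * R)) fun x hx => ?_
  rw [mem_closedBall_zero_iff]
  by_contra h
  refine hx (step_eq_zero ?_)
  rw [le_div_iff₀ (by positivity)]
  nlinarith [not_le.1 h]

theorem cutWeight_nonneg (R : ℝ) (x : EuclideanSpace ℝ (Fin n)) : 0 ≤ cutWeight R x := by
  have := deriv_step_nonpos (‖x‖ ^ 2 / R ^ 2)
  rw [cutWeight, ← neg_div, ← mul_neg]
  have h2 : 0 ≤ -deriv step (‖x‖ ^ 2 / R ^ 2) := by linarith
  positivity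

theorem continuous_cutWeight (R : ℝ) :
    Continuous (cutWeight R : EuclideanSpace ℝ (Fin n) → ℝ) := by
  have := continuous_deriv_step
  unfold cutWeight
  fun_prop

theorem le_norm_of_cutWeight_ne_zero {R : ℝ} (hR : 0 < R) {x : EuclideanSpace ℝ (Fin n)}
    (hx : cutWeight R x ≠ 0) : R ≤ ‖x‖ := by
  by_contra h
  apply hx
  rw [cutWeight, deriv_step_eq_zero_of_lt]
  · simp
  · rw [div_lt_one (by positivity)]
    exact pow_lt_pow_left₀ (not_le.1 h) (norm_nonneg _) two_ne_zero

theorem norm_le_of_cutWeight_ne_zero {R : ℝ} (hR : 0 < R) {x : EuclideanSpace ℝ (Fin n)}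
    (hx : cutWeight R x ≠ 0) : ‖x‖ ≤ 2 * R := by
  by_contra h
  apply hx
  rw [cutWeight, deriv_step_eq_zero_of_gt]
  · simp
  · rw [lt_div_iff₀ (by positivity)]
    nlinarith [not_le.1 h]

theorem hasCompactSupport_cutWeight {R : ℝ} (hR : 0 < R) :
    HasCompactSupport (cutWeight R : EuclideanSpace ℝ (Fin n) → ℝ) :=
  HasCompactSupport.of_support_subset_isCompact
    (isCompact_closedBall (0 : EuclideanSpace ℝ (Fin n)) (2 * R)) fun _ hx =>
      mem_closedBall_zero_iff.2 (norm_le_of_cutWeight_ne_zero hR hx)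

theorem integrable_cutWeight_mul {R : ℝ} (hR : 0 < R) {f : EuclideanSpace ℝ (Fin n) → ℝ}
    (hf : Continuous f) : Integrable fun x => cutWeight R x * f x :=
  ((continuous_cutWeight R).mul hf).integrable_of_hasCompactSupport
    (hasCompactSupport_cutWeight hR).mul_right

theorem integrable_ofReal_cutWeight_mul {R : ℝ} (hR : 0 < R) {f : EuclideanSpace ℝ (Fin n) → ℂ}
    (hf : Continuous f) : Integrable fun x => (cutWeight R x : ℂ) * f x := by
  refine ((Complex.continuous_ofReal.comp (continuous_cutWeight R)).mul
    hf).integrable_of_hasCompactSupport (HasCompactSupport.mul_right ?_)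
  exact (hasCompactSupport_cutWeight hR).comp_left (g := fun s : ℝ => (s : ℂ)) (by simp)

/-- The total mass of the weight grows at most like `R ^ (n - 2)`. -/
theorem exists_integral_cutWeight_le (n : ℕ) : ∃ K, 0 ≤ K ∧ ∀ R : ℝ, 0 < R →
    R ^ 2 * ∫ x : EuclideanSpace ℝ (Fin n), cutWeight R x ≤ K * R ^ n := by
  obtain ⟨C, hC0, hC⟩ := exists_abs_deriv_step_le
  set V := (volume (Metric.ball (0 : EuclideanSpace ℝ (Fin n)) 1)).toReal with hV
  refine ⟨2 * C * (2 ^ n * V), by positivity, fun R hR => ?_⟩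
  have hvol : (volume (Metric.closedBall (0 : EuclideanSpace ℝ (Fin n)) (2 * R))).toReal =
      (2 * R) ^ n * V := by
    rw [Measure.addHaar_closedBall _ _ (by positivity), ENNReal.toReal_mul,
      ENNReal.toReal_ofReal (by positivity)]
    simp [hV]
  -- The weight is at most 2C/R² and lives in the ball of radius 2R, whose volume is of order R^n.
  have hle : ∀ x : EuclideanSpace ℝ (Fin n), cutWeight R x ≤
      (Metric.closedBall (0 : EuclideanSpace ℝ (Fin n)) (2 * R)).indicator
        (fun _ => 2 * C / R ^ 2) x := by
    intro x
    by_cases h0 : cutWeight R x = 0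
    · rw [h0]
      exact Set.indicator_nonneg (fun _ _ => by positivity) _
    · rw [Set.indicator_of_mem (mem_closedBall_zero_iff.2 (norm_le_of_cutWeight_ne_zero hR h0)),
        cutWeight, ← neg_div]
      refine div_le_div_of_nonneg_right ?_ (by positivity)
      have := neg_abs_le (deriv step (‖x‖ ^ 2 / R ^ 2))
      linarith [hC (‖x‖ ^ 2 / R ^ 2)]
  have hint : Integrable ((Metric.closedBall (0 : EuclideanSpace ℝ (Fin n)) (2 * R)).indicator
        (fun _ => 2 * C / R ^ 2)) := by
    rw [integrable_indicator_iff Metric.isClosed_closedBall.measurableSet]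
    exact integrableOn_const (isCompact_closedBall _ _).measure_lt_top.ne
  have h1 := integral_mono (by simpa using integrable_cutWeight_mul hR (continuous_const (y := 1)))
    hint hle
  rw [integral_indicator Metric.isClosed_closedBall.measurableSet, setIntegral_const,
    measureReal_def, hvol, smul_eq_mul] at h1
  calc R ^ 2 * ∫ x : EuclideanSpace ℝ (Fin n), cutWeight R x
      ≤ R ^ 2 * ((2 * R) ^ n * V * (2 * C / R ^ 2)) :=
        mul_le_mul_of_nonneg_left h1 (by positivity)
    _ = _ := by
      rw [mul_pow]
      field_simp

end Cutoff

/-! ### Green's identities, energy bound and reciprocity -/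

section Reciprocity

variable {n : ℕ} {κ : ℝ} {v h G Gv Gh : EuclideanSpace ℝ (Fin n) → ℂ}

theorem sum_coord_mul_fderiv (x : EuclideanSpace ℝ (Fin n)) :
    ∑ j, fderiv ℝ v x (EuclideanSpace.basisFun (Fin n) ℝ j) *
      ((inner ℝ x (EuclideanSpace.basisFun (Fin n) ℝ j) : ℝ) : ℂ) = fderiv ℝ v x x := by
  generalize fderiv ℝ v x = L
  conv_rhs => rw [← (EuclideanSpace.basisFun (Fin n) ℝ).sum_repr' x]
  rw [map_sum]
  refine Finset.sum_congr rfl fun j _ => ?_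
  rw [map_smul, real_inner_comm, Complex.real_smul]
  ring

theorem gradDot_cutoff_mul (hh : ContDiff ℝ 1 h) (R : ℝ) (x : EuclideanSpace ℝ (Fin n)) :
    gradDot v (fun y => (cutoff R y : ℝ) • h y) x =
      (cutoff R x : ℂ) * gradDot v h x - (cutWeight R x : ℂ) * (h x * fderiv ℝ v x x) := by
  have hd : fderiv ℝ (fun y => cutoff R y • h y) x = cutoff R x • fderiv ℝ h x +
      (-cutWeight R x • (innerSL ℝ) x).smulRight (h x) := ((hasFDerivAt_cutoff R x).smul (hh.differentiable one_ne_zero x).hasFDerivAt).fderiv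
  rw [gradDot, gradDot, ← sum_coord_mul_fderiv x, Finset.mul_sum, Finset.mul_sum, Finset.mul_sum,
    ← Finset.sum_sub_distrib]
  refine Finset.sum_congr rfl fun j _ => ?_
  rw [hd]
  simp only [add_apply, smul_apply,
    ContinuousLinearMap.smulRight_apply, innerSL_apply_apply, Complex.real_smul, smul_eq_mul]
  push_cast
  ring

theorem gradDot_comm (x : EuclideanSpace ℝ (Fin n)) : gradDot v h x = gradDot h v x :=
  Finset.sum_congr rfl fun _ _ => mul_comm _ _

theorem continuous_fderiv_self (hv : ContDiff ℝ 1 v) : Continuous fun x => fderiv ℝ v x x :=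
  (hv.continuous_fderiv one_ne_zero).clm_apply continuous_id

/-- The test function is the cutoff times h. The source sees only the region where the cutoff is 1,
and the gradient of the cutoff produces a shell average in place of a surface integral over a
sphere. -/
theorem WeakHelmholtz.integral_cutoff (hw : WeakHelmholtz κ G v) (hh : ContDiff ℝ 1 h)
    {R₀ R : ℝ} (hG : ∀ x, R₀ < ‖x‖ → G x = 0) (hR : 0 < R) (hRR : R₀ ≤ R) :
    ∫ x, ((cutoff R x : ℂ) * (gradDot v h x - (κ : ℂ) ^ 2 * (v x * h x)) -
      (cutWeight R x : ℂ) * (h x * fderiv ℝ v x x)) = ∫ x, G x * h x := by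
  have h1 := hw (fun y => (cutoff R y : ℝ) • h y)
    (((contDiff_cutoff R).of_le (by exact_mod_cast le_top)).smul hh)
    ((hasCompactSupport_cutoff hR).smul_right)
  have h2 : ∫ x, G x * (cutoff R x • h x) = ∫ x, G x * h x := by
    congr 1; funext x
    by_cases hx : ‖x‖ ≤ R
    · rw [cutoff_eq_one hR hx, one_smul]
    · rw [hG x (by linarith [not_le.1 hx])]
      simp
  rw [← h2, ← h1]
  congr 1; funext x
  rw [gradDot_cutoff_mul hh, Complex.real_smul]
  ring

/-- Green's second identity with a radial cutoff. -/
theorem WeakHelmholtz.integral_cutWeight (hwv : WeakHelmholtz κ Gv v) (hwh : WeakHelmholtz κ Gh h)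
    (hv : ContDiff ℝ 1 v) (hh : ContDiff ℝ 1 h)
    {R₀ R : ℝ} (hGv : ∀ x, R₀ < ‖x‖ → Gv x = 0) (hGh : ∀ x, R₀ < ‖x‖ → Gh x = 0)
    (hR : 0 < R) (hRR : R₀ ≤ R) :
    ∫ x, (cutWeight R x : ℂ) * (h x * fderiv ℝ v x x - v x * fderiv ℝ h x x) =
      (∫ x, Gh x * v x) - ∫ x, Gv x * h x := by
  have e1 := hwv.integral_cutoff hh hGv hR hRR
  have e2 := hwh.integral_cutoff hv hGh hR hRR
  have hint : ∀ {v h : EuclideanSpace ℝ (Fin n) → ℂ}, ContDiff ℝ 1 v → ContDiff ℝ 1 h →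
      Integrable fun x => ((cutoff R x : ℂ) * (gradDot v h x - (κ : ℂ) ^ 2 * (v x * h x)) -
      (cutWeight R x : ℂ) * (h x * fderiv ℝ v x x)) := by
    intro v h hv hh
    refine Integrable.sub ?_ (integrable_ofReal_cutWeight_mul hR
      (hh.continuous.mul (continuous_fderiv_self hv)))
    have hc1 : Continuous fun x : EuclideanSpace ℝ (Fin n) => (cutoff R x : ℂ) :=
      Complex.continuous_ofReal.comp (contDiff_cutoff R).continuous
    have hc2 := continuous_gradDot hv hh
    have hv0 := hv.continuous
    have hh0 := hh.continuous
    refine Continuous.integrable_of_hasCompactSupport (by fun_prop)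
      (HasCompactSupport.mul_right ?_)
    exact (hasCompactSupport_cutoff hR).comp_left (g := fun s : ℝ => (s : ℂ)) (by simp)
  rw [← e1, ← e2, ← integral_sub (hint hh hv) (hint hv hh)]
  congr 1; funext x
  rw [gradDot_comm (v := h)]
  ring

open ComplexConjugate in
theorem fderiv_conj_apply (hv : ContDiff ℝ 1 v) (x e : EuclideanSpace ℝ (Fin n)) :
    fderiv ℝ (fun y => conj (v y)) x e = conj (fderiv ℝ v x e) := by
  have := (Complex.conjCLE.hasFDerivAt.comp x
    (hv.differentiable one_ne_zero x).hasFDerivAt).fderiv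
  have h2 : (fun y => conj (v y)) = (⇑Complex.conjCLE ∘ v) := by
    funext y; simp
  rw [h2, this]
  simp

theorem contDiff_conj (hv : ContDiff ℝ 1 v) : ContDiff ℝ 1 fun y => starRingEnd ℂ (v y) :=
  Complex.conjCLE.contDiff.comp hv

open ComplexConjugate in
theorem WeakHelmholtz.conj (hw : WeakHelmholtz κ G v) (hv : ContDiff ℝ 1 v) :
    WeakHelmholtz κ (fun x => conj (G x)) fun x => conj (v x) := by
  intro φ hφ hc
  have h1 := hw (fun x => conj (φ x)) (contDiff_conj hφ) (hc.comp_left (g := conj) (by simp))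
  calc ∫ x, (gradDot (fun x => conj (v x)) φ x - (κ : ℂ) ^ 2 * (conj (v x) * φ x))
      = ∫ x, conj (gradDot v (fun x => conj (φ x)) x - (κ : ℂ) ^ 2 * (v x * conj (φ x))) := by
        congr 1; funext x
        simp only [gradDot, fderiv_conj_apply hv, fderiv_conj_apply hφ, map_sub, map_mul, map_sum,
          Complex.conj_conj, map_pow, Complex.conj_ofReal]
    _ = conj (∫ x, (gradDot v (fun x => conj (φ x)) x - (κ : ℂ) ^ 2 * (v x * conj (φ x)))) :=
        integral_conj
    _ = conj (∫ x, G x * conj (φ x)) := by rw [h1]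
    _ = ∫ x, conj (G x * conj (φ x)) := integral_conj.symm
    _ = _ := by
        congr 1; funext x
        simp

/-- `‖x‖` times the radiation defect `∂_r v - iκ v`. -/
noncomputable def defect (κ : ℝ) (v : EuclideanSpace ℝ (Fin n) → ℂ)
    (x : EuclideanSpace ℝ (Fin n)) : ℂ :=
  fderiv ℝ v x x - Complex.I * κ * ‖x‖ * v x

theorem continuous_defect (hv : ContDiff ℝ 1 v) : Continuous (defect κ v) := by
  have h1 := continuous_fderiv_self hv
  have h2 := hv.continuous
  unfold defect
  fun_prop

/-- Sommerfeld's radiation condition. -/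
def Radiating (κ : ℝ) (v : EuclideanSpace ℝ (Fin n) → ℂ) : Prop :=
  Tendsto
    (fun x : EuclideanSpace ℝ (Fin n) => ((‖x‖ ^ (((n : ℝ) - 1) / 2) : ℝ) : ℂ) *
      (fderiv ℝ v x (‖x‖⁻¹ • x) - Complex.I * (κ : ℂ) * v x))
    (cocompact (EuclideanSpace ℝ (Fin n))) (𝓝 0)

/-- The square of the radiation condition: `defect` carries a factor ‖x‖, which turns the exponent n
- 1 into n - 3. -/
theorem Radiating.eventually_defect (hr : Radiating κ v) (hn : 3 ≤ n) {ε : ℝ} (hε : 0 < ε) :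
    ∃ R₁, 1 ≤ R₁ ∧ ∀ x, R₁ ≤ ‖x‖ → ‖defect κ v x‖ ^ 2 * ‖x‖ ^ (n - 3) ≤ ε := by
  have h1 := (Metric.tendsto_nhds.1 hr) (√ε) (Real.sqrt_pos.2 hε)
  rw [← Metric.cobounded_eq_cocompact, ← comap_norm_atTop, eventually_comap] at h1
  obtain ⟨R, hR⟩ := eventually_atTop.1 h1
  refine ⟨max R 1, le_max_right _ _, fun x hx => ?_⟩
  have hx1 : 1 ≤ ‖x‖ := (le_max_right _ _).trans hx
  have hx0 : 0 < ‖x‖ := by linarith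
  have h2 := hR ‖x‖ ((le_max_left _ _).trans hx) x rfl
  rw [dist_zero_right, norm_mul, Complex.norm_real, Real.norm_of_nonneg (by positivity)] at h2
  set q := fderiv ℝ v x (‖x‖⁻¹ • x) - Complex.I * (κ : ℂ) * v x with hq
  have hd : defect κ v x = ‖x‖ * q := by
    rw [hq, map_smul, Complex.real_smul, defect]
    push_cast
    have : (‖x‖ : ℂ) ≠ 0 := by exact_mod_cast hx0.ne'
    field_simp
  have hp : (‖x‖ ^ (((n : ℝ) - 1) / 2)) ^ 2 = ‖x‖ ^ 2 * ‖x‖ ^ (n - 3) := by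
    rw [← pow_add, ← Real.rpow_natCast, ← Real.rpow_mul hx0.le, ← Real.rpow_natCast]
    congr 1
    rw [show 2 + (n - 3) = n - 1 by omega]
    push_cast [show 1 ≤ n by omega]
    ring
  have h3 : (‖x‖ ^ (((n : ℝ) - 1) / 2) * ‖q‖) ^ 2 ≤ (√ε) ^ 2 :=
    pow_le_pow_left₀ (by positivity) h2.le 2
  rw [Real.sq_sqrt hε.le, mul_pow, hp] at h3
  rw [hd, norm_mul, Complex.norm_real, norm_norm, mul_pow]
  linarith

/-- The shell weight has mass O(R^{n-2}) and the squared defect is o(R^{3-n}) there, so the integral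
is o(R). -/
theorem Radiating.eventually_integral_defect (hr : Radiating κ v) (hv : ContDiff ℝ 1 v)
    (hn : 3 ≤ n) {ε : ℝ} (hε : 0 < ε) :
    ∃ R₁, 1 ≤ R₁ ∧ ∀ R, R₁ ≤ R → ∫ x, cutWeight R x * ‖defect κ v x‖ ^ 2 ≤ ε * R := by
  obtain ⟨K, hK0, hK⟩ := exists_integral_cutWeight_le n
  obtain ⟨R₁, hR1, h1⟩ := hr.eventually_defect hn (ε := ε / (K + 1)) (by positivity)
  refine ⟨R₁, hR1, fun R hR => ?_⟩
  have hR0 : 0 < R := by linarith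
  have hle : ∀ x, cutWeight R x * ‖defect κ v x‖ ^ 2 ≤
      cutWeight R x * (ε / (K + 1) / R ^ (n - 3)) := by
    intro x
    by_cases h0 : cutWeight R x = 0
    · simp [h0]
    refine mul_le_mul_of_nonneg_left ?_ (cutWeight_nonneg _ _)
    have hRx := le_norm_of_cutWeight_ne_zero hR0 h0
    rw [le_div_iff₀ (by positivity)]
    refine le_trans (mul_le_mul_of_nonneg_left ?_ (by positivity)) (h1 x (hR.trans hRx))
    exact pow_le_pow_left₀ hR0.le hRx _
  have hdc := continuous_defect (κ := κ) hv
  have h2 := integral_mono (integrable_cutWeight_mul hR0 (by fun_prop))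
    (integrable_cutWeight_mul hR0 continuous_const) hle
  rw [integral_mul_const] at h2
  refine h2.trans ?_
  have h3 := hK R hR0
  have hpow : R ^ n = R ^ 2 * (R * R ^ (n - 3)) := by
    rw [← pow_succ', ← pow_add]
    congr 1
    omega
  rw [hpow, mul_left_comm] at h3
  have h4 := le_of_mul_le_mul_left h3 (by positivity)
  calc (∫ x : EuclideanSpace ℝ (Fin n), cutWeight R x) * (ε / (K + 1) / R ^ (n - 3))
      ≤ (K * (R * R ^ (n - 3))) * (ε / (K + 1) / R ^ (n - 3)) :=
        mul_le_mul_of_nonneg_right h4 (by positivity)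
    _ = (K / (K + 1)) * (ε * R) := by field_simp
    _ ≤ 1 * (ε * R) := by
        refine mul_le_mul_of_nonneg_right ?_ (by positivity)
        rw [div_le_one (by positivity)]
        linarith
    _ = _ := one_mul _

open ComplexConjugate in
/-- The energy of a radiating solution in the dyadic shells stays bounded. -/
theorem WeakHelmholtz.exists_energy_le (hw : WeakHelmholtz κ G v) (hv : ContDiff ℝ 1 v)
    (hr : Radiating κ v) (hn : 3 ≤ n) (hκ : 0 < κ) {R₀ : ℝ}
    (hG : ∀ x, R₀ < ‖x‖ → G x = 0) :
    ∃ A R₁, 0 ≤ A ∧ ∀ R, R₁ ≤ R → ∫ x, cutWeight R x * (‖x‖ * ‖v x‖ ^ 2) ≤ A := by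
  obtain ⟨R₁, hR1, h1⟩ := hr.eventually_integral_defect hv hn one_pos
  set N := ∫ x, ‖G x‖ * ‖v x‖ with hN
  have hN0 : 0 ≤ N := integral_nonneg fun x => by positivity
  refine ⟨(1 + 2 * κ * N) / κ ^ 2, max R₀ R₁, by positivity, fun R hR => ?_⟩
  have hRR0 := (le_max_left _ _).trans hR
  have hRR1 := (le_max_right _ _).trans hR
  have hR0 : 0 < R := by linarith
  have hfc := continuous_fderiv_self hv
  have hvc := hv.continuous
  have hdc := continuous_defect (κ := κ) hv
  -- Green's identity for v and its conjugate: the energy flux through the shell is controlled by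
  -- the source alone, independently of R.
  have hIm : |∫ x, cutWeight R x * (fderiv ℝ v x x * conj (v x)).im| ≤ N := by
    have e := hw.integral_cutWeight (hw.conj hv) hv (contDiff_conj hv) hG
      (fun x hx => by simp [hG x hx]) hR0 hRR0
    have e2 : ∀ x, (cutWeight R x : ℂ) * (conj (v x) * fderiv ℝ v x x -
        v x * fderiv ℝ (fun y => conj (v y)) x x) =
        (2 * Complex.I) * ((cutWeight R x * (fderiv ℝ v x x * conj (v x)).im : ℝ) : ℂ) := by
      intro x
      rw [fderiv_conj_apply hv]
      have h3 := Complex.sub_conj (fderiv ℝ v x x * conj (v x))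
      rw [map_mul, Complex.conj_conj] at h3
      push_cast at h3 ⊢
      linear_combination (cutWeight R x : ℂ) * h3
    simp_rw [e2] at e
    rw [integral_const_mul, integral_complex_ofReal] at e
    have e3 := congrArg norm e
    rw [norm_mul, Complex.norm_real, Real.norm_eq_abs] at e3
    have hn2 : ‖(2 * Complex.I : ℂ)‖ = 2 := by simp
    rw [hn2] at e3
    have e4 : ‖∫ x, conj (G x) * v x‖ ≤ N := by
      refine (norm_integral_le_integral_norm _).trans_eq ?_
      simp [hN]
    have e5 : ‖∫ x, G x * conj (v x)‖ ≤ N := by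
      refine (norm_integral_le_integral_norm _).trans_eq ?_
      simp [hN]
    have e6 := norm_sub_le (∫ x, conj (G x) * v x) (∫ x, G x * conj (v x))
    linarith
  have hpt : ∀ x, κ ^ 2 * (cutWeight R x * (‖x‖ * ‖v x‖ ^ 2)) ≤
      R⁻¹ * (cutWeight R x * ‖defect κ v x‖ ^ 2) +
        2 * κ * (cutWeight R x * (fderiv ℝ v x x * conj (v x)).im) := by
    intro x
    by_cases h0 : cutWeight R x = 0
    · simp [h0]
    have hRx := le_norm_of_cutWeight_ne_zero hR0 h0
    have hx0 : 0 < ‖x‖ := by linarith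
    have hσ := cutWeight_nonneg R x
    have hid : ‖defect κ v x‖ ^ 2 = ‖fderiv ℝ v x x‖ ^ 2 + κ ^ 2 * ‖x‖ ^ 2 * ‖v x‖ ^ 2 -
        2 * κ * ‖x‖ * (fderiv ℝ v x x * conj (v x)).im := by
      rw [defect, ← Complex.normSq_eq_norm_sq, ← Complex.normSq_eq_norm_sq,
        ← Complex.normSq_eq_norm_sq]
      simp only [Complex.normSq_apply, Complex.sub_re, Complex.sub_im, Complex.mul_re,
        Complex.mul_im, Complex.I_re, Complex.I_im, Complex.ofReal_re, Complex.ofReal_im,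
        Complex.conj_re, Complex.conj_im]
      ring
    -- In the expanded square of the defect the cross term is the flux; dropping the nonnegative
    -- radial derivative term bounds |v|² by defect and flux.
    have hb : κ ^ 2 * (‖x‖ * ‖v x‖ ^ 2) ≤ ‖x‖⁻¹ * ‖defect κ v x‖ ^ 2 +
        2 * κ * (fderiv ℝ v x x * conj (v x)).im := by
      have h4 : ‖x‖⁻¹ * ‖defect κ v x‖ ^ 2 = ‖x‖⁻¹ * ‖fderiv ℝ v x x‖ ^ 2 +
          κ ^ 2 * (‖x‖ * ‖v x‖ ^ 2) - 2 * κ * (fderiv ℝ v x x * conj (v x)).im := by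
        rw [hid]
        field_simp
      rw [h4]
      have : 0 ≤ ‖x‖⁻¹ * ‖fderiv ℝ v x x‖ ^ 2 := by positivity
      linarith
    have hinv : ‖x‖⁻¹ ≤ R⁻¹ := inv_anti₀ hR0 hRx
    have hb2 := mul_le_mul_of_nonneg_right hinv (sq_nonneg ‖defect κ v x‖)
    nlinarith [mul_le_mul_of_nonneg_left (hb.trans (add_le_add_left hb2 _)) hσ]
  have hi1 := integrable_cutWeight_mul hR0 (f := fun x => ‖x‖ * ‖v x‖ ^ 2) (by fun_prop)
  have hi2 := integrable_cutWeight_mul hR0 (f := fun x => ‖defect κ v x‖ ^ 2) (by fun_prop)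
  have hi3 := integrable_cutWeight_mul hR0 (f := fun x => (fderiv ℝ v x x * conj (v x)).im)
    (Complex.continuous_im.comp (hfc.mul (Complex.continuous_conj.comp hvc)))
  have hI := integral_mono (hi1.const_mul (κ ^ 2))
    ((hi2.const_mul R⁻¹).add (hi3.const_mul (2 * κ))) hpt
  simp only [Pi.add_apply] at hI
  rw [integral_const_mul, integral_add (hi2.const_mul R⁻¹) (hi3.const_mul (2 * κ)),
    integral_const_mul, integral_const_mul] at hI
  rw [le_div_iff₀ (by positivity), mul_comm]
  refine hI.trans (add_le_add ?_ ?_)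
  · have := mul_le_mul_of_nonneg_left (h1 R hRR1) (inv_nonneg.2 hR0.le)
    rwa [one_mul, inv_mul_cancel₀ hR0.ne'] at this
  · exact mul_le_mul_of_nonneg_left ((le_abs_self _).trans hIm) (by positivity)

/-- Reciprocity for radiating solutions. -/
theorem WeakHelmholtz.reciprocity (hwv : WeakHelmholtz κ Gv v) (hwh : WeakHelmholtz κ Gh h)
    (hv : ContDiff ℝ 1 v) (hh : ContDiff ℝ 1 h) (hrv : Radiating κ v) (hrh : Radiating κ h)
    (hn : 3 ≤ n) (hκ : 0 < κ) {R₀ : ℝ} (hGv : ∀ x, R₀ < ‖x‖ → Gv x = 0)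
    (hGh : ∀ x, R₀ < ‖x‖ → Gh x = 0) :
    ∫ x, Gh x * v x = ∫ x, Gv x * h x := by
  obtain ⟨A, RA, hA0, hA⟩ := hwv.exists_energy_le hv hrv hn hκ hGv
  obtain ⟨B, RB, hB0, hB⟩ := hwh.exists_energy_le hh hrh hn hκ hGh
  rw [← sub_eq_zero, ← norm_le_zero_iff]
  refine le_of_forall_pos_le_add fun ε hε => ?_
  -- The energies will contribute δ(A + B) and the two defects δ/4 each, in total at most δ(A + B +
  -- 1) = ε.
  set δ := ε / (A + B + 1) with hδ
  have hδ0 : 0 < δ := by positivity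
  obtain ⟨RC, hRC, hC⟩ := hrv.eventually_integral_defect hv hn (ε := δ ^ 2) (by positivity)
  obtain ⟨RD, hRD, hD⟩ := hrh.eventually_integral_defect hh hn (ε := δ ^ 2) (by positivity)
  set R := max (max (max R₀ RA) (max RB RC)) RD
  have hR1 : R₀ ≤ R := (le_max_left _ _).trans ((le_max_left _ _).trans (le_max_left _ _))
  have hR2 : RA ≤ R := (le_max_right _ _).trans ((le_max_left _ _).trans (le_max_left _ _))
  have hR3 : RB ≤ R := (le_max_left _ _).trans ((le_max_right _ _).trans (le_max_left _ _))
  have hR4 : RC ≤ R := (le_max_right _ _).trans ((le_max_right _ _).trans (le_max_left _ _))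
  have hR5 : RD ≤ R := le_max_right _ _
  have hR0 : 0 < R := by linarith
  have hvc := hv.continuous
  have hhc := hh.continuous
  have hdv := continuous_defect (κ := κ) hv
  have hdh := continuous_defect (κ := κ) hh
  rw [← hwv.integral_cutWeight hwh hv hh hGv hGh hR0 hR1]
  -- Young's inequality, with R distributed so that the energy term is bounded in R and the defect
  -- integral, at most δ²R, contributes δ/4.
  have hyoung : ∀ x : EuclideanSpace ℝ (Fin n), cutWeight R x ≠ 0 → ∀ a b : ℝ, a * b ≤
      δ * (‖x‖ * a ^ 2) + (4 * δ * R)⁻¹ * b ^ 2 := by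
    intro x hx a b
    have hRx := le_norm_of_cutWeight_ne_zero hR0 hx
    have h1 : δ * (R * a ^ 2) ≤ δ * (‖x‖ * a ^ 2) := by gcongr
    have h2 : a * b ≤ δ * (R * a ^ 2) + (4 * δ * R)⁻¹ * b ^ 2 := by
      have h3 : δ * (R * a ^ 2) + (4 * δ * R)⁻¹ * b ^ 2 - a * b =
          (4 * δ * R)⁻¹ * (2 * δ * R * a - b) ^ 2 := by
        field_simp
        ring
      have h4 : 0 ≤ (4 * δ * R)⁻¹ * (2 * δ * R * a - b) ^ 2 := by positivity
      linarith
    linarith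
  have hpt : ∀ x, ‖(cutWeight R x : ℂ) * (h x * fderiv ℝ v x x - v x * fderiv ℝ h x x)‖ ≤
      (δ * (cutWeight R x * (‖x‖ * ‖h x‖ ^ 2)) +
        (4 * δ * R)⁻¹ * (cutWeight R x * ‖defect κ v x‖ ^ 2)) +
      (δ * (cutWeight R x * (‖x‖ * ‖v x‖ ^ 2)) +
        (4 * δ * R)⁻¹ * (cutWeight R x * ‖defect κ h x‖ ^ 2)) := by
    intro x
    by_cases h0 : cutWeight R x = 0
    · simp [h0]
    have hσ := cutWeight_nonneg R x
    -- The terms iκ‖x‖vh cancel because both functions satisfy the radiation condition with the same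
    -- sign.
    have e : h x * fderiv ℝ v x x - v x * fderiv ℝ h x x =
        h x * defect κ v x - v x * defect κ h x := by
      simp only [defect]
      ring
    rw [e, norm_mul, Complex.norm_real, Real.norm_of_nonneg hσ]
    have h1 := hyoung x h0 ‖h x‖ ‖defect κ v x‖
    have h2 := hyoung x h0 ‖v x‖ ‖defect κ h x‖
    have h3 : ‖h x * defect κ v x - v x * defect κ h x‖ ≤
        ‖h x‖ * ‖defect κ v x‖ + ‖v x‖ * ‖defect κ h x‖ := by
      refine (norm_sub_le _ _).trans_eq ?_
      rw [norm_mul, norm_mul]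
    have h4 := mul_le_mul_of_nonneg_left (h3.trans (add_le_add h1 h2)) hσ
    refine h4.trans_eq ?_
    ring
  have hi1 := integrable_cutWeight_mul hR0 (f := fun x => ‖x‖ * ‖h x‖ ^ 2) (by fun_prop)
  have hi2 := integrable_cutWeight_mul hR0 (f := fun x => ‖defect κ v x‖ ^ 2) (by fun_prop)
  have hi3 := integrable_cutWeight_mul hR0 (f := fun x => ‖x‖ * ‖v x‖ ^ 2) (by fun_prop)
  have hi4 := integrable_cutWeight_mul hR0 (f := fun x => ‖defect κ h x‖ ^ 2) (by fun_prop)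
  have hj1 := (hi1.const_mul δ).add (hi2.const_mul (4 * δ * R)⁻¹)
  have hj2 := (hi3.const_mul δ).add (hi4.const_mul (4 * δ * R)⁻¹)
  have hI := norm_integral_le_of_norm_le (hj1.add hj2) (Eventually.of_forall hpt)
  refine hI.trans ?_
  rw [integral_add' hj1 hj2, integral_add' (hi1.const_mul δ) (hi2.const_mul _),
    integral_add' (hi3.const_mul δ) (hi4.const_mul _)]
  simp only [integral_const_mul]
  have b1 := mul_le_mul_of_nonneg_left (hB R hR3) hδ0.le
  have b3 := mul_le_mul_of_nonneg_left (hA R hR2) hδ0.le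
  have hc0 : 0 ≤ (4 * δ * R)⁻¹ := by positivity
  have b2 := mul_le_mul_of_nonneg_left (hC R hR4) hc0
  have b4 := mul_le_mul_of_nonneg_left (hD R hR5) hc0
  have hcalc : (4 * δ * R)⁻¹ * (δ ^ 2 * R) = δ / 4 := by field_simp
  rw [hcalc] at b2 b4
  have hfin : δ * (A + B + 1) = ε := by
    rw [hδ]
    field_simp
  nlinarith

end Reciprocity

/-! ### Uniqueness by testing against potentials of cubes -/

namespace BoxProfile

variable {n : ℕ} (D : BoxProfile n)

theorem integrable_indicator_weight : Integrable (D.box.indicator D.weight) :=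
  (integrable_indicator_iff D.measurableSet_box).2 (D.integrableOn_box D.continuous_weight)

theorem integral_indicator_weight_mul (φ : EuclideanSpace ℝ (Fin n) → ℂ) :
    ∫ x, D.box.indicator D.weight x * φ x = ∫ x in D.box, D.weight x * φ x := by
  rw [← integral_indicator D.measurableSet_box]
  congr 1; funext x
  rw [Set.indicator_mul_left]

theorem weakHelmholtz_pot (hn : 3 ≤ n) (κ : ℝ) :
    WeakHelmholtz κ (D.box.indicator D.weight) (D.pot κ) :=
  weakHelmholtz_of_distributional (D.contDiff_pot hn κ)
    D.integrable_indicator_weight.locallyIntegrable fun φ hφ hc => by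
      rw [D.integral_pot_mul_helmholtz hn κ φ hφ hc, D.integral_indicator_weight_mul]

/-- The cube with centre `c` and half side `ε`, with density `1`. -/
noncomputable def cube (c : EuclideanSpace ℝ (Fin n)) {ε : ℝ} (hε : 0 < ε) : BoxProfile n where
  g := fun _ _ => 1
  p := fun j => c j - ε
  r := fun j => c j + ε
  contDiff := fun _ => contDiff_const
  le := fun _ => by linarith

theorem weight_cube (c : EuclideanSpace ℝ (Fin n)) {ε : ℝ} (hε : 0 < ε)
    (y : EuclideanSpace ℝ (Fin n)) : (cube c hε).weight y = 1 := by
  simp [weight, cube]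

theorem ball_subset_cube (c : EuclideanSpace ℝ (Fin n)) {ε : ℝ} (hε : 0 < ε) :
    Metric.ball c ε ⊆ (cube c hε).box := by
  intro y hy j
  have h1 : ‖(y - c) j‖ ≤ ‖y - c‖ := PiLp.norm_apply_le _ _
  rw [Metric.mem_ball, dist_eq_norm] at hy
  have h2 : |y j - c j| < ε := by
    simpa using h1.trans_lt hy
  rw [abs_lt] at h2
  exact ⟨by simp only [cube]; linarith, by simp only [cube]; linarith⟩

theorem dist_le_of_mem_cube {c y : EuclideanSpace ℝ (Fin n)} {ε : ℝ} (hε : 0 < ε)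
    (hy : y ∈ (cube c hε).box) : dist y c ≤ n * ε := by
  rw [dist_eq_norm]
  conv_lhs => rw [← (EuclideanSpace.basisFun (Fin n) ℝ).sum_repr (y - c)]
  refine (norm_sum_le _ _).trans ?_
  have : ∀ j ∈ (Finset.univ : Finset (Fin n)),
      ‖(EuclideanSpace.basisFun (Fin n) ℝ).repr (y - c) j •
        EuclideanSpace.basisFun (Fin n) ℝ j‖ ≤ ε := by
    intro j _
    have h1 := hy j
    simp only [cube, Set.mem_Ioc] at h1
    rw [norm_smul, OrthonormalBasis.norm_eq_one, mul_one, EuclideanSpace.basisFun_repr,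
      Real.norm_eq_abs, PiLp.sub_apply, abs_le]
    constructor <;> linarith
  refine (Finset.sum_le_sum this).trans_eq ?_
  simp

end BoxProfile

section Uniqueness

variable {n : ℕ}

/-- A continuous function whose integrals over all small cubes vanish is zero. -/
theorem eq_zero_of_integral_cube {f : EuclideanSpace ℝ (Fin n) → ℂ} (hf : Continuous f)
    (h : ∀ (c : EuclideanSpace ℝ (Fin n)) (ε : ℝ) (hε : 0 < ε),
      ∫ y in (BoxProfile.cube c hε).box, f y = 0) (c : EuclideanSpace ℝ (Fin n)) : f c = 0 := by
  by_contra hne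
  have hpos : 0 < ‖f c‖ / 2 := by positivity
  obtain ⟨δ, hδ0, hδ⟩ := Metric.continuous_iff.1 hf c (‖f c‖ / 2) hpos
  -- The cube of half side ε lies within distance nε < δ of its centre.
  set ε := δ / (n + 1) with hεdef
  have hε : 0 < ε := by positivity
  set D := BoxProfile.cube c hε with hD
  have hvol : 0 < (volume D.box).toReal := by
    refine ENNReal.toReal_pos ?_ D.volume_box_lt_top.ne
    exact ((Metric.measure_ball_pos volume c hε).trans_le
      (measure_mono (BoxProfile.ball_subset_cube c hε))).ne'
  have h1 : ‖∫ y in D.box, (f y - f c)‖ ≤ ‖f c‖ / 2 * (volume D.box).toReal := by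
    refine norm_setIntegral_le_of_norm_le_const D.volume_box_lt_top fun y hy => ?_
    have h2 := BoxProfile.dist_le_of_mem_cube hε hy
    have h3 : (n : ℝ) * ε < δ := by
      rw [hεdef, mul_div_assoc', div_lt_iff₀ (by positivity)]
      nlinarith
    rw [← dist_eq_norm]
    exact (hδ y (h2.trans_lt h3)).le
  rw [integral_sub (D.integrableOn_box hf) (D.integrableOn_box continuous_const), h c ε hε,
    zero_sub, norm_neg, setIntegral_const, norm_smul, measureReal_def, Real.norm_eq_abs,
    abs_of_pos hvol] at h1
  have : 0 < ‖f c‖ := by positivity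
  nlinarith

/-- A radiating weak solution with the density of a box profile is the potential of the profile. -/
theorem BoxProfile.eq_pot (D : BoxProfile n) (hn : 3 ≤ n) {κ : ℝ} (hκ : 0 < κ)
    {u : EuclideanSpace ℝ (Fin n) → ℂ} (hu : ContDiff ℝ 1 u)
    (hw : WeakHelmholtz κ (D.box.indicator D.weight) u) (hr : Radiating κ u)
    (x : EuclideanSpace ℝ (Fin n)) : u x = D.pot κ x := by
  rw [← sub_eq_zero]
  have hp := D.contDiff_pot hn κ
  refine eq_zero_of_integral_cube (f := fun x => u x - D.pot κ x)
    (hu.continuous.sub hp.continuous) (fun c ε hε => ?_) x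
  -- Reciprocity with the potential of this cube is applied both to u and to the constructed
  -- potential. They have the same source, so their integrals over the cube agree.
  set C := cube c hε
  obtain ⟨K, hK0, hK⟩ := D.exists_norm_le
  obtain ⟨L, hL0, hL⟩ := C.exists_norm_le
  have hsD : ∀ y, max K L < ‖y‖ → D.box.indicator D.weight y = 0 := fun y hy =>
    Set.indicator_of_notMem (fun h => absurd (hK y h) (not_le.2 ((le_max_left _ _).trans_lt hy))) _
  have hsC : ∀ y, max K L < ‖y‖ → C.box.indicator C.weight y = 0 := fun y hy =>
    Set.indicator_of_notMem (fun h => absurd (hL y h) (not_le.2 ((le_max_right _ _).trans_lt hy))) _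
  have h1 := hw.reciprocity (C.weakHelmholtz_pot hn κ) hu (C.contDiff_pot hn κ) hr
    (C.tendsto_radiation hn hκ) hn hκ hsD hsC
  have h2 := (D.weakHelmholtz_pot hn κ).reciprocity (C.weakHelmholtz_pot hn κ) hp
    (C.contDiff_pot hn κ) (D.tendsto_radiation hn hκ) (C.tendsto_radiation hn hκ) hn hκ hsD hsC
  have h3 := h1.trans h2.symm
  rw [C.integral_indicator_weight_mul, C.integral_indicator_weight_mul] at h3
  simp_rw [C, weight_cube, one_mul] at h3
  rw [integral_sub (C.integrableOn_box hu.continuous) (C.integrableOn_box hp.continuous), h3,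
    sub_self]

end Uniqueness

/-! ### Specialisation to the density built from η -/

section Assembly

variable {n : ℕ}

theorem contDiff_eta (M : ℕ) : ContDiff ℝ 1 (eta M) := by
  unfold eta
  refine (contDiff_const.mul (Polynomial.contDiff_aeval _ _)).mul ?_
  exact (contDiff_id.pow 2).neg.exp

/-- The profile of the density `∏_j χ_{(P_j,Q_j)}(x_j) η_{2M}(a_j x_j)`. -/
noncomputable def etaProfile (M : ℕ) (a P Q : Fin n → ℝ) (hPQ : ∀ j, P j ≤ Q j) :
    BoxProfile n where
  g := fun j y => eta M (a j * y)
  p := P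
  r := Q
  contDiff := fun _ => (contDiff_eta M).comp (contDiff_const.mul contDiff_id)
  le := hPQ

/-- Coordinate hyperplanes are null; hence the open box of the density may be exchanged for the
half-open `box`. -/
theorem ae_coord_ne (b : Fin n → ℝ) : ∀ᵐ x : EuclideanSpace ℝ (Fin n), ∀ j, x j ≠ b j := by
  rw [ae_all_iff]
  intro j
  have h1 : Measure.QuasiMeasurePreserving (fun x : EuclideanSpace ℝ (Fin n) => x j)
      volume volume :=
    (Measure.quasiMeasurePreserving_eval (fun _ : Fin n => (volume : Measure ℝ)) j).comp
      (PiLp.volume_preserving_ofLp (Fin n)).quasiMeasurePreserving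
  exact h1.ae (compl_mem_ae_iff.2 (measure_singleton (b j)))

theorem boxDensity_ae_eq (M : ℕ) (a P Q : Fin n → ℝ) (hPQ : ∀ j, P j ≤ Q j) :
    (fun x => (boxDensity M a P Q x : ℂ)) =ᵐ[volume]
      (etaProfile M a P Q hPQ).box.indicator (etaProfile M a P Q hPQ).weight := by
  filter_upwards [ae_coord_ne Q] with x hx
  by_cases h : x ∈ (etaProfile M a P Q hPQ).box
  · rw [Set.indicator_of_mem h, boxDensity, BoxProfile.weight]
    push_cast
    refine Finset.prod_congr rfl fun j _ => ?_
    have hj : x j ∈ Set.Ioo (P j) (Q j) := ⟨(h j).1, lt_of_le_of_ne (h j).2 (hx j)⟩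
    rw [Set.indicator_of_mem hj]
    simp [etaProfile]
  · rw [Set.indicator_of_notMem h, boxDensity]
    have h' : ∃ j, x j ∉ Set.Ioc (P j) (Q j) := by
      by_contra! hc
      exact h hc
    obtain ⟨j, hj⟩ := h'
    have hj' : x j ∉ Set.Ioo (P j) (Q j) := fun hm => hj ⟨hm.1, hm.2.le⟩
    rw [Finset.prod_eq_zero (Finset.mem_univ j), Complex.ofReal_zero]
    rw [Set.indicator_of_notMem hj', zero_mul]

theorem potentialIntegrand_eq {M : ℕ} (hM : 1 ≤ M) (κ : ℝ) {a P Q : Fin n → ℝ}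
    (ha : ∀ j, 0 < a j) (hPQ : ∀ j, P j ≤ Q j) (x : EuclideanSpace ℝ (Fin n)) {t : ℝ}
    (ht : 0 < t) : potentialIntegrand M κ a P Q x t =
      phase κ t * (etaProfile M a P Q hPQ).wave x t := by
  rw [potentialIntegrand, phase, BoxProfile.wave]
  congr 1
  exact Finset.prod_congr rfl fun j _ => Psi_sub_Psi M hM (a j) (P j) (Q j) (x j) t (ha j) ht

theorem pot_etaProfile {M : ℕ} (hM : 1 ≤ M) (κ : ℝ) {a P Q : Fin n → ℝ}
    (ha : ∀ j, 0 < a j) (hPQ : ∀ j, P j ≤ Q j) (x : EuclideanSpace ℝ (Fin n)) :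
    (etaProfile M a P Q hPQ).pot κ x =
      Complex.I * ∫ t in Set.Ioi (0 : ℝ), potentialIntegrand M κ a P Q x t := by
  rw [BoxProfile.pot]
  congr 1
  exact (setIntegral_congr_fun measurableSet_Ioi fun t ht =>
    potentialIntegrand_eq hM κ ha hPQ x ht).symm

theorem isRadiatingSolution_pot (M : ℕ) (hn : 3 ≤ n) {κ : ℝ} (hκ : 0 < κ) (a P Q : Fin n → ℝ)
    (hPQ : ∀ j, P j ≤ Q j) :
    IsRadiatingSolution κ (boxDensity M a P Q) ((etaProfile M a P Q hPQ).pot κ) where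
  contDiff := BoxProfile.contDiff_pot _ hn κ
  equation := fun φ hφ hc => by
    rw [BoxProfile.integral_pot_mul_helmholtz _ hn κ φ hφ hc,
      ← BoxProfile.integral_indicator_weight_mul]
    refine (integral_congr_ae ?_).symm
    filter_upwards [boxDensity_ae_eq M a P Q hPQ] with x hx
    rw [hx]
  radiation := BoxProfile.tendsto_radiation _ hn hκ

theorem IsRadiatingSolution.eq_pot {M : ℕ} (hn : 3 ≤ n) {κ : ℝ} (hκ : 0 < κ) {a P Q : Fin n → ℝ}
    (hPQ : ∀ j, P j ≤ Q j) {u : EuclideanSpace ℝ (Fin n) → ℂ}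
    (hu : IsRadiatingSolution κ (boxDensity M a P Q) u) (x : EuclideanSpace ℝ (Fin n)) :
    u x = (etaProfile M a P Q hPQ).pot κ x := by
  refine BoxProfile.eq_pot _ hn hκ hu.contDiff ?_ hu.radiation x
  refine weakHelmholtz_of_distributional hu.contDiff
    (BoxProfile.integrable_indicator_weight _).locallyIntegrable fun φ hφ hc => ?_
  rw [hu.equation φ hφ hc]
  refine integral_congr_ae ?_
  filter_upwards [boxDensity_ae_eq M a P Q hPQ] with x hx
  rw [hx]

end Assembly

end Diffraction

theorem theorem3 (n M : ℕ) (hn : 3 ≤ n) (hM : 1 ≤ M) (κ : ℝ) (hκ : 0 < κ)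
    (a P Q : Fin n → ℝ) (ha : ∀ j, 0 < a j) (hPQ : ∀ j, P j ≤ Q j) :
    (∀ x : EuclideanSpace ℝ (Fin n),
      IntegrableOn (Diffraction.potentialIntegrand M κ a P Q x) (Set.Ioi (0 : ℝ))) ∧
    ∀ u : EuclideanSpace ℝ (Fin n) → ℂ,
      Diffraction.IsRadiatingSolution κ (Diffraction.boxDensity M a P Q) u ↔
        ∀ x, u x = Complex.I *
          ∫ t in Set.Ioi (0 : ℝ), Diffraction.potentialIntegrand M κ a P Q x t := by
  -- In the equivalence, the forward direction is uniqueness and the backward direction is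
  -- existence.
  refine ⟨fun x => ?_, fun u => ⟨fun hu x => ?_, fun hu => ?_⟩⟩
  · exact ((Diffraction.etaProfile M a P Q hPQ).integrableOn_phase_wave hn κ x).congr_fun
      (fun t ht => (Diffraction.potentialIntegrand_eq hM κ ha hPQ x ht).symm) measurableSet_Ioi
  · rw [hu.eq_pot hn hκ hPQ x, Diffraction.pot_etaProfile hM κ ha hPQ x]
  · have : u = (Diffraction.etaProfile M a P Q hPQ).pot κ := by
      funext x
      rw [hu x, Diffraction.pot_etaProfile hM κ ha hPQ x]
    rw [this]
    exact Diffraction.isRadiatingSolution_pot M hn hκ a P Q hPQ
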